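/- Let $\xi$ be a random variable with values in $\{0,1,2,\dots\}$ such that $\mathbb E\,\xi=1$ and $0<\operatorname{Var}\xi<\infty$, and let $\eta$ be an integer-valued random variable such that $\mathbb E\,\eta=0$ and $0<\operatorname{Var}\eta<\infty$, with span $1$, i.e. $1$ is the largest integer $d$ such that $\eta\in d\mathbb Z$ almost surely. Let $\mathcal T$ be the Galton–Watson tree with offspring distribution $\xi$, that is, the random rooted family tree of the branching process started from one individual (the root) in which individuals have independent numbers of children, distributed as $\xi$. For $n\ge1$ with $\mathbb P(|\mathcal T|=n)>0$, let $T_n$ be $\mathcal T$ conditioned on having exactly $n$ vertices. Independently of $T_n$, attach to the edges $e$ of $T_n$ independent copies $\eta_e$ of $\eta$; let the label of a vertex $v$ be the sum of $\eta_e$ over all edges $e$ on the path from the root to $v$ (so the root has label $0$), and let $X(j;T_n)$ be the number of vertices of $T_n$ with label $j$, for $j\in\mathbb Z$. Then there exists a constant $C>0$, depending only on the distributions of $\xi$ and $\eta$, such that for all $n\ge1$ with $\mathbb P(|\mathcal T|=n)>0$ and all $t\in[-\pi,\pi]$, $$\mathbb E\,\Bigl|\frac1n\sum_{j\in\mathbb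 Z}X(j;T_n)\,e^{\mathrm i jt}\Bigr|^2\le\frac{C}{1+nt^4}.$$ -/

import Mathlib

open MeasureTheory ProbabilityTheory

namespace GaltonWatson

/-- Individuals of a genealogy are addressed by lists: `[]` is the root, and `i :: u` is the
`i`-th child (counted from `0`) of the individual `u`. If `c u` is the number of children that
`u` has when it occurs, `IsIndividual c v` says that `v` occurs in the family tree. -/
def IsIndividual (c : List ℕ → ℕ) : List ℕ → Prop
  | [] => True
  | i :: u => IsIndividual c u ∧ i < c u

/-- The (set of vertices of the) family tree with offspring numbers `c`. -/
def familyTree (c : List ℕ → ℕ) : Set (List ℕ) := {v | IsIndividual c v}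

/-- The label of a vertex: the sum of the edge variables over the path from the root to it.
The variable of the edge between `i :: u` and its parent `u` is `y (i :: u)`;
no edge is attached to `[]`, so `y []` is never used. -/
def label (y : List ℕ → ℤ) : List ℕ → ℤ
  | [] => 0
  | i :: u => label y u + y (i :: u)

/-- The vertical profile: the number of vertices with label `j` in the family tree with offspring
numbers `c` and edge variables `y`. -/
noncomputable def verticalProfile (c : List ℕ → ℕ) (y : List ℕ → ℤ) (j : ℤ) : ℕ :=
  {v ∈ familyTree c | label y v = j}.ncard

/-- The distribution `ν` on `ℤ` has span `d`: `d` is the largest integer such that `ν` is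
concentrated on `dℤ`. -/
def HasSpan (ν : Measure ℤ) (d : ℤ) : Prop :=
  IsGreatest {m : ℤ | ∀ᵐ x ∂ν, m ∣ x} d

/-- The event that the family tree with random offspring numbers `N` has exactly `n` vertices. -/
def sizeEvent {Ω : Type*} (N : List ℕ → Ω → ℕ) (n : ℕ) : Set Ω :=
  {ω | (familyTree (fun v => N v ω)).encard = n}

end GaltonWatson

/-! Write `S` for the sum of `exp (i t label)` over the vertices, `f` for the generating function of
`ξ`, and `z`, `w` for the characteristic function of `η` at `t` and `-t`. The quantity to bound is
`E[|S|²; |T| = n] / (n² P(|T| = n))`; it is at most `1`, so a bound of order `1 / (n t⁴)` suffices.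

Decomposing at the root gives equations for the size series `G` of `1`, `U` and `U'` of `S` and its
conjugate, and `V` of `|S|²`: `G = X f(G)`, `U = z X (f(G) + f'(G) U)`, and `V = X (f(G) + f'(G) (U
+ U' + V) + f''(G) U U')` (`sizeSeries_eq`). Solving them and applying Lagrange inversion
(`coeff_twoPoint`) yields, with `h = X f' / f`, `[X^(n+1)] V = [X^n] B f^(n+1) / ((1 - z h) (1 - w
h))`, where `B = 1 - z w h² + z w X² f'' / f`. The geometric series turn this into a double sum over
exponents `a`, `b` of `h`, which play the role of heights.

Only two moments of `ξ` are available, so `f` need not extend beyond the closed unit disc, and `h`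
may have poles there. Hence the double sum is cut at a small multiple of `n`. Terms with a large
exponent are exponentially small by a Cauchy estimate at a radius slightly below `1`, where the gain
from `f'` is of first order in the distance to `1` while the loss from `f(r) / r` is of second order
(`exists_radius`, `norm_coeff_branchFactor_le`). In the other terms the powers of `f` clear all
denominators, so the coefficient is an integral over the unit circle. There `|f(e^{iθ})|^n` decays
like a Gaussian over one period. Near `θ = 0` the two geometric sums cost `1 / (|1 - z| |1 - w|)`,
since `f / (X f')` leaves `1` vertically whereas `z` and `w` stay in a horizontal cone
(`exists_cone_bound`). Integrating the Gaussian gives `O(1 / (√n |1 - z| |1 - w|))`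
(`exists_twoPoint_bound`), and `|1 - z|`, `|1 - w|` are at least of order `t²`
(`exists_intCharFun_bounds`).

Finally `n P(|T| = n) = [X^(n-1)] f^n` (`coeff_pow_eq_size_mul`) is at least of order `1 / √n` along
the admissible sizes, by a local limit argument (`exists_coeff_pow_lower_bound`). Dividing cancels
the two factors `1 / √n` and leaves `1 / (n t⁴)`. -/

namespace PowerSeries

/-! ### Lagrange inversion and the two-point series -/

/-- The Lagrange–Bürmann formula: if `G = X f(G)` and `W (1 - X f'(G)) = H(G)`, then
`[X ^ n] W = [X ^ n] (H f ^ n)`. -/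
theorem coeff_eq_coeff_mul_pow_of_subst {K : Type*} [Field K] [CharZero K] {f G : K⟦X⟧}
    (hG0 : constantCoeff G = 0) (hG : G = X * f.subst G) (n : ℕ) (H W : K⟦X⟧)
    (hW : W * (1 - X * (d⁄dX K f).subst G) = H.subst G) :
    coeff n W = coeff n (H * f ^ n) := by
  have hs : HasSubst G := HasSubst.of_constantCoeff_zero' hG0
  set D : K⟦X⟧ := 1 - X * (d⁄dX K f).subst G with hD
  have hD0 : constantCoeff D ≠ 0 := by simp [hD]
  have hDi : D * D⁻¹ = 1 := PowerSeries.mul_inv_cancel _ hD0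
  have hsolve (H : K⟦X⟧) : H.subst G * D⁻¹ * D = H.subst G := by
    rw [mul_assoc, mul_comm D⁻¹, hDi, mul_one]
  induction n generalizing H W with
  | zero =>
    have h1 := congrArg (coeff 0) hW
    simp only [hD, coeff_zero_eq_constantCoeff, map_mul, map_sub, map_one, constantCoeff_X,
      zero_mul, sub_zero, mul_one] at h1
    have h2 : H = C (constantCoeff H) + X * (mk fun p => coeff (p + 1) H) := by
      rw [add_comm]; exact eq_X_mul_shift_add_const H
    simp only [pow_zero, mul_one, coeff_zero_eq_constantCoeff]
    rw [h1]
    conv_lhs => rw [h2, subst_add hs, subst_mul hs, subst_X hs]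
    rw [subst_C, map_add, map_mul, hG0, zero_mul, add_zero]
    exact constantCoeff_C _
  | succ n ih =>
    have h2 : H = C (constantCoeff H) + X * (mk fun p => coeff (p + 1) H) := by
      rw [add_comm]; exact eq_X_mul_shift_add_const H
    set H' : K⟦X⟧ := mk fun p => coeff (p + 1) H
    set c : K := constantCoeff H
    -- Write `H = c + X H'`. Since `1 = D + X f'(G)` and `G H'(G) = X (f H')(G)`, the solution `W =
    -- H(G) / D` is `c` plus `X` times two solutions of the same kind, for `c f'` and `f H'`. This
    -- is what the induction on `n` consumes.
    have hWeq : W = C c + X * (C c * ((d⁄dX K f).subst G * D⁻¹))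
        + X * ((f * H').subst G * D⁻¹) := by
      have h3 : W = W * D * D⁻¹ := by rw [mul_assoc, hDi, mul_one]
      rw [h3, hW, h2, subst_add hs, subst_mul hs, subst_X hs, subst_C, subst_mul hs]
      have h4 : (C c : K⟦X⟧) = C c * (D * D⁻¹) := by rw [hDi, mul_one]
      have h5 : X * (d⁄dX K f).subst G = 1 - D := by rw [hD]; ring
      have h6 : (MvPowerSeries.C c : K⟦X⟧) = C c := rfl
      rw [h6]
      calc (C c + G * H'.subst G) * D⁻¹
          = C c * D⁻¹ + (X * f.subst G) * H'.subst G * D⁻¹ := by rw [← hG]; ring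
        _ = C c * (D * D⁻¹) + C c * (1 - D) * D⁻¹ + (X * f.subst G) * H'.subst G * D⁻¹ := by ring
        _ = _ := by rw [← h4, ← h5]; ring
    have hder : coeff (n + 1) (f ^ (n + 1)) = coeff n (d⁄dX K f * f ^ n) := by
      have h7 : coeff n (d⁄dX K (f ^ (n + 1))) = coeff (n + 1) (f ^ (n + 1)) * (n + 1) := by
        rw [coeff_derivative]
      have h8 : d⁄dX K (f ^ (n + 1)) = C ((n : K) + 1) * (d⁄dX K f * f ^ n) := by
        rw [Derivation.leibniz_pow]
        simp only [Nat.add_sub_cancel, nsmul_eq_mul, smul_eq_mul, map_add, map_natCast, map_one]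
        push_cast
        ring
      rw [h8, coeff_C_mul] at h7
      have h9 : (n : K) + 1 ≠ 0 := by exact_mod_cast Nat.succ_ne_zero n
      rw [mul_comm] at h7
      exact (mul_right_cancel₀ h9 h7).symm
    rw [hWeq, h2]
    simp only [map_add, add_mul, coeff_succ_X_mul, coeff_C_mul, mul_assoc]
    rw [ih _ _ (hsolve _), ih _ _ (hsolve _), hder]
    have : f * H' * f ^ n = H' * f ^ (n + 1) := by ring
    rw [this]
    simp

/-- Modulo `X ^ n`, the inverse of `1 - g` is a truncated geometric series if `X ∣ g`. -/
theorem X_pow_dvd_inv_one_sub_sub_geom {K : Type*} [Field K] {g : K⟦X⟧} (hg : X ∣ g) (n : ℕ) :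
    X ^ n ∣ (1 - g)⁻¹ - ∑ a ∈ Finset.range n, g ^ a := by
  have h0 : constantCoeff (1 - g) ≠ 0 := by
    simp [X_dvd_iff.1 hg]
  have h1 : (1 - g)⁻¹ - ∑ a ∈ Finset.range n, g ^ a = g ^ n * (1 - g)⁻¹ := by
    have h2 : (∑ a ∈ Finset.range n, g ^ a) * (1 - g) = 1 - g ^ n := geom_sum_mul_neg g n
    have h3 : (1 - g) * (1 - g)⁻¹ = 1 := PowerSeries.mul_inv_cancel _ h0
    calc _ = (1 - g)⁻¹ - (∑ a ∈ Finset.range n, g ^ a) * ((1 - g) * (1 - g)⁻¹) := by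
            rw [h3, mul_one]
      _ = (1 - g)⁻¹ - (1 - g ^ n) * (1 - g)⁻¹ := by rw [← mul_assoc, h2]
      _ = _ := by ring
  rw [h1]
  exact (pow_dvd_pow_of_dvd hg n).mul_right _

section TwoPoint

variable {K : Type*} [Field K]

/-- The logarithmic derivative `X f' / f`. -/
noncomputable def logDer (f : K⟦X⟧) : K⟦X⟧ := X * d⁄dX K f * f⁻¹

/-- The factor `1 - q (X f' / f) ^ 2 + q X ^ 2 f'' / f`. -/
noncomputable def branchFactor (f : K⟦X⟧) (q : K) : K⟦X⟧ :=
  1 - C q * logDer f ^ 2 + C q * (X ^ 2 * d⁄dX K (d⁄dX K f) * f⁻¹)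

theorem X_dvd_logDer (f : K⟦X⟧) : X ∣ logDer f := ⟨d⁄dX K f * f⁻¹, by rw [logDer, mul_assoc]⟩

/-- The coefficients of the one-point series. -/
theorem coeff_onePoint [CharZero K] {f G U : K⟦X⟧}
    (hG0 : constantCoeff G = 0) (hG : G = X * f.subst G)
    (hU : U = X * (f.subst G + (d⁄dX K f).subst G * U)) (n : ℕ) :
    coeff (n + 1) U = coeff n (f ^ (n + 1)) := by
  have hs : HasSubst G := HasSubst.of_constantCoeff_zero' hG0
  have h1 := coeff_eq_coeff_mul_pow_of_subst hG0 hG (n + 1) X U (by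
    rw [subst_X hs]
    have h2 : U * (1 - X * (d⁄dX K f).subst G)
      = U - X * (f.subst G + (d⁄dX K f).subst G * U) + X * f.subst G := by ring
    rw [h2, ← hU, ← hG]; ring)
  rw [h1, coeff_succ_X_mul]

/-- The coefficients of the two-point series of the family tree, as a double sum. -/
theorem coeff_twoPoint [CharZero K] {f G U U' V : K⟦X⟧} {z w : K} (hf : constantCoeff f ≠ 0)
    (hG0 : constantCoeff G = 0) (hG : G = X * f.subst G)
    (hU : U = C z * (X * (f.subst G + (d⁄dX K f).subst G * U)))
    (hU' : U' = C w * (X * (f.subst G + (d⁄dX K f).subst G * U')))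
    (hV : V = X * (f.subst G + (d⁄dX K f).subst G * (U + U' + V)
      + (d⁄dX K (d⁄dX K f)).subst G * (U * U'))) (n : ℕ) :
    coeff (n + 1) V = ∑ a ∈ Finset.range (n + 1), ∑ b ∈ Finset.range (n + 1),
      z ^ a * w ^ b * coeff n (branchFactor f (z * w) * logDer f ^ (a + b) * f ^ (n + 1)) := by
  have hs : HasSubst G := HasSubst.of_constantCoeff_zero' hG0
  set f1 := d⁄dX K f with hf1
  set f2 := d⁄dX K f1 with hf2
  set h := logDer f with hh
  have hfi : f * f⁻¹ = 1 := PowerSeries.mul_inv_cancel _ hf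
  have hff : f * h = X * f1 := by rw [hh, logDer, mul_left_comm, hfi, mul_one]
  have hXh : X ∣ h := X_dvd_logDer f
  have hne (z : K) : constantCoeff (1 - C z * h) ≠ 0 := by simp [X_dvd_iff.1 hXh]
  have hinv (z : K) : (1 - C z * h) * (1 - C z * h)⁻¹ = 1 := PowerSeries.mul_inv_cancel _ (hne z)
  -- Substitute `G` into `f h = X f'` and cancel `f(G)`, using `G = X f(G)`.
  have hXf : X * f1.subst G = h.subst G := by
    have h1 := congrArg (subst G) hff
    rw [subst_mul hs, subst_mul hs, subst_X hs] at h1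
    have hne' : f.subst G ≠ 0 := by
      intro h0
      rw [h0, mul_zero] at hG
      rw [hG] at h0
      have h3 := subst_mul (hG ▸ hs : HasSubst (0 : K⟦X⟧)) f f⁻¹
      rw [hfi, h0, zero_mul, ← coe_substAlgHom (hG ▸ hs : HasSubst (0 : K⟦X⟧)), map_one] at h3
      exact one_ne_zero h3
    have h4 : (X * f1.subst G) * f.subst G = h.subst G * f.subst G := by
      calc _ = (X * f.subst G) * f1.subst G := by ring
        _ = f.subst G * h.subst G := by rw [← hG, h1]
        _ = _ := mul_comm _ _
    exact mul_right_cancel₀ hne' h4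
  have hsubC (z : K) : (C z : K⟦X⟧).subst G = C z := subst_C z
  have hone : (1 : K⟦X⟧).subst G = 1 := by rw [← coe_substAlgHom hs, map_one]
  have key (z : K) (U : K⟦X⟧) (hU : U = C z * (X * (f.subst G + f1.subst G * U))) :
      U = (C z * X * (1 - C z * h)⁻¹).subst G := by
    have h1 : U * (1 - C z * h.subst G) = C z * G := by
      rw [← hXf]
      have : U * (1 - C z * (X * f1.subst G))
        = U - C z * (X * (f.subst G + f1.subst G * U)) + C z * (X * f.subst G) := by ring
      rw [this, ← hU, ← hG]; ring
    have h2 : (1 - C z * h.subst G) * ((1 - C z * h)⁻¹).subst G = 1 := by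
      have := congrArg (subst G) (hinv z)
      rwa [subst_mul hs, subst_sub hs, subst_mul hs, hsubC, hone] at this
    calc U = U * ((1 - C z * h.subst G) * ((1 - C z * h)⁻¹).subst G) := by rw [h2, mul_one]
      _ = (U * (1 - C z * h.subst G)) * ((1 - C z * h)⁻¹).subst G := by ring
      _ = _ := by rw [h1, subst_mul hs, subst_mul hs, subst_X hs, hsubC]
  set I := (1 - C z * h)⁻¹ with hI
  set J := (1 - C w * h)⁻¹ with hJ
  have hIz : (1 - C z * h) * I = 1 := hinv z
  have hJw : (1 - C w * h) * J = 1 := hinv w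
  have hUe := key z U hU
  have hUe' := key w U' hU'
  have hXf2 : X * f2.subst G * (G * G) = (X * X ^ 2 * f2 * f⁻¹).subst G := by
    have h1 : (f⁻¹).subst G * f.subst G = 1 := by
      rw [← subst_mul hs, mul_comm, hfi, hone]
    rw [subst_mul hs, subst_mul hs, subst_mul hs, subst_pow hs, subst_X hs]
    calc X * f2.subst G * (G * G) = X * f2.subst G * (G * G) * ((f⁻¹).subst G * f.subst G) := by
            rw [h1, mul_one]
      _ = (X * f.subst G) * G ^ 2 * f2.subst G * (f⁻¹).subst G := by ring
      _ = _ := by rw [← hG]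
  -- With `I = 1 / (1 - z h)` and `J = 1 / (1 - w h)`, the identity `1 + z h I + w h J = (1 - z w
  -- h²) I J` combines the terms without `f''`; adding the `f''` term produces `branchFactor`.
  have hW := coeff_eq_coeff_mul_pow_of_subst hG0 hG (n + 1)
    (X * (branchFactor f (z * w) * (I * J))) V (by
      have e1 : V * (1 - X * f1.subst G) = V - X * (f.subst G + f1.subst G * (U + U' + V)
        + f2.subst G * (U * U')) + X * f.subst G + X * f1.subst G * (U + U')
        + X * f2.subst G * (U * U') := by ring
      rw [e1, ← hV, ← hG, hUe, hUe', hXf]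
      have e2 : X * f2.subst G * ((C z * X * I).subst G * (C w * X * J).subst G)
          = (X * X ^ 2 * f2 * f⁻¹ * (C z * C w * (I * J))).subst G := by
        rw [subst_mul hs (X * X ^ 2 * f2 * f⁻¹), ← hXf2]
        simp only [subst_mul hs, subst_X hs, hsubC]
        ring
      rw [e2]
      conv_lhs =>
        enter [1, 1]
        rw [sub_self, zero_add, ← subst_X hs (R := K)]
      rw [← subst_add hs, ← subst_mul hs, ← subst_add hs, ← subst_add hs]
      congr 1
      rw [branchFactor, ← hh, map_mul]
      linear_combination (-X * (1 + C w * h * J)) * hIz + (-X * I) * hJw)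
  rw [hW, mul_assoc X, coeff_succ_X_mul]
  -- As `X` divides `h`, exponents above `n` cannot contribute to the coefficient of order `n`.
  have hd (z : K) : X ^ (n + 1) ∣ (1 - C z * h)⁻¹ - ∑ a ∈ Finset.range (n + 1), (C z * h) ^ a :=
    X_pow_dvd_inv_one_sub_sub_geom (hXh.mul_left _) _
  obtain ⟨p, hp⟩ := hd z
  obtain ⟨r, hr⟩ := hd w
  rw [← hI, sub_eq_iff_eq_add] at hp
  rw [← hJ, sub_eq_iff_eq_add] at hr
  set S := ∑ a ∈ Finset.range (n + 1), (C z * h) ^ a with hS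
  set T := ∑ a ∈ Finset.range (n + 1), (C w * h) ^ a with hT
  set Q := branchFactor f (z * w)
  have e3 : Q * (I * J) * f ^ (n + 1)
      = X ^ (n + 1) * (Q * (p * J + S * r) * f ^ (n + 1)) + Q * (S * T) * f ^ (n + 1) := by
    rw [hp, hr]; ring
  have e4 : Q * (S * T) * f ^ (n + 1) = ∑ a ∈ Finset.range (n + 1), ∑ b ∈ Finset.range (n + 1),
      C (z ^ a * w ^ b) * (Q * h ^ (a + b) * f ^ (n + 1)) := by
    rw [hS, hT, Finset.sum_mul_sum, Finset.mul_sum, Finset.sum_mul]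
    refine Finset.sum_congr rfl fun a _ => ?_
    rw [Finset.mul_sum, Finset.sum_mul]
    refine Finset.sum_congr rfl fun b _ => ?_
    simp only [map_mul, map_pow]
    ring
  rw [e3, e4, map_add, X_pow_dvd_iff.1 (dvd_mul_right _ _) n n.lt_succ_self, zero_add, map_sum]
  · refine Finset.sum_congr rfl fun a _ => ?_
    rw [map_sum]
    refine Finset.sum_congr rfl fun b _ => ?_
    rw [coeff_C_mul]

theorem logDer_pow_mul_pow {f : K⟦X⟧} (hf : constantCoeff f ≠ 0) (k l : ℕ) :
    logDer f ^ k * f ^ (k + l) = (X * d⁄dX K f) ^ k * f ^ l := by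
  have hfi : f⁻¹ * f = 1 := PowerSeries.inv_mul_cancel _ hf
  rw [logDer, mul_pow, pow_add]
  calc _ = (X * d⁄dX K f) ^ k * f ^ l * (f⁻¹ * f) ^ k := by rw [mul_pow f⁻¹]; ring
    _ = _ := by rw [hfi, one_pow, mul_one]

/-- Two further powers of `f` clear the denominators of `branchFactor`. The result is a polynomial
in `f`, `X f'` and `X² f''`, all of which converge on the closed unit disc when `f` has a finite
second moment. -/
theorem branchFactor_mul_logDer_pow_mul_pow {f : K⟦X⟧} (hf : constantCoeff f ≠ 0) (q : K)
    (k l : ℕ) :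
    branchFactor f q * logDer f ^ k * f ^ (k + 2 + l) =
      (X * d⁄dX K f) ^ k * f ^ l * (f ^ 2 - C q * (X * d⁄dX K f) ^ 2
        + C q * (X ^ 2 * d⁄dX K (d⁄dX K f) * f)) := by
  have hfi : f⁻¹ * f = 1 := PowerSeries.inv_mul_cancel _ hf
  have h1 : branchFactor f q * f ^ 2 = f ^ 2 - C q * (X * d⁄dX K f) ^ 2
        + C q * (X ^ 2 * d⁄dX K (d⁄dX K f) * f) := by
    have h2 := logDer_pow_mul_pow hf 2 0
    rw [add_zero, pow_zero, mul_one] at h2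
    rw [← h2, branchFactor]
    calc _ = f ^ 2 - C q * (logDer f ^ 2 * f ^ 2)
          + C q * (X ^ 2 * d⁄dX K (d⁄dX K f) * f) * (f⁻¹ * f) := by ring
      _ = _ := by rw [hfi, mul_one]
  rw [← h1, ← logDer_pow_mul_pow hf k l]
  ring

/-- For `k` close to `n` there are not enough powers of `f` to clear the whole factor at once. Split
into three coefficients, each one either vanishes by order or has enough powers of `f` of its own.
-/
theorem coeff_branchFactor_mul_logDer_pow_mul_pow {f : K⟦X⟧} (hf : constantCoeff f ≠ 0) (q : K)
    (k n : ℕ) :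
    coeff n (branchFactor f q * logDer f ^ k * f ^ (n + 1)) =
      coeff n (logDer f ^ k * f ^ (n + 1)) - q * coeff n (logDer f ^ (k + 2) * f ^ (n + 1))
      + q * coeff n (X ^ 2 * d⁄dX K (d⁄dX K f) * (logDer f ^ k * f ^ n)) := by
  have hfi : f⁻¹ * f = 1 := PowerSeries.inv_mul_cancel _ hf
  rw [← coeff_C_mul, ← coeff_C_mul, ← map_sub, ← map_add, branchFactor]
  congr 1
  linear_combination (C q * X ^ 2 * d⁄dX K (d⁄dX K f) * (logDer f ^ k * f ^ n)) * hfi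

theorem coeff_logDer_pow_mul_of_lt {f : K⟦X⟧} {k n : ℕ} (h : n < k) (p : K⟦X⟧) :
    coeff n (logDer f ^ k * p) = 0 :=
  X_pow_dvd_iff.1 ((pow_dvd_pow_of_dvd (X_dvd_logDer f) k).mul_right p) n h

end TwoPoint

end PowerSeries

/-! ### Absolutely summable series on the closed unit disc -/

namespace PowerSeries

/-- The coefficients of `p` are absolutely summable. -/
def AbsSummable (p : ℂ⟦X⟧) : Prop := Summable fun k => ‖coeff k p‖

/-- The sum of `p` at the point `x`. -/
noncomputable def evalAt (x : ℂ) (p : ℂ⟦X⟧) : ℂ := ∑' k, coeff k p * x ^ k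

/-- The sum of the absolute values of the terms of `p` at radius `r`. -/
noncomputable def radiusNorm (r : ℝ) (p : ℂ⟦X⟧) : ℝ := ∑' k, ‖coeff k p‖ * r ^ k

/-- All exponents of `p` are multiples of `d`. -/
def SupportedOn (d : ℕ) (p : ℂ⟦X⟧) : Prop := ∀ k, coeff k p ≠ 0 → d ∣ k

namespace AbsSummable

variable {p q : ℂ⟦X⟧}

theorem add (hp : AbsSummable p) (hq : AbsSummable q) : AbsSummable (p + q) :=
  Summable.of_nonneg_of_le (fun _ => norm_nonneg _)
    (fun k => by rw [map_add]; exact norm_add_le _ _) (Summable.add hp hq)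

theorem sub (hp : AbsSummable p) (hq : AbsSummable q) : AbsSummable (p - q) :=
  Summable.of_nonneg_of_le (fun _ => norm_nonneg _)
    (fun k => by rw [map_sub]; exact norm_sub_le _ _) (Summable.add hp hq)

theorem mul (hp : AbsSummable p) (hq : AbsSummable q) : AbsSummable (p * q) := by
  refine (summable_norm_sum_mul_antidiagonal_of_summable_norm hp hq).congr fun k => ?_
  rw [coeff_mul]

theorem C (c : ℂ) : AbsSummable (PowerSeries.C c) :=
  summable_of_ne_finset_zero (s := {0}) fun k hk => by
    rw [coeff_C, if_neg (by simpa using hk), norm_zero]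

theorem one : AbsSummable 1 := C 1

theorem X : AbsSummable X :=
  summable_of_ne_finset_zero (s := {1}) fun k hk => by
    rw [coeff_X, if_neg (by simpa using hk), norm_zero]

theorem pow (hp : AbsSummable p) (k : ℕ) : AbsSummable (p ^ k) := by
  induction k with
  | zero => simpa using one
  | succ k ih => rw [pow_succ]; exact ih.mul hp

theorem summable_radius (hp : AbsSummable p) {r : ℝ} (h0 : 0 ≤ r) (h1 : r ≤ 1) :
    Summable fun k => ‖coeff k p‖ * r ^ k :=
  Summable.of_nonneg_of_le (fun _ => by positivity)
    (fun k => mul_le_of_le_one_right (norm_nonneg _) (pow_le_one₀ h0 h1)) hp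

theorem summable_norm_eval (hp : AbsSummable p) {x : ℂ} (hx : ‖x‖ ≤ 1) :
    Summable fun k => ‖coeff k p * x ^ k‖ := by
  simpa [norm_mul, norm_pow] using hp.summable_radius (norm_nonneg x) hx

theorem eval_add (hp : AbsSummable p) (hq : AbsSummable q) {x : ℂ} (hx : ‖x‖ ≤ 1) :
    evalAt x (p + q) = evalAt x p + evalAt x q := by
  rw [evalAt, evalAt, evalAt, ← (hp.summable_norm_eval hx).of_norm.tsum_add
    (hq.summable_norm_eval hx).of_norm]
  simp [add_mul]

theorem eval_sub (hp : AbsSummable p) (hq : AbsSummable q) {x : ℂ} (hx : ‖x‖ ≤ 1) :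
    evalAt x (p - q) = evalAt x p - evalAt x q := by
  rw [evalAt, evalAt, evalAt, ← (hp.summable_norm_eval hx).of_norm.tsum_sub
    (hq.summable_norm_eval hx).of_norm]
  simp [sub_mul]

theorem eval_mul (hp : AbsSummable p) (hq : AbsSummable q) {x : ℂ} (hx : ‖x‖ ≤ 1) :
    evalAt x (p * q) = evalAt x p * evalAt x q := by
  rw [evalAt, evalAt, evalAt, tsum_mul_tsum_eq_tsum_sum_antidiagonal_of_summable_norm
    (hp.summable_norm_eval hx) (hq.summable_norm_eval hx)]
  refine tsum_congr fun n => ?_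
  rw [coeff_mul, Finset.sum_mul]
  refine Finset.sum_congr rfl fun kl hkl => ?_
  rw [← Finset.HasAntidiagonal.mem_antidiagonal.1 hkl, pow_add]
  ring

theorem _root_.PowerSeries.evalAt_C (x c : ℂ) : evalAt x (PowerSeries.C c) = c := by
  rw [evalAt, tsum_eq_single 0 fun k hk => by rw [coeff_C, if_neg hk, zero_mul]]
  simp

theorem _root_.PowerSeries.evalAt_X (x : ℂ) : evalAt x PowerSeries.X = x := by
  rw [evalAt, tsum_eq_single 1 fun k hk => by rw [coeff_X, if_neg hk, zero_mul]]
  simp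

theorem eval_pow (hp : AbsSummable p) (k : ℕ) {x : ℂ} (hx : ‖x‖ ≤ 1) :
    evalAt x (p ^ k) = evalAt x p ^ k := by
  induction k with
  | zero => simpa using evalAt_C x 1
  | succ k ih => rw [pow_succ, (hp.pow k).eval_mul hp hx, ih, pow_succ]

theorem radiusNorm_mul_le (hp : AbsSummable p) (hq : AbsSummable q) {r : ℝ} (h0 : 0 ≤ r)
    (h1 : r ≤ 1) : radiusNorm r (p * q) ≤ radiusNorm r p * radiusNorm r q := by
  have hsp := hp.summable_radius h0 h1
  have hsq := hq.summable_radius h0 h1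
  have hn (p : ℂ⟦X⟧) : (fun k => ‖‖coeff k p‖ * r ^ k‖) = fun k => ‖coeff k p‖ * r ^ k := by
    ext k; rw [Real.norm_of_nonneg (by positivity)]
  have hsp' : Summable fun k => ‖‖coeff k p‖ * r ^ k‖ := by rwa [hn]
  have hsq' : Summable fun k => ‖‖coeff k q‖ * r ^ k‖ := by rwa [hn]
  rw [radiusNorm, radiusNorm, radiusNorm,
    tsum_mul_tsum_eq_tsum_sum_antidiagonal_of_summable_norm hsp' hsq']
  refine ((hp.mul hq).summable_radius h0 h1).tsum_le_tsum (fun n => ?_)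
    (summable_norm_sum_mul_antidiagonal_of_summable_norm hsp' hsq').of_norm
  rw [coeff_mul]
  refine (mul_le_mul_of_nonneg_right (norm_sum_le _ _) (by positivity)).trans ?_
  rw [Finset.sum_mul]
  refine Finset.sum_le_sum fun kl hkl => ?_
  rw [← Finset.HasAntidiagonal.mem_antidiagonal.1 hkl, pow_add, norm_mul]
  exact le_of_eq (by ring)

theorem _root_.PowerSeries.radiusNorm_nonneg (p : ℂ⟦X⟧) {r : ℝ} (h0 : 0 ≤ r) :
    0 ≤ radiusNorm r p := tsum_nonneg fun _ => by positivity

theorem radiusNorm_pow_le (hp : AbsSummable p) (k : ℕ) {r : ℝ} (h0 : 0 ≤ r) (h1 : r ≤ 1) :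
    radiusNorm r (p ^ k) ≤ radiusNorm r p ^ k := by
  induction k with
  | zero =>
    rw [pow_zero, pow_zero, radiusNorm, tsum_eq_single 0 fun k hk => by
      rw [coeff_one, if_neg hk, norm_zero, zero_mul]]
    simp
  | succ k ih =>
    rw [pow_succ, pow_succ]
    exact ((hp.pow k).radiusNorm_mul_le hp h0 h1).trans
      (mul_le_mul_of_nonneg_right ih (radiusNorm_nonneg p h0))

theorem norm_coeff_mul_pow_le (hp : AbsSummable p) (k : ℕ) {r : ℝ} (h0 : 0 ≤ r) (h1 : r ≤ 1) :
    ‖coeff k p‖ * r ^ k ≤ radiusNorm r p :=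
  (hp.summable_radius h0 h1).le_tsum k fun _ _ => by positivity

theorem norm_evalAt_le (hp : AbsSummable p) {x : ℂ} (hx : ‖x‖ ≤ 1) :
    ‖evalAt x p‖ ≤ radiusNorm 1 p := by
  refine (norm_tsum_le_tsum_norm (hp.summable_norm_eval hx)).trans ?_
  refine (hp.summable_norm_eval hx).tsum_le_tsum (fun k => ?_)
    (hp.summable_radius zero_le_one le_rfl)
  rw [norm_mul, norm_pow, one_pow]
  exact mul_le_mul_of_nonneg_left (pow_le_one₀ (norm_nonneg _) hx) (norm_nonneg _)

theorem norm_exp_I_mul_le (θ : ℝ) : ‖Complex.exp (Complex.I * θ)‖ ≤ 1 := by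
  rw [mul_comm, Complex.norm_exp_ofReal_mul_I]

theorem continuous_evalAt_exp (hp : AbsSummable p) :
    Continuous fun θ : ℝ => evalAt (Complex.exp (Complex.I * θ)) p := by
  refine continuous_tsum (fun k => by fun_prop) hp fun k θ => ?_
  rw [norm_mul, norm_pow]
  exact mul_le_of_le_one_right (norm_nonneg _) (pow_le_one₀ (norm_nonneg _) (norm_exp_I_mul_le θ))

end AbsSummable

namespace SupportedOn

variable {p q : ℂ⟦X⟧} {d : ℕ}

theorem add (hp : SupportedOn d p) (hq : SupportedOn d q) : SupportedOn d (p + q) := fun k hk => by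
  by_contra h
  refine hk ?_
  rw [map_add, not_not.1 (mt (hp k) h), not_not.1 (mt (hq k) h), add_zero]

theorem sub (hp : SupportedOn d p) (hq : SupportedOn d q) : SupportedOn d (p - q) := fun k hk => by
  by_contra h
  refine hk ?_
  rw [map_sub, not_not.1 (mt (hp k) h), not_not.1 (mt (hq k) h), sub_zero]

theorem mul (hp : SupportedOn d p) (hq : SupportedOn d q) : SupportedOn d (p * q) := fun k hk => by
  rw [coeff_mul] at hk
  obtain ⟨⟨i, j⟩, hij, h⟩ := Finset.exists_ne_zero_of_sum_ne_zero hk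
  rw [← Finset.HasAntidiagonal.mem_antidiagonal.1 hij]
  exact dvd_add (hp _ (left_ne_zero_of_mul h)) (hq _ (right_ne_zero_of_mul h))

theorem C (c : ℂ) : SupportedOn d (PowerSeries.C c) := fun k hk => by
  rw [coeff_C] at hk
  split_ifs at hk with h
  · simp [h]
  · exact absurd rfl hk

theorem pow (hp : SupportedOn d p) (k : ℕ) : SupportedOn d (p ^ k) := by
  induction k with
  | zero => simpa using C 1
  | succ k ih => rw [pow_succ]; exact ih.mul hp

/-- The exponents of `X p'` are among those of `p`. -/
theorem X_mul_derivative (hp : SupportedOn d p) : SupportedOn d (X * d⁄dX ℂ p) := fun k hk => by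
  cases k with
  | zero => simp
  | succ k =>
    rw [coeff_succ_X_mul, coeff_derivative] at hk
    exact hp _ (left_ne_zero_of_mul hk)

/-- With the Euler operator `E p = X p'`, which preserves supports, the series in question is `E (E
p) - E p`. -/
theorem X_sq_mul_derivative (hp : SupportedOn d p) :
    SupportedOn d (X ^ 2 * d⁄dX ℂ (d⁄dX ℂ p)) := by
  have h := hp.X_mul_derivative.X_mul_derivative.sub hp.X_mul_derivative
  have h2 : X * d⁄dX ℂ (X * d⁄dX ℂ p) - X * d⁄dX ℂ p = X ^ 2 * d⁄dX ℂ (d⁄dX ℂ p) := by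
    rw [Derivation.leibniz, derivative_X, smul_eq_mul, smul_eq_mul]
    ring
  rwa [h2] at h

theorem sum {ι : Type*} {s : Finset ι} {p : ι → ℂ⟦X⟧} (hp : ∀ i ∈ s, SupportedOn d (p i)) :
    SupportedOn d (∑ i ∈ s, p i) := fun k hk => by
  rw [map_sum] at hk
  obtain ⟨i, hi, h⟩ := Finset.exists_ne_zero_of_sum_ne_zero hk
  exact hp i hi k h

end SupportedOn

/-- Orthogonality over the shortened period `2π / d`. A series supported on multiples of `d` repeats
its values with this period, so the short interval contains just one of the points where the modulus
of the generating function of a law of span `d` returns to `1`. -/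
theorem integral_exp_of_dvd {d : ℕ} (hd : 0 < d) {m : ℤ} (hm : (d : ℤ) ∣ m) :
    ∫ θ in (-(Real.pi / d))..(Real.pi / d), Complex.exp (Complex.I * m * θ) =
      if m = 0 then (2 * Real.pi / d : ℂ) else 0 := by
  split_ifs with h
  · simp [h]
    ring
  · obtain ⟨l, rfl⟩ := hm
    have hd' : (d : ℂ) ≠ 0 := by exact_mod_cast hd.ne'
    have hc : Complex.I * ((d * l : ℤ) : ℂ) ≠ 0 :=
      mul_ne_zero Complex.I_ne_zero (by exact_mod_cast h)
    rw [integral_exp_mul_complex hc]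
    have e1 : Complex.I * ((d * l : ℤ) : ℂ) * ((Real.pi / d : ℝ) : ℂ)
        = Complex.I * ((d * l : ℤ) : ℂ) * ((-(Real.pi / d) : ℝ) : ℂ)
          + l * (2 * Real.pi * Complex.I) := by
      push_cast
      field_simp
      ring
    rw [e1, Complex.exp_add, Complex.exp_int_mul_two_pi_mul_I, mul_one, sub_self, zero_div]

/-- Coefficient extraction over one period of `evalAt (exp (i θ)) p`. -/
theorem AbsSummable.coeff_eq_integral {p : ℂ⟦X⟧} (hp : AbsSummable p) {d n : ℕ} (hd : 0 < d)
    (hpd : SupportedOn d p) (hn : d ∣ n) :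
    coeff n p = (d / (2 * Real.pi) : ℂ) * ∫ θ in (-(Real.pi / d))..(Real.pi / d),
      evalAt (Complex.exp (Complex.I * θ)) p * Complex.exp (-(Complex.I * n * θ)) := by
  have h1 : ∀ k, ∀ θ : ℝ, coeff k p * Complex.exp (Complex.I * θ) ^ k
      * Complex.exp (-(Complex.I * n * θ))
      = coeff k p * Complex.exp (Complex.I * ((k - n : ℤ) : ℂ) * θ) := fun k θ => by
    rw [← Complex.exp_nat_mul, mul_assoc, ← Complex.exp_add]
    push_cast
    congr 2
    ring
  let F : ℕ → C(ℝ, ℂ) := fun k =>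
    ⟨fun θ => coeff k p * Complex.exp (Complex.I * ((k - n : ℤ) : ℂ) * θ), by fun_prop⟩
  have hF := intervalIntegral.hasSum_intervalIntegral_of_summable_norm (a := -(Real.pi / d))
    (b := Real.pi / d) (f := F) (by
      refine Summable.of_nonneg_of_le (fun _ => norm_nonneg _) (fun k => ?_) hp
      rw [ContinuousMap.norm_le _ (norm_nonneg _)]
      intro θ
      simp only [F, ContinuousMap.restrict_apply, ContinuousMap.coe_mk, norm_mul]
      refine mul_le_of_le_one_right (norm_nonneg _) (le_of_eq ?_)
      rw [show Complex.I * ((k - n : ℤ) : ℂ) * ((θ : ℝ) : ℂ)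
        = (((k - n : ℤ) * (θ : ℝ) : ℝ) : ℂ) * Complex.I by push_cast; ring,
        Complex.norm_exp_ofReal_mul_I])
  have h2 : ∫ θ in (-(Real.pi / d))..(Real.pi / d),
      evalAt (Complex.exp (Complex.I * θ)) p * Complex.exp (-(Complex.I * n * θ))
      = ∫ θ in (-(Real.pi / d))..(Real.pi / d), ∑' k, F k θ := by
    congr 1
    ext θ
    rw [evalAt, ← tsum_mul_right]
    exact tsum_congr fun k => h1 k θ
  rw [h2, ← hF.tsum_eq, tsum_eq_single n]
  · have h3 := integral_exp_of_dvd hd (m := 0) (dvd_zero _)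
    simp only [F, ContinuousMap.coe_mk, sub_self]
    rw [intervalIntegral.integral_const_mul, h3, if_pos rfl]
    have hd' : (d : ℂ) ≠ 0 := by exact_mod_cast hd.ne'
    have hpi : (Real.pi : ℂ) ≠ 0 := by exact_mod_cast Real.pi_ne_zero
    field_simp
  · intro k hk
    simp only [F, ContinuousMap.coe_mk]
    rw [intervalIntegral.integral_const_mul]
    by_cases hc : coeff k p = 0
    · rw [hc, zero_mul]
    · rw [integral_exp_of_dvd hd, if_neg (by omega), mul_zero]
      exact dvd_sub (by exact_mod_cast hpd k hc) (by exact_mod_cast hn)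

end PowerSeries

/-! ### The generating function of a critical law -/

namespace PowerSeries

/-- The power series with real coefficients `a`. -/
noncomputable def ofReal (a : ℕ → ℝ) : ℂ⟦X⟧ := mk fun k => (a k : ℂ)

theorem coeff_derivative_ofReal (a : ℕ → ℝ) (k : ℕ) :
    coeff k (d⁄dX ℂ (ofReal a)) = ((a (k + 1) * (k + 1) : ℝ) : ℂ) := by
  rw [coeff_derivative, ofReal, coeff_mk]
  push_cast
  rfl

theorem coeff_derivative_derivative_ofReal (a : ℕ → ℝ) (k : ℕ) :
    coeff k (d⁄dX ℂ (d⁄dX ℂ (ofReal a))) = ((a (k + 2) * (k + 2) * (k + 1) : ℝ) : ℂ) := by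
  rw [coeff_derivative, coeff_derivative_ofReal]
  push_cast
  ring

end PowerSeries

open PowerSeries

/-- `a` is the sequence of point masses of a critical law on `ℕ` with variance `s ∈ (0, ∞)`. -/
structure CriticalWeights (a : ℕ → ℝ) (s : ℝ) : Prop where
  nonneg : ∀ k, 0 ≤ a k
  hasSum : HasSum a 1
  hasSum_mean : HasSum (fun k => a k * k) 1
  hasSum_sq : HasSum (fun k => a k * k ^ 2) (1 + s)
  pos_zero : 0 < a 0
  pos_var : 0 < s

namespace CriticalWeights

variable {a : ℕ → ℝ} {s : ℝ}

theorem hasSum_derivative (h : CriticalWeights a s) :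
    HasSum (fun k : ℕ => a (k + 1) * (k + 1)) 1 := by
  have := (hasSum_nat_add_iff' 1).2 h.hasSum_mean
  simpa using this

theorem hasSum_factorial (h : CriticalWeights a s) :
    HasSum (fun k : ℕ => a k * (k * (k - 1))) s := by
  have := h.hasSum_sq.sub h.hasSum_mean
  rw [add_sub_cancel_left] at this
  have e : (fun k : ℕ => a k * (k * (k - 1) : ℝ)) = fun k => a k * k ^ 2 - a k * k := by
    funext k
    ring
  rwa [e]

theorem hasSum_derivative_derivative (h : CriticalWeights a s) :
    HasSum (fun k : ℕ => a (k + 2) * (k + 2) * (k + 1)) s := by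
  have := (hasSum_nat_add_iff' 2).2 h.hasSum_factorial
  simp only [Finset.sum_range_succ, Finset.sum_range_zero] at this
  norm_num at this
  have e : (fun k : ℕ => a (k + 2) * (k + 2 : ℝ) * (k + 1)) =
      fun k => a (k + 2) * ((k + 2) * (k + 2 - 1)) := by
    funext k
    ring
  rwa [e]

/-- If there were no mass beyond `1`, the second factorial moment `s` would vanish. The atom found
here drives the strict inequalities below. -/
theorem exists_pos (h : CriticalWeights a s) : ∃ k, 2 ≤ k ∧ 0 < a k := by
  by_contra! hc
  have : (fun k : ℕ => a k * (k * (k - 1))) = fun _ => 0 := by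
    ext k
    rcases k with _ | _ | k
    · simp
    · simp
    · rw [le_antisymm (hc (k + 2) (by omega)) (h.nonneg _), zero_mul]
  exact h.pos_var.ne' (h.hasSum_factorial.unique (this ▸ hasSum_zero))

theorem norm_coeff (h : CriticalWeights a s) (k : ℕ) : ‖coeff k (ofReal a)‖ = a k := by
  rw [ofReal, coeff_mk, Complex.norm_real, Real.norm_of_nonneg (h.nonneg k)]

theorem norm_coeff_derivative (h : CriticalWeights a s) (k : ℕ) :
    ‖coeff k (d⁄dX ℂ (ofReal a))‖ = a (k + 1) * (k + 1) := by
  rw [coeff_derivative_ofReal, Complex.norm_real, Real.norm_of_nonneg]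
  exact mul_nonneg (h.nonneg _) (by positivity)

theorem norm_coeff_derivative_derivative (h : CriticalWeights a s) (k : ℕ) :
    ‖coeff k (d⁄dX ℂ (d⁄dX ℂ (ofReal a)))‖ = a (k + 2) * (k + 2) * (k + 1) := by
  rw [coeff_derivative_derivative_ofReal, Complex.norm_real, Real.norm_of_nonneg]
  exact mul_nonneg (mul_nonneg (h.nonneg _) (by positivity)) (by positivity)

theorem absSummable (h : CriticalWeights a s) : AbsSummable (ofReal a) :=
  h.hasSum.summable.congr fun k => (h.norm_coeff k).symm

theorem absSummable_derivative (h : CriticalWeights a s) : AbsSummable (d⁄dX ℂ (ofReal a)) :=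
  h.hasSum_derivative.summable.congr fun k => (h.norm_coeff_derivative k).symm

theorem absSummable_derivative_derivative (h : CriticalWeights a s) :
    AbsSummable (d⁄dX ℂ (d⁄dX ℂ (ofReal a))) :=
  h.hasSum_derivative_derivative.summable.congr
    fun k => (h.norm_coeff_derivative_derivative k).symm

theorem constantCoeff_ne_zero (h : CriticalWeights a s) : constantCoeff (ofReal a) ≠ 0 := by
  rw [← coeff_zero_eq_constantCoeff_apply, ofReal, coeff_mk]
  exact_mod_cast h.pos_zero.ne'

theorem radiusNorm_one (h : CriticalWeights a s) : radiusNorm 1 (ofReal a) = 1 := by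
  simp only [radiusNorm, h.norm_coeff, one_pow, mul_one]
  exact h.hasSum.tsum_eq

theorem radiusNorm_derivative_one (h : CriticalWeights a s) :
    radiusNorm 1 (d⁄dX ℂ (ofReal a)) = 1 := by
  simp only [radiusNorm, h.norm_coeff_derivative, one_pow, mul_one]
  exact h.hasSum_derivative.tsum_eq

theorem radiusNorm_derivative_derivative_le (h : CriticalWeights a s) {r : ℝ} (h0 : 0 ≤ r)
    (h1 : r ≤ 1) : radiusNorm r (d⁄dX ℂ (d⁄dX ℂ (ofReal a))) ≤ s := by
  rw [← h.hasSum_derivative_derivative.tsum_eq]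
  refine (h.absSummable_derivative_derivative.summable_radius h0 h1).tsum_le_tsum (fun k => ?_)
    h.hasSum_derivative_derivative.summable
  rw [h.norm_coeff_derivative_derivative]
  exact mul_le_of_le_one_right
    (mul_nonneg (mul_nonneg (h.nonneg _) (by positivity)) (by positivity)) (pow_le_one₀ h0 h1)

/-- Bernoulli's inequality `r ^ k ≥ 1 - k (1 - r)`, summed against a law of mean `1`. -/
theorem le_radiusNorm (h : CriticalWeights a s) {r : ℝ} (h0 : 0 ≤ r) (h1 : r ≤ 1) :
    r ≤ radiusNorm r (ofReal a) := by
  have h2 : HasSum (fun k => a k - a k * k * (1 - r)) (1 - 1 * (1 - r)) :=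
    h.hasSum.sub (h.hasSum_mean.mul_right _)
  have h3 := h.absSummable.summable_radius h0 h1
  have h4 : (1 - 1 * (1 - r)) ≤ radiusNorm r (ofReal a) := by
    rw [← h2.tsum_eq]
    refine h2.summable.tsum_le_tsum (fun k => ?_) h3
    rw [h.norm_coeff]
    have := one_add_mul_le_pow (a := r - 1) (by linarith) k
    rw [add_sub_cancel] at this
    nlinarith [h.nonneg k]
  linarith

/-- The second-order companion of Bernoulli's inequality. In the induction step the discarded term
is the nonnegative cubic `k (k - 1) / 2 * (1 - r) ^ 3`. -/
theorem pow_le_quadratic {r : ℝ} (h0 : 0 ≤ r) (h1 : r ≤ 1) (k : ℕ) :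
    r ^ k ≤ 1 - k * (1 - r) + k * (k - 1) / 2 * (1 - r) ^ 2 := by
  induction k with
  | zero => simp
  | succ k ih =>
    rw [pow_succ]
    push_cast
    have h2 := mul_le_mul_of_nonneg_right ih h0
    have h3 : 0 ≤ (k : ℝ) * (k - 1) / 2 * (1 - r) ^ 3 := by
      rcases k with _ | k
      · simp
      · push_cast
        have : 0 ≤ 1 - r := by linarith
        rw [add_sub_cancel_right]
        positivity
    nlinarith

theorem radiusNorm_le (h : CriticalWeights a s) {r : ℝ} (h0 : 0 ≤ r) (h1 : r ≤ 1) :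
    radiusNorm r (ofReal a) ≤ r + s * (1 - r) ^ 2 / 2 := by
  have h2 : HasSum (fun k => a k - a k * k * (1 - r) + a k * (k * (k - 1)) * ((1 - r) ^ 2 / 2))
      (1 - 1 * (1 - r) + s * ((1 - r) ^ 2 / 2)) :=
    (h.hasSum.sub (h.hasSum_mean.mul_right _)).add (h.hasSum_factorial.mul_right _)
  have h4 : radiusNorm r (ofReal a) ≤ (1 - 1 * (1 - r) + s * ((1 - r) ^ 2 / 2)) := by
    rw [← h2.tsum_eq]
    refine (h.absSummable.summable_radius h0 h1).tsum_le_tsum (fun k => ?_) h2.summable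
    rw [h.norm_coeff]
    calc _ ≤ a k * (1 - k * (1 - r) + k * (k - 1) / 2 * (1 - r) ^ 2) :=
          mul_le_mul_of_nonneg_left (pow_le_quadratic h0 h1 k) (h.nonneg k)
      _ = _ := by ring
  linarith

/-- At radius `1` the sum is `1`. It is enough to record the loss in one term, of degree `l + 1 ≥
1`, which is at least linear in `1 - r`. -/
theorem radiusNorm_derivative_le (h : CriticalWeights a s) {r : ℝ} (h0 : 0 ≤ r) (h1 : r ≤ 1)
    {l : ℕ} : radiusNorm r (d⁄dX ℂ (ofReal a)) ≤ 1 - a (l + 2) * (l + 2) * (1 - r) := by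
  have h2 := h.hasSum_derivative.sub
    (hasSum_ite_eq (l + 1) (a (l + 2) * (l + 2) * (1 - r)))
  rw [← h2.tsum_eq]
  refine (h.absSummable_derivative.summable_radius h0 h1).tsum_le_tsum (fun k => ?_) h2.summable
  rw [h.norm_coeff_derivative]
  have h3 : 0 ≤ a (k + 1) * (k + 1) := mul_nonneg (h.nonneg _) (by positivity)
  split_ifs with hk
  · subst hk
    have h4 : r ^ (l + 1) ≤ r := by
      rw [pow_succ]
      exact mul_le_of_le_one_left h0 (pow_le_one₀ h0 h1)
    have h5 := mul_le_mul_of_nonneg_left h4 h3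
    push_cast at h5 ⊢
    rw [add_assoc, one_add_one_eq_two, add_assoc, one_add_one_eq_two] at *
    linarith
  · rw [sub_zero]
    exact mul_le_of_le_one_right h3 (pow_le_one₀ h0 h1)

/-- Below the critical radius, the gain from `f'` beats a fixed power of `f(r) / r`. -/
theorem exists_radius (h : CriticalWeights a s) (M : ℕ) : ∃ r : ℝ, 0 < r ∧ r ≤ 1 ∧
    (radiusNorm r (ofReal a) / r) ^ M * radiusNorm r (d⁄dX ℂ (ofReal a)) < 1 := by
  obtain ⟨k, hk, hak⟩ := h.exists_pos
  obtain ⟨l, rfl⟩ := Nat.exists_eq_add_of_le' hk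
  set c := a (l + 2) * (l + 2) with hc
  have hc0 : 0 < c := by positivity
  -- The bound `ε ≤ 1 / 2` gives `1 - ε + s ε² / 2 ≤ (1 + s ε²) (1 - ε)`; the other bound makes the
  -- loss `M s ε²` smaller than the gain `c ε`.
  set ε := min (1 / 2) (c / (2 * (M * s + 1))) with hε
  have hs := h.pos_var
  have hMs : 0 < 2 * (M * s + 1) := by positivity
  have hε0 : 0 < ε := lt_min (by norm_num) (div_pos hc0 hMs)
  have hε1 : ε ≤ 1 / 2 := min_le_left _ _
  have hε2 : ε * (2 * (M * s + 1)) ≤ c := by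
    rw [← le_div_iff₀ hMs]; exact min_le_right _ _
  refine ⟨1 - ε, by linarith, by linarith, ?_⟩
  have h0 : 0 ≤ 1 - ε := by linarith
  have h1 : 1 - ε ≤ 1 := by linarith
  have e1 : radiusNorm (1 - ε) (ofReal a) / (1 - ε) ≤ Real.exp (s * ε ^ 2) := by
    rw [div_le_iff₀ (by linarith)]
    have := h.radiusNorm_le h0 h1
    have h3 := Real.add_one_le_exp (s * ε ^ 2)
    have h4 : 0 ≤ s * ε ^ 2 := by positivity
    have h5 : (s * ε ^ 2 + 1) * (1 - ε) ≤ Real.exp (s * ε ^ 2) * (1 - ε) :=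
      mul_le_mul_of_nonneg_right h3 h0
    nlinarith
  have e2 : radiusNorm (1 - ε) (d⁄dX ℂ (ofReal a)) ≤ Real.exp (-(c * ε)) := by
    have := h.radiusNorm_derivative_le h0 h1 (l := l)
    rw [← hc] at this
    have h3 := Real.add_one_le_exp (-(c * ε))
    linarith
  calc _ ≤ Real.exp (s * ε ^ 2) ^ M * Real.exp (-(c * ε)) :=
        mul_le_mul (pow_le_pow_left₀ (div_nonneg (radiusNorm_nonneg _ h0) h0) e1 M) e2
          (radiusNorm_nonneg _ h0) (by positivity)
    _ = Real.exp (M * (s * ε ^ 2) + -(c * ε)) := by rw [← Real.exp_nat_mul, ← Real.exp_add]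
    _ < 1 := by
        rw [Real.exp_lt_one_iff]
        nlinarith [mul_pos hε0 hε0]

end CriticalWeights

/-! ### Gaussian decay and the cone bound on the unit circle -/

/-- A continuous function which is positive on `[-R, R] \ {0}` and at least quadratic at `0`
dominates a multiple of `θ ^ 2` on `[-R, R]`. -/
theorem exists_mul_sq_le_of_continuous {F : ℝ → ℝ} (hF : Continuous F) {R δ c : ℝ} (hR : 0 < R)
    (hδ : 0 < δ) (hc : 0 < c) (h0 : ∀ θ, |θ| ≤ δ → c * θ ^ 2 ≤ F θ)
    (h1 : ∀ θ, |θ| ≤ R → θ ≠ 0 → 0 < F θ) :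
    ∃ c > 0, ∀ θ, |θ| ≤ R → c * θ ^ 2 ≤ F θ := by
  have hK : IsCompact (Metric.closedBall (0 : ℝ) R ∩ {θ | δ ≤ |θ|}) :=
    (isCompact_closedBall 0 R).inter_right (isClosed_le continuous_const continuous_abs)
  rcases (Metric.closedBall (0 : ℝ) R ∩ {θ | δ ≤ |θ|}).eq_empty_or_nonempty with he | hne
  · refine ⟨c, hc, fun θ hθ => h0 θ ?_⟩
    by_contra hcon
    have : θ ∈ Metric.closedBall (0 : ℝ) R ∩ {θ | δ ≤ |θ|} :=
      ⟨by simpa using hθ, (not_le.1 hcon).le⟩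
    rw [he] at this
    exact this
  · obtain ⟨θ₀, hθ₀, hmin⟩ := hK.exists_isMinOn hne hF.continuousOn
    have hθ₀' : |θ₀| ≤ R := by simpa using hθ₀.1
    have hpos : 0 < F θ₀ := h1 θ₀ hθ₀' (by
      intro h; have := hθ₀.2; simp [h] at this; linarith)
    refine ⟨min c (F θ₀ / R ^ 2), lt_min hc (by positivity), fun θ hθ => ?_⟩
    rcases le_total |θ| δ with h | h
    · exact (mul_le_mul_of_nonneg_right (min_le_left _ _) (sq_nonneg θ)).trans (h0 θ h)
    · refine le_trans ?_ (hmin ⟨by simpa using hθ, h⟩)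
      calc _ ≤ F θ₀ / R ^ 2 * R ^ 2 :=
            mul_le_mul (min_le_right _ _) (sq_le_sq' (abs_le.1 hθ).1 (abs_le.1 hθ).2)
              (sq_nonneg θ) (by positivity)
        _ = F θ₀ := by field_simp

/-- A point `w` whose displacement from `1` is nearly vertical is far from every point of a cone
with apex `1`. -/
theorem le_norm_sub_of_cone {s K κ τ : ℝ} {w z : ℂ} (hK : 0 ≤ K) (hκ : 0 < κ)
    (hs : s = 2 * κ * (2 * K + 1)) (hτ : 0 ≤ τ) (hw : 1 - κ * τ ≤ w.re)
    (hw' : (s - κ) * τ ≤ |w.im|) (hz : |z.im| ≤ K * (1 - z.re)) (hz1 : z.re ≤ 1) :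
    ‖1 - z‖ ≤ 4 * (1 + K) * ‖w - z‖ := by
  set u := 1 - z.re with hu
  have hu0 : 0 ≤ u := by linarith
  have h1 : ‖1 - z‖ ≤ (1 + K) * u := by
    refine (Complex.norm_le_abs_re_add_abs_im _).trans ?_
    simp only [Complex.sub_re, Complex.one_re, Complex.sub_im, Complex.one_im, zero_sub, abs_neg]
    rw [← hu, abs_of_nonneg hu0]
    linarith
  have h2 : u / 4 ≤ ‖w - z‖ := by
    -- If `z` is far to the left compared with `τ`, the real parts of `w` and `z` are separated.
    -- Otherwise the cone makes `z.im` small, and the relation between `s` and `κ` leaves `|w.im| -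
    -- |z.im| ≥ (2 K + 1) κ τ`.
    rcases le_total (2 * κ * τ) u with h | h
    · refine le_trans ?_ ((le_abs_self _).trans (Complex.abs_re_le_norm _))
      rw [Complex.sub_re]
      linarith
    · refine le_trans ?_ (Complex.abs_im_le_norm _)
      rw [Complex.sub_im]
      have := abs_sub_abs_le_abs_sub w.im z.im
      have h3 : K * u ≤ K * (2 * κ * τ) := mul_le_mul_of_nonneg_left h hK
      have h4 : (s - κ) * τ - K * (2 * κ * τ) = (2 * K + 1) * (κ * τ) := by rw [hs]; ring
      have h5 : 0 ≤ κ * τ := by positivity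
      nlinarith
  calc _ ≤ (1 + K) * u := h1
    _ = 4 * (1 + K) * (u / 4) := by ring
    _ ≤ _ := mul_le_mul_of_nonneg_left h2 (by positivity)

/-- By the law of cosines the squared norm is `(x + y)² - 2 x y (1 - cos t)`; the assumption `x + y
≤ 1` bounds it by the square of the right-hand side. -/
theorem norm_add_mul_exp_le {x y : ℝ} (hx : 0 ≤ x) (hy : 0 ≤ y) (hxy : x + y ≤ 1) (t : ℝ) :
    ‖(x : ℂ) + y * Complex.exp (t * Complex.I)‖ ≤ x + y - x * y * (1 - Real.cos t) := by
  have hc := Real.neg_one_le_cos t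
  have hc' := Real.cos_le_one t
  have hxy' : 0 ≤ x * y := mul_nonneg hx hy
  have hn : 0 ≤ x + y - x * y * (1 - Real.cos t) := by nlinarith
  rw [← abs_of_nonneg hn, ← abs_of_nonneg (norm_nonneg _), ← sq_le_sq, ← Complex.normSq_eq_norm_sq,
    Complex.normSq_apply]
  simp only [Complex.add_re, Complex.ofReal_re, Complex.mul_re, Complex.exp_ofReal_mul_I_re,
    Complex.ofReal_im, Complex.exp_ofReal_mul_I_im, zero_mul, sub_zero, Complex.add_im,
    Complex.mul_im, add_zero, zero_add]
  have h1 : (x + y * Real.cos t) * (x + y * Real.cos t) + y * Real.sin t * (y * Real.sin t)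
      = (x + y) ^ 2 - 2 * (x * y * (1 - Real.cos t)) := by
    have := Real.sin_sq_add_cos_sq t
    linear_combination y ^ 2 * this
  rw [h1]
  have h2 : 0 ≤ x * y * (1 - Real.cos t) := mul_nonneg hxy' (by linarith)
  nlinarith [sq_nonneg (x * y * (1 - Real.cos t))]

open PowerSeries

namespace CriticalWeights

variable {a : ℕ → ℝ} {s : ℝ}

theorem add_le_one (h : CriticalWeights a s) {k : ℕ} (hk : k ≠ 0) : a 0 + a k ≤ 1 := by
  have := h.hasSum.summable.sum_le_tsum {0, k} fun i _ => h.nonneg i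
  rwa [Finset.sum_pair hk.symm, h.hasSum.tsum_eq] at this

/-- Only the interference between the atoms at `0` and `k` is kept; all other terms are estimated by
the triangle inequality. -/
theorem norm_eval_le (h : CriticalWeights a s) {k : ℕ} (hk : k ≠ 0) (θ : ℝ) :
    ‖evalAt (Complex.exp (Complex.I * θ)) (ofReal a)‖ ≤ 1 - a 0 * a k * (1 - Real.cos (k * θ)) := by
  set x := Complex.exp (Complex.I * θ) with hx
  have hx1 : ‖x‖ = 1 := by rw [hx, mul_comm, Complex.norm_exp_ofReal_mul_I]
  have hS : HasSum (fun j => (a j : ℂ) * x ^ j) (evalAt x (ofReal a)) := by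
    have := (h.absSummable.summable_norm_eval hx1.le).of_norm.hasSum
    simpa only [evalAt, ofReal, coeff_mk] using this
  have h1 := (hS.sub (hasSum_ite_eq 0 ((a 0 : ℂ)))).sub (hasSum_ite_eq k ((a k : ℂ) * x ^ k))
  have h2 := (h.hasSum.sub (hasSum_ite_eq 0 (a 0))).sub (hasSum_ite_eq k (a k))
  have h3 : ‖evalAt x (ofReal a) - a 0 - a k * x ^ k‖ ≤ 1 - a 0 - a k := by
    rw [← h1.tsum_eq]
    refine tsum_of_norm_bounded h2 fun j => ?_
    by_cases hj0 : j = 0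
    · subst hj0; simp [hk.symm]
    · by_cases hjk : j = k
      · subst hjk; simp [hj0]
      · simp [hj0, hjk, hx1, abs_of_nonneg (h.nonneg j)]
  have h4 := norm_add_mul_exp_le (h.nonneg 0) (h.nonneg k) (h.add_le_one hk) (k * θ)
  have h5 : x ^ k = Complex.exp (((k * θ : ℝ) : ℂ) * Complex.I) := by
    rw [hx, ← Complex.exp_nat_mul]
    congr 1
    push_cast
    ring
  rw [← h5] at h4
  calc _ = ‖(evalAt x (ofReal a) - a 0 - a k * x ^ k) + (a 0 + a k * x ^ k)‖ := by
        congr 1; ring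
    _ ≤ _ := norm_add_le _ _
    _ ≤ _ := by linarith

/-- The span of the law. -/
theorem exists_span (h : CriticalWeights a s) : ∃ d : ℕ, 0 < d ∧ SupportedOn d (ofReal a) ∧
    ∀ θ : ℝ, |θ| ≤ Real.pi / d → θ ≠ 0 →
      ‖evalAt (Complex.exp (Complex.I * θ)) (ofReal a)‖ < 1 := by
  -- The span is the generator of the subgroup generated by the support. Since the law charges `0`,
  -- no translation of the support is needed.
  obtain ⟨e, he⟩ := Int.subgroup_cyclic
    (AddSubgroup.closure {m : ℤ | ∃ k : ℕ, a k ≠ 0 ∧ m = k})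
  rw [← AddSubgroup.zmultiples_eq_closure] at he
  have hmem : ∀ k : ℕ, a k ≠ 0 → e ∣ k := fun k hk => by
    rw [← Int.mem_zmultiples_iff, ← he]
    exact AddSubgroup.subset_closure ⟨k, hk, rfl⟩
  have he0 : e ≠ 0 := by
    rintro rfl
    obtain ⟨k, hk, hak⟩ := h.exists_pos
    have := zero_dvd_iff.1 (hmem k hak.ne')
    omega
  refine ⟨e.natAbs, Int.natAbs_pos.2 he0, fun k hk => ?_, fun θ hθ hθ0 => ?_⟩
  · rw [ofReal, coeff_mk] at hk
    exact Int.natCast_dvd_natCast.1 (Int.natAbs_dvd.2 (hmem k (by exact_mod_cast hk)))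
  · by_contra! hcon
    -- If the modulus is at least `1`, then `cos (k θ) = 1` for every `k` in the support, hence `m θ
    -- ∈ 2π ℤ` for every `m` in the subgroup. For the generator `e`, `|e θ| ≤ π` then forces `e θ =
    -- 0`.
    have hle : AddSubgroup.closure {m : ℤ | ∃ k : ℕ, a k ≠ 0 ∧ m = k} ≤
        (AddSubgroup.zmultiples (2 * Real.pi)).comap (zmultiplesHom ℝ θ) := by
      rw [AddSubgroup.closure_le]
      rintro _ ⟨k, hk, rfl⟩
      simp only [AddSubgroup.coe_comap, Set.mem_preimage, SetLike.mem_coe, zmultiplesHom_apply,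
        AddSubgroup.mem_zmultiples_iff]
      rcases eq_or_ne k 0 with rfl | hk0
      · exact ⟨0, by simp⟩
      have hak : 0 < a k := lt_of_le_of_ne (h.nonneg k) (Ne.symm hk)
      have h1 := hcon.trans (h.norm_eval_le hk0 θ)
      have h2 : Real.cos (k * θ) = 1 := by
        refine le_antisymm (Real.cos_le_one _) ?_
        have := mul_pos h.pos_zero hak
        by_contra! h3
        nlinarith
      obtain ⟨n, hn⟩ := (Real.cos_eq_one_iff _).1 h2
      exact ⟨n, by simpa using hn⟩
    have h3 : e ∈ AddSubgroup.closure {m : ℤ | ∃ k : ℕ, a k ≠ 0 ∧ m = k} :=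
      he ▸ AddSubgroup.mem_zmultiples e
    obtain ⟨n, hn⟩ := AddSubgroup.mem_zmultiples_iff.1 (hle h3)
    simp only [zsmul_eq_mul, zmultiplesHom_apply] at hn
    have hpi := Real.pi_pos
    have hepos : (0 : ℝ) < |(e : ℝ)| := by simpa using he0
    have h4 : |(e : ℝ) * θ| ≤ Real.pi := by
      rw [abs_mul]
      rw [Nat.cast_natAbs, le_div_iff₀ (by exact_mod_cast hepos)] at hθ
      push_cast at hθ
      linarith
    rw [← hn, abs_mul, abs_of_pos (by positivity : 0 < 2 * Real.pi)] at h4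
    have h5 : |(n : ℝ)| < 1 := by nlinarith
    have h6 : n = 0 := by
      have : |n| < 1 := by exact_mod_cast h5
      exact Int.abs_lt_one_iff.1 this
    rw [h6, Int.cast_zero, zero_mul] at hn
    rcases mul_eq_zero.1 hn.symm with h7 | h7
    · exact he0 (by exact_mod_cast h7)
    · exact hθ0 h7

/-- On `|θ| ≤ π / k` the atoms at `0` and `k` give a quadratic defect, through `1 - cos x ≥ 2 x² /
π²` for `|x| ≤ π`. Compactness covers the rest of the period, and `1 - x ≤ exp (-x)` finishes. -/
theorem exists_gaussian_bound (h : CriticalWeights a s) {d : ℕ} (hd : 0 < d)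
    (hlt : ∀ θ : ℝ, |θ| ≤ Real.pi / d → θ ≠ 0 →
      ‖evalAt (Complex.exp (Complex.I * θ)) (ofReal a)‖ < 1) :
    ∃ c > 0, ∀ θ : ℝ, |θ| ≤ Real.pi / d →
      ‖evalAt (Complex.exp (Complex.I * θ)) (ofReal a)‖ ≤ Real.exp (-(c * θ ^ 2)) := by
  obtain ⟨k, hk, hak⟩ := h.exists_pos
  have hpi := Real.pi_pos
  have hk0 : (0 : ℝ) < k := by exact_mod_cast (by omega : 0 < k)
  obtain ⟨c, hc, hcF⟩ := exists_mul_sq_le_of_continuous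
    (F := fun θ => 1 - ‖evalAt (Complex.exp (Complex.I * θ)) (ofReal a)‖)
    (R := Real.pi / d) (δ := Real.pi / k) (c := a 0 * a k * (2 / Real.pi ^ 2 * k ^ 2))
    (continuous_const.sub h.absSummable.continuous_evalAt_exp.norm) (by positivity) (by positivity)
    (mul_pos (mul_pos h.pos_zero hak) (by positivity))
    (fun θ hθ => by
      have h1 := h.norm_eval_le (by omega : k ≠ 0) θ
      have h2 : |(k : ℝ) * θ| ≤ Real.pi := by
        rw [abs_mul, abs_of_pos hk0]
        rw [le_div_iff₀ hk0] at hθ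
        linarith
      have h3 := Real.cos_le_one_sub_mul_cos_sq h2
      have h4 := mul_pos h.pos_zero hak
      have h5 := mul_le_mul_of_nonneg_left
        (by linarith : 2 / Real.pi ^ 2 * (k * θ) ^ 2 ≤ 1 - Real.cos (k * θ)) h4.le
      calc _ = a 0 * a k * (2 / Real.pi ^ 2 * (k * θ) ^ 2) := by ring
        _ ≤ _ := by linarith)
    (fun θ hθ hθ0 => sub_pos.2 (hlt θ hθ hθ0))
  refine ⟨c, hc, fun θ hθ => ?_⟩
  have h1 := hcF θ hθ
  have h2 := Real.add_one_le_exp (-(c * θ ^ 2))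
  linarith

/-- Termwise differentiation, dominated by `b k * k`. Applied to `a k`, and to `a k * k`, where the
finite variance enters. -/
theorem hasDerivAt_tsum_exp {b : ℕ → ℝ} (hb : Summable b) {m : ℝ}
    (hb0 : ∀ k, 0 ≤ b k) (hm : HasSum (fun k => b k * k) m) :
    HasDerivAt (fun θ : ℝ => ∑' k, (b k : ℂ) * Complex.exp (Complex.I * θ) ^ k)
      (Complex.I * m) 0 := by
  have h1 := hasDerivAt_tsum (𝕜 := ℝ) (F := ℂ) (u := fun k => b k * k)
    (g := fun (k : ℕ) (θ : ℝ) => (b k : ℂ) * Complex.exp (Complex.I * θ) ^ k)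
    (g' := fun (k : ℕ) (θ : ℝ) => (b k : ℂ) * (Complex.exp (k * (Complex.I * θ)) *
      (k * Complex.I))) (y₀ := 0)
    hm.summable (fun k y => by
      have h2 : HasDerivAt (fun θ : ℝ => (k : ℂ) * (Complex.I * θ)) (k * (Complex.I * 1)) y :=
        ((Complex.ofRealCLM.hasDerivAt (x := y)).const_mul Complex.I).const_mul _
      rw [mul_one] at h2
      have h3 := (h2.cexp).const_mul (b k : ℂ)
      simpa only [Complex.exp_nat_mul] using h3)
    (fun k y => by
      rw [norm_mul, norm_mul, norm_mul, Complex.norm_I, mul_one, Complex.norm_natCast,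
        Complex.norm_real, Real.norm_of_nonneg (hb0 k)]
      rw [show (k : ℂ) * (Complex.I * y) = ((k * y : ℝ) : ℂ) * Complex.I by push_cast; ring,
        Complex.norm_exp_ofReal_mul_I, one_mul])
    (by simpa using Complex.ofRealCLM.summable hb) 0
  have h2 : HasSum (fun k : ℕ => ((b k * k : ℝ) : ℂ) * Complex.I) (m * Complex.I) :=
    (Complex.ofRealCLM.hasSum hm).mul_right _
  have h3 : Complex.I * m = ∑' k : ℕ, (b k : ℂ) * (Complex.exp (k * (Complex.I * (0 : ℝ))) *
      (k * Complex.I)) := by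
    rw [mul_comm, ← h2.tsum_eq]
    refine tsum_congr fun k => ?_
    simp
    ring
  rw [h3]
  exact h1

theorem hasDerivAt_eval (h : CriticalWeights a s) :
    HasDerivAt (fun θ : ℝ => evalAt (Complex.exp (Complex.I * θ)) (ofReal a)) Complex.I 0 := by
  have := hasDerivAt_tsum_exp h.hasSum.summable h.nonneg h.hasSum_mean
  simpa [evalAt, ofReal] using this

theorem coeff_X_mul_derivative (a : ℕ → ℝ) (k : ℕ) :
    coeff k (X * d⁄dX ℂ (ofReal a)) = ((a k * k : ℝ) : ℂ) := by
  cases k with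
  | zero => simp
  | succ k => rw [coeff_succ_X_mul, coeff_derivative_ofReal]; push_cast; rfl

theorem hasDerivAt_eval_derivative (h : CriticalWeights a s) :
    HasDerivAt (fun θ : ℝ => evalAt (Complex.exp (Complex.I * θ)) (X * d⁄dX ℂ (ofReal a)))
      (Complex.I * (1 + s)) 0 := by
  have h1 : HasSum (fun k : ℕ => a k * k * k) (1 + s) := by
    have := h.hasSum_sq
    simpa only [pow_two, mul_assoc] using this
  have := hasDerivAt_tsum_exp h.hasSum_mean.summable
    (fun k => mul_nonneg (h.nonneg k) (by positivity)) h1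
  simp only [evalAt, coeff_X_mul_derivative]
  simpa using this

theorem eval_zero (h : CriticalWeights a s) :
    evalAt (Complex.exp (Complex.I * (0 : ℝ))) (ofReal a) = 1 := by
  have : HasSum (fun k => ((a k : ℝ) : ℂ)) ((1 : ℝ) : ℂ) := Complex.ofRealCLM.hasSum h.hasSum
  simpa [evalAt, ofReal] using this.tsum_eq

theorem eval_derivative_zero (h : CriticalWeights a s) :
    evalAt (Complex.exp (Complex.I * (0 : ℝ))) (X * d⁄dX ℂ (ofReal a)) = 1 := by
  have : HasSum (fun k : ℕ => ((a k * k : ℝ) : ℂ)) ((1 : ℝ) : ℂ) :=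
    Complex.ofRealCLM.hasSum h.hasSum_mean
  simpa [evalAt, coeff_X_mul_derivative] using this.tsum_eq

/-- Near the critical point, `f - z X f'` is bounded below by a multiple of `‖1 - z‖` for `z` in
a cone with apex `1`. -/
theorem exists_cone_bound (h : CriticalWeights a s) {K : ℝ} (hK : 0 ≤ K) :
    ∃ δ > 0, ∃ c > 0, ∀ θ : ℝ, |θ| ≤ δ →
      evalAt (Complex.exp (Complex.I * θ)) (ofReal a) ≠ 0 ∧
      ∀ z : ℂ, |z.im| ≤ K * (1 - z.re) → z.re ≤ 1 →
        c * ‖1 - z‖ ≤ ‖evalAt (Complex.exp (Complex.I * θ)) (ofReal a)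
          - z * evalAt (Complex.exp (Complex.I * θ)) (X * d⁄dX ℂ (ofReal a))‖ := by
  set φ := fun θ : ℝ => evalAt (Complex.exp (Complex.I * θ)) (ofReal a) with hφ
  set g := fun θ : ℝ => evalAt (Complex.exp (Complex.I * θ)) (X * d⁄dX ℂ (ofReal a)) with hg
  have hφ0 : φ 0 = 1 := h.eval_zero
  have hg0 : g 0 = 1 := h.eval_derivative_zero
  set κ := s / (2 * (2 * K + 1)) with hκ
  have hs := h.pos_var
  have hκ0 : 0 < κ := by positivity
  have hsκ : s = 2 * κ * (2 * K + 1) := by rw [hκ]; field_simp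
  -- The derivative of `φ / g` at `0` is `i - i (1 + s) = -i s`, so the quotient leaves `1` in the
  -- vertical direction, at speed `s`. The tolerance `κ` is the one that `le_norm_sub_of_cone`
  -- allows.
  have hD := (h.hasDerivAt_eval.div h.hasDerivAt_eval_derivative (by
    change g 0 ≠ 0; rw [hg0]; exact one_ne_zero))
  change HasDerivAt (fun θ => φ θ / g θ) ((Complex.I * g 0 - φ 0 * (Complex.I * (1 + s))) / g 0 ^ 2)
    0 at hD
  rw [hφ0, hg0] at hD
  have hlo := (hasDerivAt_iff_isLittleO_nhds_zero.1 hD).def hκ0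
  have hcφ : ContinuousAt φ 0 := h.absSummable.continuous_evalAt_exp.continuousAt
  have hcg : ContinuousAt g 0 :=
    (AbsSummable.X.mul h.absSummable_derivative).continuous_evalAt_exp.continuousAt
  have e1 : ∀ᶠ θ in nhds (0 : ℝ), φ θ ≠ 0 := hcφ.eventually_ne (by rw [hφ0]; exact one_ne_zero)
  have e2 : ∀ᶠ θ in nhds (0 : ℝ), 1 / 2 < ‖g θ‖ :=
    hcg.norm.eventually (lt_mem_nhds (by change 1 / 2 < ‖g 0‖; rw [hg0, norm_one]; norm_num))
  obtain ⟨δ, hδ, hall⟩ := Metric.eventually_nhds_iff.1 (hlo.and (e1.and e2))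
  refine ⟨δ / 2, by positivity, 1 / (8 * (1 + K)), by positivity, fun θ hθ => ?_⟩
  obtain ⟨p1, p2, p3⟩ := hall (y := θ) (by rw [Real.dist_eq, sub_zero]; linarith)
  refine ⟨p2, fun z hz hz1 => ?_⟩
  have hgθ : g θ ≠ 0 := by
    intro h0; rw [h0, norm_zero] at p3; norm_num at p3
  rw [zero_add, hφ0, hg0] at p1
  set w := φ θ / g θ with hw
  have p1' : ‖(w - 1) + (θ * s : ℝ) * Complex.I‖ ≤ κ * |θ| := by
    rw [Real.norm_eq_abs] at p1
    refine le_trans (le_of_eq ?_) p1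
    congr 1
    rw [Complex.real_smul]
    push_cast
    ring
  have hre : 1 - κ * |θ| ≤ w.re := by
    have := ((neg_le_abs _).trans (Complex.abs_re_le_norm _)).trans p1'
    simp at this
    linarith
  have him : (s - κ) * |θ| ≤ |w.im| := by
    have := (Complex.abs_im_le_norm _).trans p1'
    simp at this
    have h3 : |θ * s| - |w.im| ≤ |w.im + θ * s| := by
      have := abs_sub_abs_le_abs_sub (θ * s) (-w.im)
      rw [abs_neg, sub_neg_eq_add, add_comm (θ * s)] at this
      exact this
    rw [abs_mul, abs_of_pos hs] at h3
    linarith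
  have h4 := le_norm_sub_of_cone hK hκ0 hsκ (abs_nonneg θ) hre him hz hz1
  have h5 : φ θ - z * g θ = (w - z) * g θ := by
    rw [hw, sub_mul, div_mul_cancel₀ _ hgθ]
  change _ ≤ ‖φ θ - z * g θ‖
  rw [h5, norm_mul, one_div, inv_mul_le_iff₀ (by positivity)]
  calc _ ≤ 4 * (1 + K) * ‖w - z‖ := h4
    _ = 8 * (1 + K) * (‖w - z‖ * (1 / 2)) := by ring
    _ ≤ _ := by gcongr

end CriticalWeights

/-! ### Tail and main part of the two-point sum -/

open PowerSeries

namespace PowerSeries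

theorem radiusNorm_one_series (r : ℝ) : radiusNorm r 1 = 1 := by
  rw [radiusNorm, tsum_eq_single 0 fun k hk => by rw [coeff_one, if_neg hk, norm_zero, zero_mul]]
  simp

theorem radiusNorm_X (r : ℝ) : radiusNorm r X = r := by
  rw [radiusNorm, tsum_eq_single 1 fun k hk => by rw [coeff_X, if_neg hk, norm_zero, zero_mul]]
  simp

end PowerSeries

namespace CriticalWeights

variable {a : ℕ → ℝ} {s : ℝ}

theorem radiusNorm_derivative_le_one (h : CriticalWeights a s) {r : ℝ} (h0 : 0 ≤ r) (h1 : r ≤ 1) :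
    radiusNorm r (d⁄dX ℂ (ofReal a)) ≤ 1 := by
  have := h.radiusNorm_derivative_le h0 h1 (l := 0)
  have h2 : 0 ≤ a (0 + 2) * ((0 : ℕ) + 2) * (1 - r) :=
    mul_nonneg (mul_nonneg (h.nonneg _) (by norm_num)) (by linarith)
  linarith

/-- Cauchy's estimate at radius `r`. Since `n ≤ k + l`, dividing by `r ^ n` leaves at most `F₁ ^ k *
(F / r) ^ l`, with `F`, `F₁` the sums of `f`, `f'` at `r`. As `F₁ ≤ 1 ≤ F / r`, the exponents may be
replaced by `m` and `8 m`. -/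
theorem norm_coeff_mul_le (h : CriticalWeights a s) {p : ℂ⟦X⟧} (hp : AbsSummable p) {r B : ℝ}
    (h0 : 0 < r) (h1 : r ≤ 1) (hB : radiusNorm r p ≤ B) {n k l m : ℕ} (hn : n ≤ k + l)
    (hl : l ≤ 8 * m) (hm : m ≤ k) :
    ‖coeff n (p * ((X * d⁄dX ℂ (ofReal a)) ^ k * ofReal a ^ l))‖ ≤
      B * ((radiusNorm r (ofReal a) / r) ^ 8 * radiusNorm r (d⁄dX ℂ (ofReal a))) ^ m := by
  have hf := h.absSummable
  have hf1 := h.absSummable_derivative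
  have hX := AbsSummable.X.mul hf1
  set F := radiusNorm r (ofReal a) with hF
  set F₁ := radiusNorm r (d⁄dX ℂ (ofReal a)) with hF₁
  have hF0 : 0 ≤ F := radiusNorm_nonneg _ h0.le
  have hF₁0 : 0 ≤ F₁ := radiusNorm_nonneg _ h0.le
  have hF₁1 : F₁ ≤ 1 := h.radiusNorm_derivative_le_one h0.le h1
  have hR : 1 ≤ F / r := (one_le_div h0).2 (h.le_radiusNorm h0.le h1)
  have hB0 : 0 ≤ B := (radiusNorm_nonneg p h0.le).trans hB
  have e1 : radiusNorm r (p * ((X * d⁄dX ℂ (ofReal a)) ^ k * ofReal a ^ l))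
      ≤ B * ((r * F₁) ^ k * F ^ l) := by
    refine (hp.radiusNorm_mul_le ((hX.pow k).mul (hf.pow l)) h0.le h1).trans ?_
    refine mul_le_mul hB ?_ (radiusNorm_nonneg _ h0.le) hB0
    refine ((hX.pow k).radiusNorm_mul_le (hf.pow l) h0.le h1).trans ?_
    refine mul_le_mul ?_ (hf.radiusNorm_pow_le l h0.le h1) (radiusNorm_nonneg _ h0.le)
      (by positivity)
    refine (hX.radiusNorm_pow_le k h0.le h1).trans
      (pow_le_pow_left₀ (radiusNorm_nonneg _ h0.le) ?_ k)
    refine (AbsSummable.X.radiusNorm_mul_le hf1 h0.le h1).trans ?_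
    rw [radiusNorm_X]
  have e2 := ((hp.mul ((hX.pow k).mul (hf.pow l))).norm_coeff_mul_pow_le n h0.le h1).trans e1
  have e3 : B * ((r * F₁) ^ k * F ^ l) = (B * (F₁ ^ k * (F / r) ^ l)) * r ^ (k + l) := by
    rw [div_pow, pow_add, mul_pow]
    field_simp
  have e4 : (B * (F₁ ^ k * (F / r) ^ l)) * r ^ (k + l) ≤ (B * (F₁ ^ k * (F / r) ^ l)) * r ^ n :=
    mul_le_mul_of_nonneg_left (pow_le_pow_of_le_one h0.le h1 hn) (by positivity)
  have e5 := le_of_mul_le_mul_right ((e2.trans e3.le).trans e4) (by positivity)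
  refine e5.trans (mul_le_mul_of_nonneg_left ?_ hB0)
  rw [mul_pow, ← pow_mul, mul_comm]
  exact mul_le_mul (pow_le_pow_right₀ hR hl) (pow_le_pow_of_le_one hF₁0 hF₁1 hm) (by positivity)
    (by positivity)

/-- Terms with a large power of `X f' / f` are exponentially small. -/
theorem norm_coeff_branchFactor_le (h : CriticalWeights a s) {r : ℝ} (h0 : 0 < r) (h1 : r ≤ 1)
    {q : ℂ} (hq : ‖q‖ ≤ 1) {n k m : ℕ} (hn : n + 1 ≤ 8 * m) (hm : m ≤ k) :
    ‖coeff n (branchFactor (ofReal a) q * logDer (ofReal a) ^ k * ofReal a ^ (n + 1))‖ ≤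
      (2 + s) * ((radiusNorm r (ofReal a) / r) ^ 8 * radiusNorm r (d⁄dX ℂ (ofReal a))) ^ m := by
  have hf0 := h.constantCoeff_ne_zero
  have hs := h.pos_var
  have hf2 := h.absSummable_derivative_derivative
  set ρ := (radiusNorm r (ofReal a) / r) ^ 8 * radiusNorm r (d⁄dX ℂ (ofReal a)) with hρ
  have hρ0 : 0 ≤ ρ := mul_nonneg (pow_nonneg (div_nonneg (radiusNorm_nonneg _ h0.le) h0.le) _)
    (radiusNorm_nonneg _ h0.le)
  -- Either `j > n` and the coefficient vanishes by order, or `j ≤ n` and at least one power of `f`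
  -- remains after the denominators are cleared.
  have A (j : ℕ) (hj : m ≤ j) : ‖coeff n (logDer (ofReal a) ^ j * ofReal a ^ (n + 1))‖ ≤ ρ ^ m := by
    rcases lt_or_ge n j with hlt | hle
    · rw [coeff_logDer_pow_mul_of_lt hlt, norm_zero]; positivity
    · obtain ⟨l, rfl⟩ := Nat.exists_eq_add_of_le hle
      rw [add_assoc, logDer_pow_mul_pow hf0 j (l + 1)]
      have := h.norm_coeff_mul_le AbsSummable.one h0 h1 (radiusNorm_one_series r).le
        (n := j + l) (k := j) (l := l + 1) (m := m) (by omega) (by omega) hj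
      rwa [one_mul, one_mul] at this
  have B : ‖coeff n (X ^ 2 * d⁄dX ℂ (d⁄dX ℂ (ofReal a)) *
      (logDer (ofReal a) ^ k * ofReal a ^ n))‖ ≤ s * ρ ^ m := by
    rcases lt_or_ge n k with hlt | hle
    · rw [mul_left_comm, coeff_logDer_pow_mul_of_lt hlt, norm_zero]; positivity
    · obtain ⟨l, rfl⟩ := Nat.exists_eq_add_of_le hle
      rw [logDer_pow_mul_pow hf0 k l]
      refine h.norm_coeff_mul_le ((AbsSummable.X.pow 2).mul hf2) h0 h1 ?_ le_rfl (by omega) hm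
      refine ((AbsSummable.X.pow 2).radiusNorm_mul_le hf2 h0.le h1).trans ?_
      have e1 := (AbsSummable.X.radiusNorm_pow_le 2 h0.le h1)
      rw [radiusNorm_X] at e1
      have e2 : r ^ 2 ≤ 1 := pow_le_one₀ h0.le h1
      have e3 := h.radiusNorm_derivative_derivative_le h0.le h1
      calc _ ≤ 1 * s := mul_le_mul (e1.trans e2) e3 (radiusNorm_nonneg _ h0.le) zero_le_one
        _ = s := one_mul s
  rw [coeff_branchFactor_mul_logDer_pow_mul_pow hf0]
  have t1 := A k hm
  have t2 : ‖q * coeff n (logDer (ofReal a) ^ (k + 2) * ofReal a ^ (n + 1))‖ ≤ ρ ^ m := by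
    rw [norm_mul]
    exact (mul_le_of_le_one_left (norm_nonneg _) hq).trans (A (k + 2) (by omega))
  have t3 : ‖q * coeff n (X ^ 2 * d⁄dX ℂ (d⁄dX ℂ (ofReal a)) *
      (logDer (ofReal a) ^ k * ofReal a ^ n))‖ ≤ s * ρ ^ m := by
    rw [norm_mul]
    exact (mul_le_of_le_one_left (norm_nonneg _) hq).trans B
  calc _ ≤ ρ ^ m + ρ ^ m + s * ρ ^ m :=
        (norm_add_le _ _).trans (add_le_add ((norm_sub_le _ _).trans (add_le_add t1 t2)) t3)
    _ = _ := by ring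

/-- The factor common to all terms of `mainSeries`. -/
noncomputable def mainFactor (a : ℕ → ℝ) (q : ℂ) : ℂ⟦X⟧ :=
  ofReal a ^ 2 - C q * (X * d⁄dX ℂ (ofReal a)) ^ 2
    + C q * (X ^ 2 * d⁄dX ℂ (d⁄dX ℂ (ofReal a)) * ofReal a)

/-- The part of the two-point sum with both heights below `m`, as a power series. -/
noncomputable def mainSeries (a : ℕ → ℝ) (z w : ℂ) (N m : ℕ) : ℂ⟦X⟧ :=
  ∑ i ∈ Finset.range m, ∑ j ∈ Finset.range m, C (z ^ i * w ^ j) *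
    ((X * d⁄dX ℂ (ofReal a)) ^ (i + j) * ofReal a ^ (N - 2 - (i + j)) *
      mainFactor a (z * w))

/-- Both indices are below `m`, so `i + j ≤ N - 2`: the truncated subtraction in `mainSeries` is a
genuine one, and two powers of `f` are left for `branchFactor`. -/
theorem mainSeries_eq (h : CriticalWeights a s) (z w : ℂ) {N m : ℕ} (hm : 2 * m ≤ N) :
    mainSeries a z w N m = ∑ i ∈ Finset.range m, ∑ j ∈ Finset.range m, C (z ^ i * w ^ j) *
      (branchFactor (ofReal a) (z * w) * logDer (ofReal a) ^ (i + j) * ofReal a ^ N) := by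
  refine Finset.sum_congr rfl fun i hi => Finset.sum_congr rfl fun j hj => ?_
  rw [Finset.mem_range] at hi hj
  rw [mainFactor, ← branchFactor_mul_logDer_pow_mul_pow h.constantCoeff_ne_zero]
  congr 3
  omega

theorem _root_.PowerSeries.AbsSummable.sum {ι : Type*} {t : Finset ι} {p : ι → ℂ⟦X⟧}
    (hp : ∀ i ∈ t, AbsSummable (p i)) : AbsSummable (∑ i ∈ t, p i) := by
  classical
  induction t using Finset.induction_on with
  | empty => simpa using AbsSummable.C 0
  | insert i t hi ih =>
    rw [Finset.sum_insert hi]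
    exact (hp i (by simp)).add (ih fun j hj => hp j (by simp [hj]))

theorem _root_.PowerSeries.AbsSummable.eval_sum {ι : Type*} {t : Finset ι} {p : ι → ℂ⟦X⟧}
    (hp : ∀ i ∈ t, AbsSummable (p i)) {x : ℂ} (hx : ‖x‖ ≤ 1) :
    evalAt x (∑ i ∈ t, p i) = ∑ i ∈ t, evalAt x (p i) := by
  classical
  induction t using Finset.induction_on with
  | empty => simpa using evalAt_C x 0
  | insert i t hi ih =>
    rw [Finset.sum_insert hi, Finset.sum_insert hi, (hp i (by simp)).eval_add
      (AbsSummable.sum fun j hj => hp j (by simp [hj])) hx, ih fun j hj => hp j (by simp [hj])]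

theorem absSummable_mainFactor (h : CriticalWeights a s) (q : ℂ) :
    AbsSummable (mainFactor a q) :=
  ((h.absSummable.pow 2).sub ((AbsSummable.C _).mul
    ((AbsSummable.X.mul h.absSummable_derivative).pow 2))).add ((AbsSummable.C _).mul
      (((AbsSummable.X.pow 2).mul h.absSummable_derivative_derivative).mul h.absSummable))

theorem absSummable_mainTerm (h : CriticalWeights a s) (q c : ℂ) (k l : ℕ) :
    AbsSummable (C c * ((X * d⁄dX ℂ (ofReal a)) ^ k * ofReal a ^ l * mainFactor a q)) :=
  (AbsSummable.C _).mul ((((AbsSummable.X.mul h.absSummable_derivative).pow _).mul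
    (h.absSummable.pow _)).mul (h.absSummable_mainFactor _))

theorem absSummable_mainSeries (h : CriticalWeights a s) (z w : ℂ) (N m : ℕ) :
    AbsSummable (mainSeries a z w N m) :=
  AbsSummable.sum fun _ _ => AbsSummable.sum fun _ _ => h.absSummable_mainTerm _ _ _ _

theorem supportedOn_mainSeries {d : ℕ} (hd : SupportedOn d (ofReal a)) (z w : ℂ) (N m : ℕ) :
    SupportedOn d (mainSeries a z w N m) :=
  SupportedOn.sum fun _ _ => SupportedOn.sum fun _ _ => (SupportedOn.C _).mul
    (((hd.X_mul_derivative.pow _).mul (hd.pow _)).mul (((hd.pow 2).sub ((SupportedOn.C _).mul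
      (hd.X_mul_derivative.pow 2))).add ((SupportedOn.C _).mul (hd.X_sq_mul_derivative.mul hd))))

theorem eval_mainSeries (h : CriticalWeights a s) (z w : ℂ) (N m : ℕ) {x : ℂ} (hx : ‖x‖ ≤ 1) :
    evalAt x (mainSeries a z w N m) = ∑ i ∈ Finset.range m, ∑ j ∈ Finset.range m, z ^ i * w ^ j *
      (evalAt x (X * d⁄dX ℂ (ofReal a)) ^ (i + j) * evalAt x (ofReal a) ^ (N - 2 - (i + j)) *
      evalAt x (mainFactor a (z * w))) := by
  rw [mainSeries, AbsSummable.eval_sum (fun _ _ => AbsSummable.sum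
    fun _ _ => h.absSummable_mainTerm _ _ _ _) hx]
  refine Finset.sum_congr rfl fun i _ => ?_
  rw [AbsSummable.eval_sum (fun _ _ => h.absSummable_mainTerm _ _ _ _) hx]
  refine Finset.sum_congr rfl fun j _ => ?_
  have hX := AbsSummable.X.mul h.absSummable_derivative
  rw [(AbsSummable.C _).eval_mul (((hX.pow _).mul
    (h.absSummable.pow _)).mul (h.absSummable_mainFactor _)) hx, evalAt_C,
    ((hX.pow _).mul (h.absSummable.pow _)).eval_mul (h.absSummable_mainFactor _) hx,
    (hX.pow _).eval_mul (h.absSummable.pow _) hx, hX.eval_pow _ hx, h.absSummable.eval_pow _ hx]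

theorem norm_eval_le_one (h : CriticalWeights a s) {x : ℂ} (hx : ‖x‖ ≤ 1) :
    ‖evalAt x (ofReal a)‖ ≤ 1 :=
  (h.absSummable.norm_evalAt_le hx).trans h.radiusNorm_one.le

theorem norm_eval_derivative_le_one (h : CriticalWeights a s) {x : ℂ} (hx : ‖x‖ ≤ 1) :
    ‖evalAt x (X * d⁄dX ℂ (ofReal a))‖ ≤ 1 := by
  rw [AbsSummable.X.eval_mul h.absSummable_derivative hx, evalAt_X, norm_mul]
  exact mul_le_one₀ hx (norm_nonneg _)
    ((h.absSummable_derivative.norm_evalAt_le hx).trans h.radiusNorm_derivative_one.le)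

theorem norm_eval_mainFactor_le (h : CriticalWeights a s) {q : ℂ} (hq : ‖q‖ ≤ 1) {x : ℂ}
    (hx : ‖x‖ ≤ 1) : ‖evalAt x (mainFactor a q)‖ ≤ 2 + s := by
  have hX := AbsSummable.X.mul h.absSummable_derivative
  have hX2 := (AbsSummable.X.pow 2).mul h.absSummable_derivative_derivative
  have hs := h.pos_var
  rw [mainFactor, AbsSummable.eval_add ((h.absSummable.pow 2).sub ((AbsSummable.C _).mul
    (hX.pow 2))) ((AbsSummable.C _).mul (hX2.mul h.absSummable)) hx,
    (h.absSummable.pow 2).eval_sub ((AbsSummable.C _).mul (hX.pow 2)) hx,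
    (AbsSummable.C _).eval_mul (hX.pow 2) hx, (AbsSummable.C _).eval_mul (hX2.mul h.absSummable) hx,
    hX2.eval_mul h.absSummable hx, h.absSummable.eval_pow 2 hx, hX.eval_pow 2 hx, evalAt_C,
    (AbsSummable.X.pow 2).eval_mul h.absSummable_derivative_derivative hx,
    AbsSummable.X.eval_pow 2 hx, evalAt_X]
  have e0 := h.norm_eval_le_one hx
  have e1 := h.norm_eval_derivative_le_one hx
  have e2 := (h.absSummable_derivative_derivative.norm_evalAt_le hx).trans
    (h.radiusNorm_derivative_derivative_le zero_le_one le_rfl)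
  refine (norm_add_le _ _).trans ?_
  have t1 : ‖evalAt x (ofReal a) ^ 2‖ ≤ 1 := by
    rw [norm_pow]; exact pow_le_one₀ (norm_nonneg _) e0
  have t2 : ‖q * evalAt x (X * d⁄dX ℂ (ofReal a)) ^ 2‖ ≤ 1 := by
    rw [norm_mul, norm_pow]
    exact mul_le_one₀ hq (by positivity) (pow_le_one₀ (norm_nonneg _) e1)
  have t3 : ‖q * (x ^ 2 * evalAt x (d⁄dX ℂ (d⁄dX ℂ (ofReal a))) * evalAt x (ofReal a))‖ ≤ s := by
    rw [norm_mul, norm_mul, norm_mul, norm_pow]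
    calc _ ≤ 1 * (1 * s * 1) := by
          gcongr
          exact pow_le_one₀ (norm_nonneg _) hx
      _ = s := by ring
  have := norm_sub_le (evalAt x (ofReal a) ^ 2) (q * evalAt x (X * d⁄dX ℂ (ofReal a)) ^ 2)
  linarith

/-- The crude bound for `mainSeries` on the unit circle. -/
theorem norm_eval_mainSeries_le (h : CriticalWeights a s) {z w : ℂ} (hz : ‖z‖ ≤ 1) (hw : ‖w‖ ≤ 1)
    {N m : ℕ} {x : ℂ} (hx : ‖x‖ ≤ 1) :
    ‖evalAt x (mainSeries a z w N m)‖ ≤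
      m ^ 2 * ((2 + s) * ‖evalAt x (ofReal a)‖ ^ (N - 2 * m)) := by
  have hs := h.pos_var
  rw [h.eval_mainSeries z w N m hx]
  have hterm : ∀ i ∈ Finset.range m, ∀ j ∈ Finset.range m, ‖z ^ i * w ^ j *
      (evalAt x (X * d⁄dX ℂ (ofReal a)) ^ (i + j) * evalAt x (ofReal a) ^ (N - 2 - (i + j)) *
      evalAt x (mainFactor a (z * w)))‖ ≤ (2 + s) * ‖evalAt x (ofReal a)‖ ^ (N - 2 * m) := by
    intro i hi j hj
    rw [Finset.mem_range] at hi hj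
    have e0 := h.norm_eval_le_one hx
    have e1 := h.norm_eval_derivative_le_one hx
    have e2 : ‖evalAt x (mainFactor a (z * w))‖ ≤ 2 + s := h.norm_eval_mainFactor_le
      (by rw [norm_mul]; exact mul_le_one₀ hz (norm_nonneg _) hw) hx
    simp only [norm_mul, norm_pow]
    calc _ ≤ 1 * 1 * (1 * ‖evalAt x (ofReal a)‖ ^ (N - 2 * m) * (2 + s)) := by
          gcongr ?_ * ?_ * (?_ * ?_ * ?_)
          · exact pow_le_one₀ (norm_nonneg _) hz
          · exact pow_le_one₀ (norm_nonneg _) hw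
          · exact pow_le_one₀ (norm_nonneg _) e1
          · exact pow_le_pow_of_le_one (norm_nonneg _) e0 (by omega)
      _ = _ := by ring
  calc _ ≤ ∑ i ∈ Finset.range m, ∑ j ∈ Finset.range m,
        (2 + s) * ‖evalAt x (ofReal a)‖ ^ (N - 2 * m) :=
        norm_sum_le_of_le _ fun i hi => norm_sum_le_of_le _ fun j hj => hterm i hi j hj
    _ = _ := by simp [pow_two, mul_assoc]

/-- The geometric sum times `φ ^ m * (φ - z g)` equals `φ * (φ ^ m - (z g) ^ m)`, in which nothing
is divided by a small `φ`. The factor `‖φ‖ ^ m` is taken later from the available power of `φ`. -/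
theorem norm_geom_sum_le {z g φ : ℂ} (hz : ‖z‖ ≤ 1) (hg : ‖g‖ ≤ 1) (hφ : ‖φ‖ ≤ 1) (hφ0 : φ ≠ 0)
    {B : ℝ} (hzg : B ≤ ‖φ - z * g‖) (m : ℕ) :
    ‖∑ i ∈ Finset.range m, (z * (g / φ)) ^ i‖ * (‖φ‖ ^ m * B) ≤ 2 := by
  have hn : 0 < ‖φ‖ := norm_pos_iff.2 hφ0
  have h1 : (∑ i ∈ Finset.range m, (z * (g / φ)) ^ i) * (φ ^ m * (φ - z * g))
      = φ * (φ ^ m - (z * g) ^ m) := by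
    have h2 := geom_sum_mul_neg (z * (g / φ)) m
    have h3 : φ - z * g = φ * (1 - z * (g / φ)) := by field_simp
    have h4 : φ ^ m * (1 - (z * (g / φ)) ^ m) = φ ^ m - (z * g) ^ m := by
      rw [mul_sub, mul_one, ← mul_pow]
      congr 2
      field_simp
    rw [h3, ← h4, ← h2]
    ring
  have h5 := congrArg norm h1
  rw [norm_mul, norm_mul, norm_pow, norm_mul] at h5
  have h6 : ‖φ ^ m - (z * g) ^ m‖ ≤ 2 := by
    refine (norm_sub_le _ _).trans ?_
    rw [norm_pow, norm_pow, norm_mul]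
    have := pow_le_one₀ (norm_nonneg φ) hφ (n := m)
    have := pow_le_one₀ (n := m) (by positivity) (mul_le_one₀ hz (norm_nonneg _) hg)
    linarith
  calc _ ≤ ‖∑ i ∈ Finset.range m, (z * (g / φ)) ^ i‖ * (‖φ‖ ^ m * ‖φ - z * g‖) := by gcongr
    _ = _ := h5
    _ ≤ 1 * 2 := by gcongr
    _ = 2 := one_mul 2

/-- The bound for `mainSeries` near the critical point. -/
theorem norm_eval_mainSeries_le_of_cone (h : CriticalWeights a s) {z w : ℂ} (hz : ‖z‖ ≤ 1)
    (hw : ‖w‖ ≤ 1) {N m : ℕ} (hN : 2 * m + 2 ≤ N) {x : ℂ} (hx : ‖x‖ ≤ 1)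
    (h0 : evalAt x (ofReal a) ≠ 0) {B B' : ℝ} (hB' : 0 < B')
    (hzB : B ≤ ‖evalAt x (ofReal a) - z * evalAt x (X * d⁄dX ℂ (ofReal a))‖)
    (hwB : B' ≤ ‖evalAt x (ofReal a) - w * evalAt x (X * d⁄dX ℂ (ofReal a))‖) :
    ‖evalAt x (mainSeries a z w N m)‖ * (B * B') ≤
      4 * (2 + s) * ‖evalAt x (ofReal a)‖ ^ (N - 2 - 2 * m) := by
  have e0 := h.norm_eval_le_one hx
  have e1 := h.norm_eval_derivative_le_one hx
  have e2 : ‖evalAt x (mainFactor a (z * w))‖ ≤ 2 + s := h.norm_eval_mainFactor_le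
    (by rw [norm_mul]; exact mul_le_one₀ hz (norm_nonneg _) hw) hx
  rw [h.eval_mainSeries z w N m hx]
  set φ := evalAt x (ofReal a)
  set g := evalAt x (X * d⁄dX ℂ (ofReal a))
  set E := evalAt x (mainFactor a (z * w))
  have hs := h.pos_var
  -- The powers of `g` and `φ` depend on `i` and `j` only through `(g / φ) ^ (i + j)`, so the double
  -- sum is a product of two geometric sums.
  have hfac : ∑ i ∈ Finset.range m, ∑ j ∈ Finset.range m, z ^ i * w ^ j *
      (g ^ (i + j) * φ ^ (N - 2 - (i + j)) * E) = (∑ i ∈ Finset.range m, (z * (g / φ)) ^ i) *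
        (∑ j ∈ Finset.range m, (w * (g / φ)) ^ j) * (φ ^ (N - 2) * E) := by
    rw [Finset.sum_mul_sum, Finset.sum_mul]
    refine Finset.sum_congr rfl fun i hi => ?_
    rw [Finset.sum_mul]
    refine Finset.sum_congr rfl fun j hj => ?_
    rw [Finset.mem_range] at hi hj
    have h3 : φ ^ (N - 2) = φ ^ (N - 2 - (i + j)) * φ ^ (i + j) := by
      rw [← pow_add]; congr 1; omega
    rw [h3, mul_pow, mul_pow, div_pow, div_pow, pow_add, pow_add]
    field_simp
  have h1 := norm_geom_sum_le hz e1 e0 h0 hzB m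
  have h2 := norm_geom_sum_le hw e1 e0 h0 hwB m
  have h4 : ‖φ‖ ^ (N - 2) = ‖φ‖ ^ (N - 2 - 2 * m) * (‖φ‖ ^ m * ‖φ‖ ^ m) := by
    rw [← pow_add, ← pow_add]; congr 1; omega
  rw [hfac, norm_mul, norm_mul, norm_mul, norm_pow, h4]
  set S := ‖∑ i ∈ Finset.range m, (z * (g / φ)) ^ i‖
  set T := ‖∑ i ∈ Finset.range m, (w * (g / φ)) ^ i‖
  calc _ = (S * (‖φ‖ ^ m * B)) * (T * (‖φ‖ ^ m * B')) * ‖E‖ * ‖φ‖ ^ (N - 2 - 2 * m) := by ring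
    _ ≤ 2 * 2 * (2 + s) * ‖φ‖ ^ (N - 2 - 2 * m) := by gcongr
    _ = _ := by ring

end CriticalWeights

open PowerSeries

theorem exists_pow_mul_pow_le (p : ℕ) {x : ℝ} (h0 : 0 ≤ x) (h1 : x < 1) :
    ∃ D > 0, ∀ n : ℕ, (n : ℝ) ^ p * x ^ n ≤ D := by
  obtain ⟨D, hD⟩ := (tendsto_pow_const_mul_const_pow_of_lt_one p h0 h1).bddAbove_range
  exact ⟨max D 1, by positivity, fun n => (hD ⟨n, rfl⟩).trans (le_max_left _ _)⟩

theorem norm_one_sub_le_two {z : ℂ} (hz : ‖z‖ ≤ 1) : ‖1 - z‖ ≤ 2 := by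
  have := norm_sub_le 1 z
  rw [norm_one] at this
  linarith

namespace CriticalWeights

variable {a : ℕ → ℝ} {s : ℝ}

/-- The tail of the double sum is controlled by its largest term. -/
theorem norm_sum_sub_sum_le {t : ℕ → ℕ → ℂ} {N m : ℕ} (hm : m ≤ N) {B : ℝ} (hB : 0 ≤ B)
    (ht : ∀ i j, m ≤ i ∨ m ≤ j → ‖t i j‖ ≤ B) :
    ‖∑ i ∈ Finset.range N, ∑ j ∈ Finset.range N, t i j‖ ≤
      ‖∑ i ∈ Finset.range m, ∑ j ∈ Finset.range m, t i j‖ + N ^ 2 * B := by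
  rw [← Finset.sum_product', ← Finset.sum_product', add_comm]
  have hsub : Finset.range m ×ˢ Finset.range m ⊆ Finset.range N ×ˢ Finset.range N :=
    Finset.product_subset_product (Finset.range_mono hm) (Finset.range_mono hm)
  rw [← Finset.sum_sdiff hsub]
  refine (norm_add_le _ _).trans (add_le_add_left ?_ _)
  calc _ ≤ ∑ _x ∈ (Finset.range N ×ˢ Finset.range N) \ (Finset.range m ×ˢ Finset.range m), B := by
        refine norm_sum_le_of_le _ fun x hx => ht _ _ ?_
        simp only [Finset.mem_sdiff, Finset.mem_product, Finset.mem_range, not_and_or, not_lt] at hx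
        exact hx.2
    _ ≤ ∑ _x ∈ Finset.range N ×ˢ Finset.range N, B :=
        Finset.sum_le_sum_of_subset_of_nonneg Finset.sdiff_subset fun _ _ _ => hB
    _ = _ := by simp [pow_two]

/-- The Gaussian domination of `mainSeries` on one period of the unit circle. -/
theorem exists_mainSeries_bound (h : CriticalWeights a s) {K : ℝ} (hK : 0 ≤ K) {d : ℕ} (hd : 0 < d)
    (hlt : ∀ θ : ℝ, |θ| ≤ Real.pi / d → θ ≠ 0 →
      ‖evalAt (Complex.exp (Complex.I * θ)) (ofReal a)‖ < 1) :
    ∃ c > 0, ∃ D > 0, ∀ N m : ℕ, 2 * m + 2 ≤ N → N ≤ 4 * (N - 2 - 2 * m) → ∀ z w : ℂ,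
      ‖z‖ ≤ 1 → ‖w‖ ≤ 1 → z ≠ 1 → w ≠ 1 → |z.im| ≤ K * (1 - z.re) → |w.im| ≤ K * (1 - w.re) →
      ∀ θ : ℝ, |θ| ≤ Real.pi / d →
      ‖evalAt (Complex.exp (Complex.I * θ)) (mainSeries a z w N m)‖ * (‖1 - z‖ * ‖1 - w‖) ≤
        D * Real.exp (-(c * N) * θ ^ 2) := by
  obtain ⟨c, hc, hgauss⟩ := h.exists_gaussian_bound hd hlt
  obtain ⟨δ, hδ, c₁, hc₁, hcone⟩ := h.exists_cone_bound hK
  have hs := h.pos_var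
  obtain ⟨D₁, hD₁, hbound⟩ := exists_pow_mul_pow_le 2 (x := Real.exp (-(c * δ ^ 2 / 8)))
    (Real.exp_pos _).le (Real.exp_lt_one_iff.2 (neg_neg_of_pos (by positivity)))
  refine ⟨c / 8, by positivity, 4 * (2 + s) / (c₁ * c₁) + 4 * (2 + s) * D₁, by positivity, ?_⟩
  intro N m hm hN z w hz hw hz1 hw1 hzK hwK θ hθ
  set x := Complex.exp (Complex.I * θ)
  have hx : ‖x‖ ≤ 1 := AbsSummable.norm_exp_I_mul_le θ
  have hzre : z.re ≤ 1 := (Complex.re_le_norm z).trans hz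
  have hwre : w.re ≤ 1 := (Complex.re_le_norm w).trans hw
  have e0 := h.norm_eval_le_one hx
  have hzp : 0 < ‖1 - z‖ := norm_pos_iff.2 (sub_ne_zero.2 hz1.symm)
  have hwp : 0 < ‖1 - w‖ := norm_pos_iff.2 (sub_ne_zero.2 hw1.symm)
  -- After the geometric sums are paid for, at least a quarter of the `N` powers of `f` survives,
  -- hence a Gaussian of exponent `c / 4`.
  have hpow (L : ℕ) (hL : N ≤ 4 * L) : ‖evalAt x (ofReal a)‖ ^ L ≤
      Real.exp (-(c / 4 * N) * θ ^ 2) := by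
    refine (pow_le_pow_left₀ (norm_nonneg _) (hgauss θ hθ) L).trans ?_
    rw [← Real.exp_nat_mul]
    refine Real.exp_le_exp.2 ?_
    have : (N : ℝ) ≤ 4 * L := by exact_mod_cast hL
    have h2 : 0 ≤ c * θ ^ 2 := by positivity
    nlinarith
  have hN0 : (0 : ℝ) ≤ N := by positivity
  rcases le_total |θ| δ with hnear | hfar
  · obtain ⟨p1, p2⟩ := hcone θ hnear
    have h1 := h.norm_eval_mainSeries_le_of_cone hz hw hm hx p1 (mul_pos hc₁ hwp)
      (p2 z hzK hzre) (p2 w hwK hwre)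
    have h2 := hpow _ hN
    have h3 : Real.exp (-(c / 4 * N) * θ ^ 2) ≤ Real.exp (-(c / 8 * N) * θ ^ 2) := by
      refine Real.exp_le_exp.2 ?_
      have : 0 ≤ c * N * θ ^ 2 := by positivity
      nlinarith
    calc _ = ‖evalAt x (mainSeries a z w N m)‖ * (c₁ * ‖1 - z‖ * (c₁ * ‖1 - w‖)) / (c₁ * c₁) := by
          field_simp
      _ ≤ 4 * (2 + s) * Real.exp (-(c / 8 * N) * θ ^ 2) / (c₁ * c₁) := by
          refine div_le_div_of_nonneg_right ?_ (by positivity)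
          exact h1.trans (mul_le_mul_of_nonneg_left (h2.trans h3) (by positivity))
      _ = 4 * (2 + s) / (c₁ * c₁) * Real.exp (-(c / 8 * N) * θ ^ 2) := by ring
      _ ≤ _ := by
          refine mul_le_mul_of_nonneg_right ?_ (Real.exp_pos _).le
          have : 0 ≤ 4 * (2 + s) * D₁ := by positivity
          linarith
  · have h1 := h.norm_eval_mainSeries_le hz hw (N := N) (m := m) hx
    have h2 := hpow (N - 2 * m) (by omega)
    -- Away from `0`, half of the exponent is exponentially small in `N` and absorbs the number `m ^
    -- 2` of terms; the other half remains as the Gaussian.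
    have h4 : Real.exp (-(c / 4 * N) * θ ^ 2) ≤
        Real.exp (-(c * δ ^ 2 / 8)) ^ N * Real.exp (-(c / 8 * N) * θ ^ 2) := by
      rw [← Real.exp_nat_mul, ← Real.exp_add]
      refine Real.exp_le_exp.2 ?_
      have h5 : δ ^ 2 ≤ θ ^ 2 := by
        rw [← sq_abs θ]; exact pow_le_pow_left₀ hδ.le hfar 2
      have : c * N * δ ^ 2 ≤ c * N * θ ^ 2 := mul_le_mul_of_nonneg_left h5 (by positivity)
      nlinarith
    have h6 : (m : ℝ) ≤ N := by exact_mod_cast (by omega : m ≤ N)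
    have hz2 := norm_one_sub_le_two hz
    have hw2 := norm_one_sub_le_two hw
    calc _ ≤ (m ^ 2 * ((2 + s) * ‖evalAt x (ofReal a)‖ ^ (N - 2 * m))) * (2 * 2) := by gcongr
      _ ≤ (N ^ 2 * ((2 + s) * (Real.exp (-(c * δ ^ 2 / 8)) ^ N *
          Real.exp (-(c / 8 * N) * θ ^ 2)))) * (2 * 2) := by
          gcongr
          exact h2.trans h4
      _ = 4 * (2 + s) * (N ^ 2 * Real.exp (-(c * δ ^ 2 / 8)) ^ N) *
          Real.exp (-(c / 8 * N) * θ ^ 2) := by ring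
      _ ≤ 4 * (2 + s) * D₁ * Real.exp (-(c / 8 * N) * θ ^ 2) := by
          gcongr
          exact hbound N
      _ ≤ _ := by
          refine mul_le_mul_of_nonneg_right ?_ (Real.exp_pos _).le
          have : 0 ≤ 4 * (2 + s) / (c₁ * c₁) := by positivity
          linarith

/-- The main estimate for the two-point sum. -/
theorem exists_twoPoint_bound (h : CriticalWeights a s) {K : ℝ} (hK : 0 ≤ K) {d : ℕ} (hd : 0 < d)
    (hsupp : SupportedOn d (ofReal a))
    (hlt : ∀ θ : ℝ, |θ| ≤ Real.pi / d → θ ≠ 0 →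
      ‖evalAt (Complex.exp (Complex.I * θ)) (ofReal a)‖ < 1) :
    ∃ D > 0, ∀ n : ℕ, 8 ≤ n + 1 → d ∣ n → ∀ z w : ℂ,
      ‖z‖ ≤ 1 → ‖w‖ ≤ 1 → z ≠ 1 → w ≠ 1 → |z.im| ≤ K * (1 - z.re) → |w.im| ≤ K * (1 - w.re) →
      ‖∑ i ∈ Finset.range (n + 1), ∑ j ∈ Finset.range (n + 1), z ^ i * w ^ j *
        coeff n (branchFactor (ofReal a) (z * w) * logDer (ofReal a) ^ (i + j)
          * ofReal a ^ (n + 1))‖ * (‖1 - z‖ * ‖1 - w‖) ≤ D / √(n + 1 : ℝ) := by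
  obtain ⟨c, hc, D₁, hD₁, hmain⟩ := h.exists_mainSeries_bound hK hd hlt
  obtain ⟨r, hr0, hr1, hρ1⟩ := h.exists_radius 8
  set ρ := (radiusNorm r (ofReal a) / r) ^ 8 * radiusNorm r (d⁄dX ℂ (ofReal a)) with hρ
  have hρ0 : 0 ≤ ρ := mul_nonneg (pow_nonneg (div_nonneg (radiusNorm_nonneg _ hr0.le) hr0.le) _)
    (radiusNorm_nonneg _ hr0.le)
  obtain ⟨D₂, hD₂, hbound⟩ := exists_pow_mul_pow_le 3 hρ0 hρ1
  have hs := h.pos_var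
  refine ⟨d / (2 * Real.pi) * (D₁ * √(Real.pi / c)) + 4 * (2 + s) * (512 * D₂), by positivity, ?_⟩
  intro n hn hdn z w hz hw hz1 hw1 hzK hwK
  set N := n + 1 with hN
  -- Large enough that `N ≤ 8 m`, matching the exponent `8` of `exists_radius`, and small enough
  -- that `2 m + 2 ≤ N` and `N ≤ 4 (N - 2 - 2 m)` as soon as `N ≥ 8`.
  set m := N / 8 + 1 with hm
  have hzw : ‖z * w‖ ≤ 1 := by rw [norm_mul]; exact mul_le_one₀ hz (norm_nonneg _) hw
  have hN0 : (0 : ℝ) < N := by positivity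
  have hcast : (n + 1 : ℝ) = N := by rw [hN]; push_cast; rfl
  rw [hcast]
  have hz2 := norm_one_sub_le_two hz
  have hw2 := norm_one_sub_le_two hw
  have hint : ‖coeff n (mainSeries a z w N m)‖ * (‖1 - z‖ * ‖1 - w‖) ≤
      d / (2 * Real.pi) * (D₁ * √(Real.pi / c)) / √(N : ℝ) := by
    have hsum := h.absSummable_mainSeries z w N m
    rw [hsum.coeff_eq_integral hd (supportedOn_mainSeries hsupp z w N m) hdn, norm_mul]
    have hpd : -(Real.pi / d) ≤ Real.pi / d := by
      have : 0 ≤ Real.pi / d := by positivity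
      linarith
    have hcn : ‖(d / (2 * Real.pi) : ℂ)‖ = d / (2 * Real.pi) := by
      rw [show (d / (2 * Real.pi) : ℂ) = ((d / (2 * Real.pi) : ℝ) : ℂ) by push_cast; rfl,
        Complex.norm_real, Real.norm_of_nonneg (by positivity)]
    have hGint : Integrable fun θ : ℝ => D₁ * Real.exp (-(c * N) * θ ^ 2) :=
      (integrable_exp_neg_mul_sq (by positivity)).const_mul _
    have h1 : ‖∫ θ in (-(Real.pi / d))..(Real.pi / d),
        evalAt (Complex.exp (Complex.I * θ)) (mainSeries a z w N m) *
          Complex.exp (-(Complex.I * n * θ))‖ * (‖1 - z‖ * ‖1 - w‖) ≤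
        ∫ θ in (-(Real.pi / d))..(Real.pi / d), D₁ * Real.exp (-(c * N) * θ ^ 2) := by
      rw [← norm_mul, ← norm_mul, ← intervalIntegral.integral_mul_const]
      refine intervalIntegral.norm_integral_le_of_norm_le hpd (ae_of_all _ fun θ hθ => ?_)
        hGint.intervalIntegrable
      rw [norm_mul, norm_mul, norm_mul (1 - z)]
      rw [show -(Complex.I * n * θ) = ((-(n * θ) : ℝ) : ℂ) * Complex.I by push_cast; ring,
        Complex.norm_exp_ofReal_mul_I, mul_one]
      exact hmain N m (by omega) (by omega) z w hz hw hz1 hw1 hzK hwK θ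
        (abs_le.2 ⟨hθ.1.le, hθ.2⟩)
    -- The Gaussian integral over the whole line is the source of the factor `1 / √N`.
    have h2 : ∫ θ in (-(Real.pi / d))..(Real.pi / d), D₁ * Real.exp (-(c * N) * θ ^ 2) ≤
        D₁ * √(Real.pi / (c * N)) := by
      rw [intervalIntegral.integral_of_le hpd, ← integral_gaussian, ← integral_const_mul]
      exact setIntegral_le_integral hGint (ae_of_all _ fun θ => by
        have := Real.exp_pos (-(c * N) * θ ^ 2); positivity)
    rw [hcn, mul_assoc]
    refine (mul_le_mul_of_nonneg_left (h1.trans h2) (by positivity)).trans (le_of_eq ?_)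
    have h6 : √(Real.pi / (c * N)) = √(Real.pi / c) / √(N : ℝ) := by
      rw [← div_div, Real.sqrt_div (by positivity)]
    rw [h6]
    ring
  have htail := norm_sum_sub_sum_le (t := fun i j => z ^ i * w ^ j *
        coeff n (branchFactor (ofReal a) (z * w) * logDer (ofReal a) ^ (i + j)
          * ofReal a ^ (n + 1))) (N := N) (m := m) (by omega) (B := (2 + s) * ρ ^ m)
      (by positivity) (fun i j hij => by
        have h3 := h.norm_coeff_branchFactor_le hr0 hr1 hzw (n := n) (k := i + j) (m := m)
          (by omega) (by omega)
        rw [norm_mul, norm_mul, norm_pow, norm_pow]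
        calc _ ≤ 1 * 1 * ((2 + s) * ρ ^ m) := by
              gcongr
              · exact pow_le_one₀ (norm_nonneg _) hz
              · exact pow_le_one₀ (norm_nonneg _) hw
          _ = _ := by ring)
  have hmainsum : ∑ i ∈ Finset.range m, ∑ j ∈ Finset.range m, z ^ i * w ^ j *
        coeff n (branchFactor (ofReal a) (z * w) * logDer (ofReal a) ^ (i + j)
          * ofReal a ^ (n + 1)) = coeff n (mainSeries a z w N m) := by
    rw [h.mainSeries_eq z w (by omega), map_sum]
    refine Finset.sum_congr rfl fun i _ => ?_
    rw [map_sum]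
    refine Finset.sum_congr rfl fun j _ => ?_
    rw [coeff_C_mul]
  rw [hmainsum] at htail
  -- There are at most `N ^ 2` tail terms, and one more factor `N ≥ √N` brings them to the scale `1
  -- / √N`; this is why the cube was bounded in `hbound`.
  have hrem : (N : ℝ) ^ 2 * ((2 + s) * ρ ^ m) * √(N : ℝ) ≤ (2 + s) * (512 * D₂) := by
    have h4 : √(N : ℝ) ≤ N := by
      rw [Real.sqrt_le_left hN0.le]
      have : (1 : ℝ) ≤ N := by exact_mod_cast (by omega : 1 ≤ N)
      nlinarith
    have h5 : (N : ℝ) ≤ 8 * m := by exact_mod_cast (by omega : N ≤ 8 * m)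
    calc _ ≤ (N : ℝ) ^ 2 * ((2 + s) * ρ ^ m) * N := by gcongr
      _ = (2 + s) * (N ^ 3 * ρ ^ m) := by ring
      _ ≤ (2 + s) * ((8 * m) ^ 3 * ρ ^ m) := by gcongr
      _ = (2 + s) * (512 * (m ^ 3 * ρ ^ m)) := by ring
      _ ≤ _ := by gcongr; exact hbound m
  have hsq : 0 < √(N : ℝ) := Real.sqrt_pos.2 hN0
  rw [← le_div_iff₀ hsq] at hrem
  calc _ ≤ (‖coeff n (mainSeries a z w N m)‖ + N ^ 2 * ((2 + s) * ρ ^ m)) *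
        (‖1 - z‖ * ‖1 - w‖) := by gcongr
    _ = ‖coeff n (mainSeries a z w N m)‖ * (‖1 - z‖ * ‖1 - w‖) +
        (N ^ 2 * ((2 + s) * ρ ^ m)) * (‖1 - z‖ * ‖1 - w‖) := by ring
    _ ≤ d / (2 * Real.pi) * (D₁ * √(Real.pi / c)) / √(N : ℝ) +
        ((2 + s) * (512 * D₂) / √(N : ℝ)) * (2 * 2) := by gcongr
    _ = _ := by ring

end CriticalWeights

/-! ### The offspring law and the local limit lower bound -/

open PowerSeries

/-- The integral against a law on a countable discrete space, as a sum over its point masses. -/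
theorem hasSum_integral_discrete {X E : Type*} [MeasurableSpace X] [MeasurableSingletonClass X]
    [Countable X] [NormedAddCommGroup E] [NormedSpace ℝ E] [CompleteSpace E] {μ : Measure X}
    [IsFiniteMeasure μ] {f : X → E} (hf : Integrable f μ) :
    HasSum (fun x => μ.real {x} • f x) (∫ x, f x ∂μ) := by
  rw [← Measure.sum_smul_dirac μ] at hf
  have h := hasSum_integral_measure hf
  rw [Measure.sum_smul_dirac] at h
  simpa [integral_smul_measure, integral_dirac, measureReal_def] using h

theorem criticalWeights_of_measure (ξ : Measure ℕ) [IsProbabilityMeasure ξ]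
    (hξ_sq : MemLp (fun k : ℕ => (k : ℝ)) 2 ξ) (hξ_mean : ∫ k : ℕ, (k : ℝ) ∂ξ = 1)
    (hξ_var : 0 < variance (fun k : ℕ => (k : ℝ)) ξ) :
    CriticalWeights (fun k => ξ.real {k}) (variance (fun k : ℕ => (k : ℝ)) ξ) := by
  have hint : Integrable (fun k : ℕ => (k : ℝ)) ξ := hξ_sq.integrable one_le_two
  have hsum : HasSum (fun k : ℕ => ξ.real {k}) 1 := by
    simpa using hasSum_integral_discrete (integrable_const (1 : ℝ) (μ := ξ))
  have hmean : HasSum (fun k : ℕ => ξ.real {k} * k) 1 := by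
    have := hasSum_integral_discrete hint
    rw [hξ_mean] at this
    exact this
  have hsq : HasSum (fun k : ℕ => ξ.real {k} * (k : ℝ) ^ 2)
      (1 + variance (fun k : ℕ => (k : ℝ)) ξ) := by
    have := hasSum_integral_discrete hξ_sq.integrable_sq
    rw [variance_eq_sub hξ_sq, hξ_mean]
    simpa using this
  refine ⟨fun k => measureReal_nonneg, hsum, hmean, hsq, ?_, hξ_var⟩
  -- Without mass at `0`, mean `1` forces the offspring number to be `1` almost surely, so the
  -- second moment equals the mean and the variance vanishes.
  refine lt_of_le_of_ne measureReal_nonneg fun h0 => ?_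
  have h1 : HasSum (fun k : ℕ => ξ.real {k} * k - ξ.real {k}) (1 - 1) := hmean.sub hsum
  rw [sub_self] at h1
  have h2 := (hasSum_zero_iff_of_nonneg (fun k => by
    rcases k with _ | k
    · simp [← h0]
    · simp only [Nat.cast_add, Nat.cast_one]
      have : 0 ≤ ξ.real {k + 1} * k := mul_nonneg measureReal_nonneg (by positivity)
      linarith)).1 h1
  have h3 : ∀ k : ℕ, ξ.real {k} * (k : ℝ) ^ 2 = ξ.real {k} * k := fun k => by
    have := congrFun h2 k
    simp only [Pi.zero_apply] at this
    linear_combination (k : ℝ) * this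
  have h4 := hsq.unique (by simpa only [h3] using hmean)
  linarith

/-- The central limit theorem at the level of characteristic functions, for the normalised variable
`(k - 1) / √s` at the argument `√s * t`. -/
theorem tendsto_eval_pow (ξ : Measure ℕ) [IsProbabilityMeasure ξ]
    (hξ_sq : MemLp (fun k : ℕ => (k : ℝ)) 2 ξ) (hξ_mean : ∫ k : ℕ, (k : ℝ) ∂ξ = 1)
    (hξ_var : 0 < variance (fun k : ℕ => (k : ℝ)) ξ) (t : ℝ) :
    Filter.Tendsto (fun n : ℕ => (evalAt (Complex.exp (Complex.I * (t / √n : ℝ)))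
        (ofReal fun k => ξ.real {k}) * Complex.exp (-(Complex.I * (t / √n : ℝ)))) ^ n)
      Filter.atTop (nhds (Complex.exp (-(variance (fun k : ℕ => (k : ℝ)) ξ / 2 * t ^ 2 : ℝ)))) := by
  have hint : Integrable (fun k : ℕ => (k : ℝ)) ξ := hξ_sq.integrable one_le_two
  set s := variance (fun k : ℕ => (k : ℝ)) ξ with hs
  have hs0 : 0 < √s := Real.sqrt_pos.2 hξ_var
  set X : ℕ → ℝ := fun k => ((k : ℝ) - 1) / √s with hX
  have h0 : ξ[X] = 0 := by
    rw [integral_div, integral_sub hint (integrable_const _), hξ_mean]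
    simp
  have h1 : ξ[X ^ 2] = 1 := by
    have e1 : (X ^ 2 : ℕ → ℝ) = fun k : ℕ => ((k : ℝ) - 1) ^ 2 / s := by
      ext k
      simp only [hX, Pi.pow_apply, div_pow, Real.sq_sqrt hξ_var.le]
    have e2 : s = ∫ k : ℕ, ((k : ℝ) - 1) ^ 2 ∂ξ := by
      rw [hs, variance_eq_integral (by fun_prop), hξ_mean]
    rw [e1, integral_div, ← e2, div_self hξ_var.ne']
  have hlim := tendsto_charFun_inv_sqrt_mul_pow (X := X) (P := ξ) (by fun_prop) h0 h1 (√s * t)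
  have e3 : (-(↑(√s * t) : ℂ) ^ 2 / 2) = (-(s / 2 * t ^ 2 : ℝ) : ℂ) := by
    push_cast
    rw [mul_pow, ← Complex.ofReal_pow, Real.sq_sqrt hξ_var.le]
    ring
  rw [e3] at hlim
  refine hlim.congr fun n => ?_
  congr 1
  rw [charFun_apply_real, integral_map (by fun_prop) (by fun_prop)]
  have e4 : ∀ k : ℕ, Complex.exp (((√n)⁻¹ * (√s * t) : ℝ) * (X k : ℝ) * Complex.I) =
      Complex.exp (Complex.I * (t / √n : ℝ)) ^ k * Complex.exp (-(Complex.I * (t / √n : ℝ))) := by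
    intro k
    rw [← Complex.exp_nat_mul, ← Complex.exp_add]
    congr 1
    have e5 : (√n)⁻¹ * (√s * t) * X k = (t / √n) * (k - 1) := by
      simp only [hX]
      field_simp
    rw [← Complex.ofReal_mul, e5]
    push_cast
    ring
  simp_rw [e4]
  rw [integral_mul_const]
  congr 1
  rw [evalAt]
  have hbd : Integrable (fun k : ℕ => Complex.exp (Complex.I * (t / √n : ℝ)) ^ k) ξ := by
    refine Integrable.of_bound (by fun_prop) 1 (ae_of_all _ fun k => ?_)
    rw [norm_pow]
    exact pow_le_one₀ (norm_nonneg _) (AbsSummable.norm_exp_I_mul_le _)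
  rw [← (hasSum_integral_discrete hbd).tsum_eq]
  refine tsum_congr fun k => ?_
  rw [ofReal, coeff_mk, Complex.real_smul]

/-- The lower bound in the local limit theorem at `S_{n + 1} = n`. -/
theorem exists_coeff_pow_lower_bound (ξ : Measure ℕ) [IsProbabilityMeasure ξ]
    (hξ_sq : MemLp (fun k : ℕ => (k : ℝ)) 2 ξ) (hξ_mean : ∫ k : ℕ, (k : ℝ) ∂ξ = 1)
    (hξ_var : 0 < variance (fun k : ℕ => (k : ℝ)) ξ) {d : ℕ} (hd : 0 < d)
    (hsupp : SupportedOn d (ofReal fun k => ξ.real {k}))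
    (hlt : ∀ θ : ℝ, |θ| ≤ Real.pi / d → θ ≠ 0 →
      ‖evalAt (Complex.exp (Complex.I * θ)) (ofReal fun k => ξ.real {k})‖ < 1) :
    ∃ c > 0, ∃ n₀ : ℕ, ∀ n ≥ n₀, d ∣ n →
      c / √(n + 1 : ℝ) ≤ ‖coeff n ((ofReal fun k => ξ.real {k}) ^ (n + 1))‖ := by
  have h := criticalWeights_of_measure ξ hξ_sq hξ_mean hξ_var
  set s := variance (fun k : ℕ => (k : ℝ)) ξ with hs
  set a : ℕ → ℝ := fun k => ξ.real {k} with ha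
  obtain ⟨c, hc, hgauss⟩ := h.exists_gaussian_bound hd hlt
  set φ : ℝ → ℂ := fun θ => evalAt (Complex.exp (Complex.I * θ)) (ofReal a) with hφ
  have hφc : Continuous φ := h.absSummable.continuous_evalAt_exp
  have hpi := Real.pi_pos
  set R := Real.pi / d with hR
  have hR0 : 0 < R := by positivity
  -- The coefficient integrand after the substitution `θ = t / √n`, extended by zero. The last
  -- factor `exp (i θ)` compensates for extracting the coefficient of order one less than the power
  -- of `f`; it tends to `1`.
  set J : ℕ → ℝ → ℂ := fun n => (Set.Ioc (-R * √n) (R * √n)).indicator fun t =>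
    (φ (t / √n) * Complex.exp (-(Complex.I * (t / √n : ℝ)))) ^ n *
      Complex.exp (Complex.I * (t / √n : ℝ)) with hJ
  have hlim : Filter.Tendsto (fun n => ∫ t, J n t) Filter.atTop
      (nhds (∫ t : ℝ, Complex.exp (-(s / 2 * t ^ 2 : ℝ)))) := by
    refine tendsto_integral_of_dominated_convergence (fun t => Real.exp (-c * t ^ 2))
      (fun n => ?_) (integrable_exp_neg_mul_sq hc) (fun n => ae_of_all _ fun t => ?_)
      (ae_of_all _ fun t => ?_)
    · refine AEStronglyMeasurable.indicator (Continuous.aestronglyMeasurable ?_) measurableSet_Ioc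
      fun_prop
    · by_cases ht : t ∈ Set.Ioc (-R * √n) (R * √n)
      · simp only [hJ, Set.indicator_of_mem ht]
        have hn : 0 < √(n : ℝ) := by
          by_contra hcon
          have h1 : √(n : ℝ) = 0 := le_antisymm (not_lt.1 hcon) (Real.sqrt_nonneg _)
          rw [h1] at ht
          simp at ht
        have h2 : ‖φ (t / √n)‖ ≤ Real.exp (-(c * (t / √n) ^ 2)) := by
          refine hgauss _ (abs_le.2 ⟨?_, ?_⟩)
          · rw [le_div_iff₀ hn]; exact ht.1.le
          · rw [div_le_iff₀ hn]; exact ht.2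
        have e1 : ∀ u : ℝ, ‖Complex.exp (-(Complex.I * u))‖ = 1 := fun u => by
          rw [show -(Complex.I * u) = ((-u : ℝ) : ℂ) * Complex.I by push_cast; ring,
            Complex.norm_exp_ofReal_mul_I]
        have e2 : ∀ u : ℝ, ‖Complex.exp (Complex.I * u)‖ = 1 := fun u => by
          rw [mul_comm, Complex.norm_exp_ofReal_mul_I]
        rw [norm_mul, norm_pow, norm_mul, e1, e2, mul_one, mul_one]
        refine (pow_le_pow_left₀ (norm_nonneg _) h2 n).trans (le_of_eq ?_)
        rw [← Real.exp_nat_mul, div_pow, Real.sq_sqrt (by positivity)]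
        have hn' : (n : ℝ) ≠ 0 := (Real.sqrt_pos.1 hn).ne'
        congr 1
        field_simp
      · simp only [hJ, Set.indicator_of_notMem ht, norm_zero]
        exact (Real.exp_pos _).le
    · have hsq : Filter.Tendsto (fun n : ℕ => √(n : ℝ)) Filter.atTop Filter.atTop :=
        Real.tendsto_sqrt_atTop.comp tendsto_natCast_atTop_atTop
      have hev : ∀ᶠ n : ℕ in Filter.atTop, |t| / R + 1 ≤ √(n : ℝ) := hsq.eventually_ge_atTop _
      have h1 := tendsto_eval_pow ξ hξ_sq hξ_mean hξ_var t
      have h2 : Filter.Tendsto (fun n : ℕ => Complex.exp (Complex.I * (t / √n : ℝ))) Filter.atTop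
          (nhds 1) := by
        have h3 : Filter.Tendsto (fun n : ℕ => t / √(n : ℝ)) Filter.atTop (nhds 0) :=
          hsq.const_div_atTop t
        have h4 : Continuous fun u : ℝ => Complex.exp (Complex.I * u) := by fun_prop
        have h5 := (h4.tendsto 0).comp h3
        simpa [Function.comp_def] using h5
      have h6 := h1.mul h2
      rw [mul_one] at h6
      refine h6.congr' ?_
      filter_upwards [hev] with n hn
      have h7 : |t| < R * √n := by
        have h9 : |t| / R < √n := by linarith
        rwa [div_lt_iff₀' hR0] at h9
      have h8 : t ∈ Set.Ioc (-R * √n) (R * √n) :=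
        ⟨by rw [neg_mul]; exact (abs_lt.1 h7).1, (abs_lt.1 h7).2.le⟩
      simp only [hJ, Set.indicator_of_mem h8, hφ]
      rfl
  set L := ∫ t : ℝ, Complex.exp (-(s / 2 * t ^ 2 : ℝ)) with hL
  -- The limit is a Gaussian integral, hence nonzero, and half of it is a lower bound for large `n`.
  have hLpos : 0 < ‖L‖ := by
    have h1 : L = ((∫ t : ℝ, Real.exp (-(s / 2) * t ^ 2) : ℝ) : ℂ) := by
      rw [hL, ← integral_complex_ofReal]
      refine integral_congr_ae (ae_of_all _ fun t => ?_)
      push_cast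
      rw [neg_mul]
    rw [h1, integral_gaussian, Complex.norm_real, Real.norm_of_nonneg (Real.sqrt_nonneg _)]
    exact Real.sqrt_pos.2 (div_pos hpi (half_pos hξ_var))
  have hev : ∀ᶠ n in Filter.atTop, ‖L‖ / 2 < ‖∫ t, J n t‖ :=
    hlim.norm.eventually (lt_mem_nhds (half_lt_self hLpos))
  obtain ⟨n₀, hn₀⟩ := Filter.eventually_atTop.1 hev
  refine ⟨d / (2 * Real.pi) * (‖L‖ / 2), by positivity, n₀, fun n hn hdn => ?_⟩
  have h1 := (hn₀ (n + 1) (by omega)).le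
  have hN : (0 : ℝ) < √((n + 1 : ℕ) : ℝ) := Real.sqrt_pos.2 (by positivity)
  have hcoef := (h.absSummable.pow (n + 1)).coeff_eq_integral hd (hsupp.pow (n + 1)) hdn
  have hJint : ∫ t, J (n + 1) t = √((n + 1 : ℕ) : ℝ) • ∫ θ in (-(Real.pi / d))..(Real.pi / d),
      evalAt (Complex.exp (Complex.I * θ)) (ofReal a ^ (n + 1)) *
        Complex.exp (-(Complex.I * n * θ)) := by
    have e1 : ∀ θ : ℝ, evalAt (Complex.exp (Complex.I * θ)) (ofReal a ^ (n + 1)) *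
        Complex.exp (-(Complex.I * n * θ)) = (φ θ * Complex.exp (-(Complex.I * θ))) ^ (n + 1) *
        Complex.exp (Complex.I * θ) := fun θ => by
      rw [h.absSummable.eval_pow _ (AbsSummable.norm_exp_I_mul_le θ), mul_pow,
        ← Complex.exp_nat_mul, mul_assoc (φ θ ^ (n + 1)), ← Complex.exp_add]
      congr 2
      push_cast
      ring
    simp_rw [e1]
    have e2 := intervalIntegral.integral_comp_div (a := -R * √((n + 1 : ℕ) : ℝ))
      (b := R * √((n + 1 : ℕ) : ℝ))
      (fun θ : ℝ => (φ θ * Complex.exp (-(Complex.I * θ))) ^ (n + 1) *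
        Complex.exp (Complex.I * θ)) hN.ne'
    rw [mul_div_cancel_right₀ _ hN.ne', mul_div_cancel_right₀ _ hN.ne'] at e2
    rw [← hR, ← e2, integral_indicator measurableSet_Ioc, intervalIntegral.integral_of_le]
    nlinarith
  rw [hJint, norm_smul, Real.norm_of_nonneg hN.le] at h1
  have hcn : ‖(d / (2 * Real.pi) : ℂ)‖ = d / (2 * Real.pi) := by
    rw [show (d / (2 * Real.pi) : ℂ) = ((d / (2 * Real.pi) : ℝ) : ℂ) by push_cast; rfl,
      Complex.norm_real, Real.norm_of_nonneg (by positivity)]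
  rw [hcoef, norm_mul, hcn, mul_div_assoc]
  refine mul_le_mul_of_nonneg_left ?_ (by positivity)
  push_cast at hN h1
  rw [div_le_iff₀ hN]
  linarith

/-! ### The characteristic function of the edge variables -/

theorem abs_sin_sub_le (x : ℝ) : |Real.sin x - x| ≤ 2 * x ^ 2 := by
  have key : ∀ y : ℝ, 0 ≤ y → |Real.sin y - y| ≤ 2 * y ^ 2 := fun y hy => by
    rcases hy.eq_or_lt with rfl | hy0
    · simp
    rw [abs_le]
    have h1 := Real.sin_le hy
    rcases le_total y 1 with h | h
    · have h2 := Real.sin_gt_sub_cube hy0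
      constructor
      · nlinarith [mul_nonneg (sq_nonneg y) (sub_nonneg.2 h)]
      · nlinarith
    · have h2 := Real.neg_one_le_sin y
      constructor <;> nlinarith
  rcases le_total 0 x with h | h
  · exact key x h
  · have := key (-x) (by linarith)
    rw [Real.sin_neg, neg_sub_neg, abs_sub_comm, neg_sq] at this
    exact this

/-- The characteristic function of a law on `ℤ`. -/
noncomputable def intCharFun (η : Measure ℤ) (t : ℝ) : ℂ := ∫ k : ℤ, Complex.exp (t * k * Complex.I) ∂η

section IntCharFun

variable (η : Measure ℤ) [IsProbabilityMeasure η]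

theorem norm_exp_ofReal_mul_intCast (t : ℝ) (k : ℤ) : ‖Complex.exp (t * k * Complex.I)‖ = 1 := by
  rw [show (t * k : ℂ) = ((t * k : ℝ) : ℂ) by push_cast; rfl, Complex.norm_exp_ofReal_mul_I]

theorem integrable_exp_intCast (t : ℝ) :
    Integrable (fun k : ℤ => Complex.exp (t * k * Complex.I)) η :=
  Integrable.of_bound (by fun_prop) 1 (ae_of_all _ fun k => (norm_exp_ofReal_mul_intCast t k).le)

theorem norm_intCharFun_le_one (t : ℝ) : ‖intCharFun η t‖ ≤ 1 := by
  refine (norm_integral_le_integral_norm _).trans ?_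
  simp [norm_exp_ofReal_mul_intCast]

theorem continuous_intCharFun : Continuous (intCharFun η) := by
  refine continuous_of_dominated (bound := fun _ => 1) (fun t => by fun_prop) (fun t =>
    ae_of_all _ fun k => (norm_exp_ofReal_mul_intCast t k).le) (integrable_const _)
    (ae_of_all _ fun k => by fun_prop)

theorem re_intCharFun (t : ℝ) : (intCharFun η t).re = ∫ k : ℤ, Real.cos (t * k) ∂η := by
  have h := integral_re (𝕜 := ℂ) (integrable_exp_intCast η t)
  refine h.symm.trans (integral_congr_ae (ae_of_all _ fun k => ?_))
  have : (t * k : ℂ) = ((t * k : ℝ) : ℂ) := by push_cast; rfl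
  simp only [this]
  exact Complex.exp_ofReal_mul_I_re _

theorem im_intCharFun (t : ℝ) : (intCharFun η t).im = ∫ k : ℤ, Real.sin (t * k) ∂η := by
  have h := integral_im (𝕜 := ℂ) (integrable_exp_intCast η t)
  refine h.symm.trans (integral_congr_ae (ae_of_all _ fun k => ?_))
  have : (t * k : ℂ) = ((t * k : ℝ) : ℂ) := by push_cast; rfl
  simp only [this]
  exact Complex.exp_ofReal_mul_I_im _

theorem integrable_one_sub_cos (t : ℝ) : Integrable (fun k : ℤ => 1 - Real.cos (t * k)) η :=
  Integrable.of_bound (by fun_prop) 2 (ae_of_all _ fun k => by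
    have h1 := Real.neg_one_le_cos (t * k)
    have h2 := Real.cos_le_one (t * k)
    rw [Real.norm_eq_abs, abs_le]
    constructor <;> linarith)

theorem one_sub_re_intCharFun (t : ℝ) :
    1 - (intCharFun η t).re = ∫ k : ℤ, (1 - Real.cos (t * k)) ∂η := by
  rw [re_intCharFun, integral_sub (integrable_const _) (Integrable.of_bound (by fun_prop) 1
    (ae_of_all _ fun k => by simpa using Real.abs_cos_le_one _))]
  simp

variable {η}

/-- If the real part equals `1`, then `t k ∈ 2π ℤ` for almost every `k`, so `η` is concentrated on a
subgroup `e ℤ`. Span one forces `e = ±1`, so `t ∈ 2π ℤ`, which is impossible for `0 < |t| ≤ π`. -/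
theorem one_sub_re_intCharFun_pos (hspan : GaltonWatson.HasSpan η 1) {t : ℝ} (ht : |t| ≤ Real.pi)
    (ht0 : t ≠ 0) : 0 < 1 - (intCharFun η t).re := by
  have hnn : ∀ k : ℤ, 0 ≤ 1 - Real.cos (t * k) := fun k => by linarith [Real.cos_le_one (t * k)]
  rw [one_sub_re_intCharFun]
  refine lt_of_le_of_ne (integral_nonneg hnn) fun h0 => ?_
  have h1 := (integral_eq_zero_iff_of_nonneg hnn (integrable_one_sub_cos η t)).1 h0.symm
  obtain ⟨e, he⟩ := Int.subgroup_cyclic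
    ((AddSubgroup.zmultiples (2 * Real.pi)).comap (zmultiplesHom ℝ t))
  rw [← AddSubgroup.zmultiples_eq_closure] at he
  have h2 : ∀ᵐ k ∂η, e ∣ k := by
    filter_upwards [h1] with k hk
    rw [← Int.mem_zmultiples_iff, ← he]
    simp only [Pi.zero_apply, sub_eq_zero] at hk
    obtain ⟨n, hn⟩ := (Real.cos_eq_one_iff _).1 hk.symm
    simp only [AddSubgroup.mem_comap, zmultiplesHom_apply, AddSubgroup.mem_zmultiples_iff]
    exact ⟨n, by simpa [mul_comm] using hn⟩
  have h3 : |e| ≤ 1 := hspan.2 (h2.mono fun k hk => (abs_dvd _ _).2 hk)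
  -- For `e = 0` the law would be the point mass at `0`, which is also concentrated on `2 ℤ`.
  have h4 : e ≠ 0 := by
    rintro rfl
    have : (2 : ℤ) ≤ 1 := hspan.2 (h2.mono fun k hk => by rw [zero_dvd_iff.1 hk]; exact dvd_zero _)
    omega
  have h5 : (1 : ℤ) ∈ (AddSubgroup.zmultiples (2 * Real.pi)).comap (zmultiplesHom ℝ t) := by
    rw [he, Int.mem_zmultiples_iff]
    exact Int.isUnit_iff_abs_eq.2 (le_antisymm h3 (Int.one_le_abs h4)) |>.dvd
  obtain ⟨n, hn⟩ := AddSubgroup.mem_zmultiples_iff.1 h5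
  simp only [zsmul_eq_mul, zmultiplesHom_apply, Int.cast_one, one_mul] at hn
  have hpi := Real.pi_pos
  rw [← hn, abs_mul, abs_of_pos (by positivity : 0 < 2 * Real.pi)] at ht
  have h6 : |(n : ℝ)| < 1 := by nlinarith
  have h7 : n = 0 := by
    have : |n| < 1 := by exact_mod_cast h6
    exact Int.abs_lt_one_iff.1 this
  rw [h7, Int.cast_zero, zero_mul] at hn
  exact ht0 hn.symm

theorem exists_mul_sq_le_one_sub_re (hspan : GaltonWatson.HasSpan η 1) :
    ∃ c > 0, ∀ t : ℝ, |t| ≤ Real.pi → c * t ^ 2 ≤ 1 - (intCharFun η t).re := by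
  obtain ⟨k, hk, hηk⟩ : ∃ k : ℤ, k ≠ 0 ∧ 0 < η.real {k} := by
    by_contra! hc
    have h1 : ∀ᵐ x ∂η, x = 0 := by
      rw [ae_iff_of_countable]
      intro x hx
      by_contra h0
      have := le_antisymm (hc x h0) measureReal_nonneg
      exact hx ((measureReal_eq_zero_iff).1 this)
    have : (2 : ℤ) ≤ 1 := hspan.2 (h1.mono fun k hk => by rw [hk]; exact dvd_zero _)
    omega
  have hpi := Real.pi_pos
  have hk0 : (0 : ℝ) < |(k : ℝ)| := by simpa using hk
  refine exists_mul_sq_le_of_continuous (F := fun t => 1 - (intCharFun η t).re) (R := Real.pi)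
    (δ := Real.pi / |(k : ℝ)|) (c := η.real {k} * (2 / Real.pi ^ 2 * (k : ℝ) ^ 2))
    (continuous_const.sub (Complex.continuous_re.comp (continuous_intCharFun η))) hpi
    (by positivity) (by positivity) (fun t ht => ?_)
    (fun t ht ht0 => one_sub_re_intCharFun_pos hspan ht ht0)
  rw [one_sub_re_intCharFun]
  have h1 := hasSum_integral_discrete (integrable_one_sub_cos η t)
  have h2 := h1.summable.le_tsum k fun j _ => smul_nonneg measureReal_nonneg
    (by linarith [Real.cos_le_one (t * j)])
  rw [h1.tsum_eq, smul_eq_mul] at h2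
  refine le_trans ?_ h2
  have h3 : |t * k| ≤ Real.pi := by
    rw [abs_mul]
    rwa [le_div_iff₀ hk0] at ht
  have h4 := Real.cos_le_one_sub_mul_cos_sq h3
  rw [mul_assoc]
  refine mul_le_mul_of_nonneg_left ?_ hηk.le
  calc _ = 2 / Real.pi ^ 2 * (t * k) ^ 2 := by ring
    _ ≤ _ := by linarith

/-- Centring removes the linear term of the sine. The remainder is bounded quadratically, because
only the second moment is available. -/
theorem abs_im_intCharFun_le (hsq : MemLp (fun k : ℤ => (k : ℝ)) 2 η)
    (hmean : ∫ k : ℤ, (k : ℝ) ∂η = 0) (t : ℝ) :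
    |(intCharFun η t).im| ≤ 2 * t ^ 2 * ∫ k : ℤ, (k : ℝ) ^ 2 ∂η := by
  have hint : Integrable (fun k : ℤ => t * (k : ℝ)) η := (hsq.integrable one_le_two).const_mul t
  have h1 : (intCharFun η t).im = ∫ k : ℤ, (Real.sin (t * k) - t * k) ∂η := by
    rw [im_intCharFun, integral_sub (Integrable.of_bound (by fun_prop) 1
      (ae_of_all _ fun k => by simpa using Real.abs_sin_le_one _)) hint, integral_const_mul, hmean,
      mul_zero, sub_zero]
  rw [h1, ← integral_const_mul, ← Real.norm_eq_abs]
  refine norm_integral_le_of_norm_le (hsq.integrable_sq.const_mul _) (ae_of_all _ fun k => ?_)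
  rw [Real.norm_eq_abs]
  refine (abs_sin_sub_le _).trans (le_of_eq ?_)
  ring

/-- The values of the characteristic function lie in a cone with apex `1`, at distance at least
of order `t ^ 2` from the apex. -/
theorem exists_intCharFun_bounds (hspan : GaltonWatson.HasSpan η 1)
    (hsq : MemLp (fun k : ℤ => (k : ℝ)) 2 η) (hmean : ∫ k : ℤ, (k : ℝ) ∂η = 0) :
    ∃ K ≥ 0, ∃ c > 0, ∀ t : ℝ, |t| ≤ Real.pi →
      |(intCharFun η t).im| ≤ K * (1 - (intCharFun η t).re) ∧ c * t ^ 2 ≤ ‖1 - intCharFun η t‖ := by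
  obtain ⟨c, hc, hct⟩ := exists_mul_sq_le_one_sub_re hspan
  have hS : 0 ≤ ∫ k : ℤ, (k : ℝ) ^ 2 ∂η := integral_nonneg fun k => sq_nonneg _
  refine ⟨2 / c * ∫ k : ℤ, (k : ℝ) ^ 2 ∂η, by positivity, c, hc, fun t ht => ⟨?_, ?_⟩⟩
  · refine (abs_im_intCharFun_le hsq hmean t).trans ?_
    calc _ = 2 / c * (∫ k : ℤ, (k : ℝ) ^ 2 ∂η) * (c * t ^ 2) := by field_simp
      _ ≤ _ := mul_le_mul_of_nonneg_left (hct t ht) (by positivity)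
  · refine (hct t ht).trans ((le_abs_self _).trans ?_)
    simpa using Complex.abs_re_le_norm (1 - intCharFun η t)

end IntCharFun

/-! ### Family trees, their subtrees and measurability -/

namespace GaltonWatson

/-- Addresses record the latest generation first, so the child of the root from which an individual
descends is the last entry, and its descendants are the addresses `v ++ [i]`. -/
theorem isIndividual_append_singleton (N : List ℕ → ℕ) (v : List ℕ) (i : ℕ) :
    IsIndividual N (v ++ [i]) ↔ i < N [] ∧ IsIndividual (fun u => N (u ++ [i])) v := by
  induction v with
  | nil => simp [IsIndividual]
  | cons j v ih =>
    simp only [List.cons_append, IsIndividual, ih]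
    tauto

theorem familyTree_eq (N : List ℕ → ℕ) :
    familyTree N = insert [] (⋃ i ∈ (Finset.range (N []) : Set ℕ),
      (fun v => v ++ [i]) '' familyTree (fun u => N (u ++ [i]))) := by
  ext v
  rcases List.eq_nil_or_concat v with rfl | ⟨u, j, rfl⟩
  · simp [familyTree, IsIndividual]
  · simp only [List.concat_eq_append, familyTree, Set.mem_ofPred_eq, isIndividual_append_singleton,
      Set.mem_insert_iff, List.append_eq_nil_iff, List.cons_ne_self, and_false, false_or,
      Set.mem_iUnion, Set.mem_image, Finset.coe_range, Set.mem_Iio, exists_prop]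
    constructor
    · rintro ⟨h1, h2⟩
      exact ⟨j, h1, u, h2, rfl⟩
    · rintro ⟨i, hi, w, hw, hwu⟩
      obtain ⟨rfl, h⟩ := List.append_inj' hwu rfl
      obtain rfl : i = j := by simpa using h
      exact ⟨hi, hw⟩

theorem append_singleton_injective (i : ℕ) : Function.Injective fun v : List ℕ => v ++ [i] :=
  fun _ _ h => List.append_cancel_right h

theorem pairwiseDisjoint_image_append (s : Set ℕ) (t : ℕ → Set (List ℕ)) :
    s.PairwiseDisjoint fun i => (fun v => v ++ [i]) '' t i := by
  intro i _ j _ hij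
  refine Set.disjoint_left.2 ?_
  rintro _ ⟨v, _, rfl⟩ ⟨w, _, hw⟩
  obtain ⟨_, h⟩ := List.append_inj' hw rfl
  exact hij (by simpa using h.symm)

theorem finite_familyTree_iff (N : List ℕ → ℕ) :
    (familyTree N).Finite ↔ ∀ i < N [], (familyTree fun u => N (u ++ [i])).Finite := by
  rw [familyTree_eq, Set.finite_insert]
  constructor
  · intro h i hi
    refine Set.Finite.of_finite_image (h.subset ?_) (append_singleton_injective i).injOn
    exact Set.subset_biUnion_of_mem (u := fun i => (fun v => v ++ [i]) ''
      familyTree (fun u => N (u ++ [i]))) (by simpa using hi)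
  · intro h
    exact Set.Finite.biUnion (Finset.finite_toSet _) fun i hi => (h i (by simpa using hi)).image _

/-- Summation over the vertices of a finite family tree, by the subtrees of the root. -/
theorem finsum_familyTree {M : Type*} [AddCommMonoid M] (N : List ℕ → ℕ)
    (hN : (familyTree N).Finite) (φ : List ℕ → M) :
    ∑ᶠ v ∈ familyTree N, φ v = φ [] + ∑ i : Fin (N []),
      ∑ᶠ v ∈ familyTree (fun u => N (u ++ [(i : ℕ)])), φ (v ++ [(i : ℕ)]) := by
  have hfin := (finite_familyTree_iff N).1 hN
  rw [familyTree_eq, finsum_mem_insert, finsum_mem_biUnion]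
  · rw [Finset.sum_fin_eq_sum_range, finsum_mem_coe_finset]
    congr 1
    refine Finset.sum_congr rfl fun i hi => ?_
    rw [dif_pos (Finset.mem_range.1 hi),
      finsum_mem_image (append_singleton_injective i).injOn]
  · exact pairwiseDisjoint_image_append _ _
  · exact Finset.finite_toSet _
  · exact fun i hi => (hfin i (by simpa using hi)).image _
  · simp
  · exact Set.Finite.biUnion (Finset.finite_toSet _)
      fun i hi => (hfin i (by simpa using hi)).image _

theorem label_append_singleton (y : List ℕ → ℤ) (v : List ℕ) (i : ℕ) :
    label y (v ++ [i]) = y [i] + label (fun u => y (u ++ [i])) v := by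
  induction v with
  | nil => simp [label]
  | cons j v ih =>
    simp only [List.cons_append, label, ih]
    ring

/-- The family tree of a marked genealogy. -/
def markedTree (c : List ℕ → ℕ × ℤ) : Set (List ℕ) := familyTree fun v => (c v).1

/-- The genealogy of the descendants of the `i`-th child of the root. -/
def subtree (i : ℕ) (c : List ℕ → ℕ × ℤ) : List ℕ → ℕ × ℤ := fun v => c (v ++ [i])

/-- The marked genealogies whose family tree has exactly `n` vertices. -/
def sizeSet (n : ℕ) : Set (List ℕ → ℕ × ℤ) := {c | (markedTree c).encard = n}

/-- The exponential sum over the vertex labels, started from the mark of the root. -/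
noncomputable def expSum (t : ℝ) (c : List ℕ → ℕ × ℤ) : ℂ :=
  ∑ᶠ v ∈ markedTree c, Complex.exp (t * ((c []).2 + label (fun u => (c u).2) v : ℤ) * Complex.I)

theorem mem_sizeSet_iff {n : ℕ} {c : List ℕ → ℕ × ℤ} :
    c ∈ sizeSet n ↔ (markedTree c).Finite ∧ (markedTree c).ncard = n := by
  rw [sizeSet, Set.mem_ofPred_eq]
  constructor
  · intro h
    have hf : (markedTree c).Finite := Set.finite_of_encard_eq_coe h
    refine ⟨hf, ?_⟩
    rw [← hf.cast_ncard_eq] at h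
    exact_mod_cast h
  · rintro ⟨hf, h⟩
    rw [← hf.cast_ncard_eq, h]

theorem ncard_markedTree {c : List ℕ → ℕ × ℤ} (hc : (markedTree c).Finite) :
    (markedTree c).ncard = 1 + ∑ i : Fin (c []).1, (markedTree (subtree i c)).ncard := by
  have h := finsum_familyTree (fun v => (c v).1) hc fun _ => (1 : ℕ)
  simp only [finsum_one] at h
  exact h

theorem finite_markedTree_iff (c : List ℕ → ℕ × ℤ) :
    (markedTree c).Finite ↔ ∀ i : Fin (c []).1, (markedTree (subtree i c)).Finite := by
  rw [markedTree, finite_familyTree_iff]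
  exact ⟨fun h i => h i i.2, fun h i hi => h ⟨i, hi⟩⟩

theorem nil_mem_markedTree (c : List ℕ → ℕ × ℤ) : [] ∈ markedTree c := trivial

/-- Counting the mark of the root makes the functional self-similar: the edge variable above a child
of the root is the root mark of the child's subtree. -/
theorem expSum_eq (t : ℝ) {c : List ℕ → ℕ × ℤ} (hc : (markedTree c).Finite) :
    expSum t c = Complex.exp (t * (c []).2 * Complex.I) *
      (1 + ∑ i : Fin (c []).1, expSum t (subtree i c)) := by
  rw [expSum, markedTree, finsum_familyTree _ hc, mul_add, mul_one, Finset.mul_sum]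
  congr 1
  · simp [label]
  · refine Finset.sum_congr rfl fun i _ => ?_
    have hf : (markedTree (subtree i c)).Finite := (finite_markedTree_iff c).1 hc i
    rw [expSum, ← smul_eq_mul, smul_finsum_mem hf]
    refine finsum_mem_congr rfl fun v _ => ?_
    rw [label_append_singleton, smul_eq_mul, ← Complex.exp_add]
    congr 1
    simp only [subtree, List.nil_append]
    push_cast
    ring

theorem norm_expSum_le (t : ℝ) {c : List ℕ → ℕ × ℤ} (hc : (markedTree c).Finite) :
    ‖expSum t c‖ ≤ (markedTree c).ncard := by
  rw [expSum, finsum_mem_eq_finite_toFinset_sum _ hc, Set.ncard_eq_toFinset_card _ hc]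
  refine (norm_sum_le _ _).trans ?_
  simp only [norm_exp_ofReal_mul_intCast]
  simp

theorem measurableSet_mem_markedTree (v : List ℕ) : MeasurableSet {c | v ∈ markedTree c} := by
  induction v with
  | nil => exact MeasurableSet.univ
  | cons i u ih =>
    have h : {c : List ℕ → ℕ × ℤ | i :: u ∈ markedTree c} =
        {c | u ∈ markedTree c} ∩ {c | i < (c u).1} := by
      ext c
      rfl
    rw [h]
    exact ih.inter (measurableSet_lt measurable_const (by fun_prop))

/-- There are countably many finite sets of addresses, and being equal to a given one is a countable
intersection of membership conditions. -/
theorem measurableSet_sizeSet (n : ℕ) : MeasurableSet (sizeSet n) := by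
  have h : sizeSet n = ⋃ s ∈ {s : Finset (List ℕ) | s.card = n},
      ⋂ v, {c | v ∈ markedTree c ↔ v ∈ s} := by
    ext c
    simp only [Set.mem_iUnion, Set.mem_iInter, Set.mem_ofPred_eq, exists_prop]
    rw [mem_sizeSet_iff]
    constructor
    · rintro ⟨hf, hn⟩
      refine ⟨hf.toFinset, ?_, fun v => by simp⟩
      rw [← hn, Set.ncard_eq_toFinset_card _ hf]
    · rintro ⟨s, hs, hv⟩
      have : markedTree c = s := Set.ext hv
      rw [this]
      exact ⟨s.finite_toSet, by simpa using hs⟩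
  rw [h]
  refine MeasurableSet.biUnion (Set.to_countable _) fun s _ => MeasurableSet.iInter fun v => ?_
  by_cases hv : v ∈ s
  · convert measurableSet_mem_markedTree v using 1
    ext c
    simp [hv]
  · convert (measurableSet_mem_markedTree v).compl using 1
    ext c
    simp [hv]

theorem measurable_label (v : List ℕ) :
    Measurable fun c : List ℕ → ℕ × ℤ => label (fun u => (c u).2) v := by
  induction v with
  | nil => exact measurable_const
  | cons i u ih => exact ih.add (by fun_prop)

/-- On trees of size `n` the sum is the limit of its restrictions to finite sets of addresses. The
indicator avoids infinite trees, where `finsum` need not be the intended sum. -/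
theorem measurable_indicator_expSum (t : ℝ) (n : ℕ) :
    Measurable ((sizeSet n).indicator (expSum t)) := by
  classical
  let g : List ℕ → (List ℕ → ℕ × ℤ) → ℂ := fun v => (sizeSet n ∩ {c | v ∈ markedTree c}).indicator
    fun c => Complex.exp (t * ((c []).2 + label (fun u => (c u).2) v : ℤ) * Complex.I)
  have hg : ∀ v, Measurable (g v) := fun v => by
    refine Measurable.indicator ?_ ((measurableSet_sizeSet n).inter (measurableSet_mem_markedTree v))
    have h1 : Measurable fun c : List ℕ → ℕ × ℤ => ((c []).2 + label (fun u => (c u).2) v : ℤ) :=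
      Measurable.add (by fun_prop) (measurable_label v)
    have h2 : Measurable fun k : ℤ => Complex.exp (t * k * Complex.I) := measurable_from_top
    exact h2.comp h1
  refine measurable_of_tendsto_metrizable' (Filter.atTop : Filter (Finset (List ℕ)))
    (f := fun s c => ∑ v ∈ s, g v c) (fun s => Finset.measurable_fun_sum s fun v _ => hg v) ?_
  rw [tendsto_pi_nhds]
  intro c
  by_cases hc : c ∈ sizeSet n
  · have hf := (mem_sizeSet_iff.1 hc).1
    have h1 : (sizeSet n).indicator (expSum t) c = ∑ v ∈ hf.toFinset, g v c := by
      rw [Set.indicator_of_mem hc, expSum, finsum_mem_eq_finite_toFinset_sum _ hf]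
      refine Finset.sum_congr rfl fun v hv => ?_
      have hm : c ∈ sizeSet n ∩ {c | v ∈ markedTree c} := ⟨hc, by simpa using hv⟩
      rw [show g v c = _ from Set.indicator_of_mem hm _]
    rw [h1]
    refine tendsto_const_nhds.congr' ?_
    filter_upwards [Filter.eventually_ge_atTop hf.toFinset] with s hs
    refine Finset.sum_subset hs fun v _ hv => ?_
    have hm : c ∉ sizeSet n ∩ {c | v ∈ markedTree c} := fun h => hv (by simpa using h.2)
    exact Set.indicator_of_notMem hm _
  · have h0 : ∀ v, g v c = 0 := fun v => by
      have hm : c ∉ sizeSet n ∩ {c | v ∈ markedTree c} := fun h => hc h.1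
      exact Set.indicator_of_notMem hm _
    rw [Set.indicator_of_notMem hc]
    simp [h0]

end GaltonWatson

/-! ### The branching property and generating series by size -/

namespace GaltonWatson

open PowerSeries

/-- The family of independent marks. -/
noncomputable def genealogyLaw (μ : Measure (ℕ × ℤ)) : Measure (List ℕ → ℕ × ℤ) :=
  Measure.infinitePi fun _ => μ

instance (μ : Measure (ℕ × ℤ)) [IsProbabilityMeasure μ] :
    IsProbabilityMeasure (genealogyLaw μ) := by
  unfold genealogyLaw
  infer_instance

/-- An injection which sends the `i`-th copy of the set of addresses onto the descendants of the
`i`-th child, for `i < k`, and fixes the root in the additional copy. -/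
def branchAddress (k : ℕ) : Option (Fin k) × List ℕ → List ℕ
  | (none, []) => []
  | (none, j :: u) => (j :: u) ++ [k]
  | (some i, u) => u ++ [(i : ℕ)]

theorem branchAddress_injective (k : ℕ) : Function.Injective (branchAddress k) := by
  have key : ∀ {u v : List ℕ} {a b : ℕ}, u ++ [a] = v ++ [b] → u = v ∧ a = b := by
    intro u v a b h
    obtain ⟨h1, h2⟩ := List.append_inj' h rfl
    exact ⟨h1, by simpa using h2⟩
  rintro ⟨_ | i, u⟩ ⟨_ | j, v⟩ h
  · rcases u with _ | ⟨a, u⟩ <;> rcases v with _ | ⟨b, v⟩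
    · rfl
    · simp [branchAddress] at h
    · simp [branchAddress] at h
    · rw [(key h).1]
  · rcases u with _ | ⟨a, u⟩
    · simp [branchAddress] at h
    · exact absurd (key h).2 j.2.ne'
  · rcases v with _ | ⟨a, v⟩
    · simp [branchAddress] at h
    · exact absurd (key h).2 i.2.ne
  · obtain ⟨rfl, h2⟩ := key h
    rw [Fin.ext h2]

/-- The branching property: the mark of the root and the genealogies of the descendants of its
first `k` children are independent. -/
theorem integral_branching (μ : Measure (ℕ × ℤ)) [IsProbabilityMeasure μ] {k : ℕ}
    (g₀ : ℕ × ℤ → ℂ) (g : Fin k → (List ℕ → ℕ × ℤ) → ℂ) (hg : ∀ i, Measurable (g i)) :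
    ∫ c, g₀ (c []) * ∏ i : Fin k, g i (subtree i c) ∂genealogyLaw μ =
      (∫ x, g₀ x ∂μ) * ∏ i : Fin k, ∫ c, g i c ∂genealogyLaw μ := by
  have hg₀ : Measurable g₀ := Measurable.of_discrete
  let G : Option (Fin k) → (List ℕ → ℕ × ℤ) → ℂ := fun o =>
    o.elim (fun u => g₀ (u [])) g
  have hG : ∀ o, Measurable (G o) := fun o => by
    rcases o with _ | i
    · exact hg₀.comp (measurable_pi_apply [])
    · exact hg i
  -- Relabelling independent marks along an injection keeps them independent, and currying groups
  -- them into independent genealogies: one for each child, and an additional one of which only the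
  -- root mark is used.
  have h1 := Measure.map_infinitePi_infinitePi_of_inj (P := fun _ : List ℕ => μ)
    (branchAddress_injective k)
  have h2 := Measure.infinitePi_map_curry (fun (_ : Option (Fin k)) (_ : List ℕ) => μ)
  have hm1 : Measurable fun (c : List ℕ → ℕ × ℤ) (p : Option (Fin k) × List ℕ) =>
      c (branchAddress k p) := by fun_prop
  have h3 : (genealogyLaw μ).map (fun c (o : Option (Fin k)) (v : List ℕ) =>
      c (branchAddress k (o, v))) = Measure.pi fun _ => genealogyLaw μ := by
    rw [← Measure.infinitePi_eq_pi]
    unfold genealogyLaw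
    rw [← h2, ← h1, Measure.map_map (by fun_prop) hm1]
    rfl
  have hm2 : Measurable fun (c : List ℕ → ℕ × ℤ) (o : Option (Fin k)) (v : List ℕ) =>
      c (branchAddress k (o, v)) := by fun_prop
  have hGm : Measurable fun u : Option (Fin k) → List ℕ → ℕ × ℤ => ∏ o, G o (u o) :=
    Finset.measurable_fun_prod _ fun o _ => (hG o).comp (measurable_pi_apply o)
  have h4 := integral_fintype_prod_eq_prod (𝕜 := ℂ) (μ := fun _ : Option (Fin k) => genealogyLaw μ) G
  rw [← h3, integral_map hm2.aemeasurable hGm.aestronglyMeasurable] at h4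
  simp only [Fintype.prod_option] at h4
  have h5 : ∫ c, G none c ∂genealogyLaw μ = ∫ x, g₀ x ∂μ := by
    have h := integral_map (μ := genealogyLaw μ) (f := g₀)
      (measurable_pi_apply (X := fun _ : List ℕ => ℕ × ℤ) []).aemeasurable
      hg₀.aestronglyMeasurable
    rw [genealogyLaw, Measure.infinitePi_map_eval (fun _ : List ℕ => μ) []] at h
    exact h.symm
  rw [h5] at h4
  exact h4

/-- The generating series of `g` by the size of the family tree. -/
noncomputable def sizeSeries (μ : Measure (ℕ × ℤ)) (g : (List ℕ → ℕ × ℤ) → ℂ) : ℂ⟦X⟧ :=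
  PowerSeries.mk fun n => ∫ c, (sizeSet n).indicator g c ∂genealogyLaw μ

/-- `g`, restricted to the family trees of any given size, is measurable and bounded. -/
def SizeRegular (g : (List ℕ → ℕ × ℤ) → ℂ) : Prop :=
  ∀ n, Measurable ((sizeSet n).indicator g) ∧ ∃ B : ℝ, ∀ c, ‖(sizeSet n).indicator g c‖ ≤ B

/-- The size series of `g` at a single genealogy. -/
noncomputable def pointSeries (g : (List ℕ → ℕ × ℤ) → ℂ) (c : List ℕ → ℕ × ℤ) : ℂ⟦X⟧ :=
  PowerSeries.mk fun n => (sizeSet n).indicator g c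

open Classical in
theorem pointSeries_eq (g : (List ℕ → ℕ × ℤ) → ℂ) (c : List ℕ → ℕ × ℤ) :
    pointSeries g c = if (markedTree c).Finite then
      monomial (markedTree c).ncard (g c) else 0 := by
  ext n
  rw [pointSeries, coeff_mk]
  split_ifs with hf
  · rw [coeff_monomial]
    by_cases h : n = (markedTree c).ncard
    · rw [if_pos h, Set.indicator_of_mem (mem_sizeSet_iff.2 ⟨hf, h.symm⟩)]
    · rw [if_neg h, Set.indicator_of_notMem fun hc => h (mem_sizeSet_iff.1 hc).2.symm]
  · rw [Set.indicator_of_notMem fun hc => hf (mem_sizeSet_iff.1 hc).1, map_zero]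

theorem prod_monomial {k : ℕ} (n : Fin k → ℕ) (x : Fin k → ℂ) :
    ∏ i, monomial (n i) (x i) = monomial (∑ i, n i) (∏ i, x i) := by
  induction k with
  | zero => simp [monomial_zero_eq_C]
  | succ k ih =>
    rw [Fin.prod_univ_succ, Fin.sum_univ_succ, Fin.prod_univ_succ, ih, monomial_mul_monomial]

/-- Size decomposition at the root for a product over the subtrees. -/
theorem indicator_sizeSet_prod {c : List ℕ → ℕ × ℤ} {k : ℕ} (hk : (c []).1 = k) (m : ℕ)
    (g : Fin k → (List ℕ → ℕ × ℤ) → ℂ) :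
    (sizeSet (m + 1)).indicator (fun c => ∏ i : Fin k, g i (subtree i c)) c =
      coeff m (∏ i : Fin k, pointSeries (g i) (subtree i c)) := by
  classical
  subst hk
  by_cases hf : (markedTree c).Finite
  · have hsub := (finite_markedTree_iff c).1 hf
    -- All point series are monomials, and their degrees add up to the number of vertices other than
    -- the root.
    have h1 : ∏ i : Fin (c []).1, pointSeries (g i) (subtree i c) =
        monomial (∑ i : Fin (c []).1, (markedTree (subtree i c)).ncard)
          (∏ i : Fin (c []).1, g i (subtree i c)) := by
      rw [← prod_monomial]
      refine Finset.prod_congr rfl fun i _ => ?_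
      rw [pointSeries_eq, if_pos (hsub i)]
    rw [h1, coeff_monomial]
    have h2 := ncard_markedTree hf
    by_cases h : m = ∑ i : Fin (c []).1, (markedTree (subtree i c)).ncard
    · rw [if_pos h, Set.indicator_of_mem (mem_sizeSet_iff.2 ⟨hf, by omega⟩)]
    · rw [if_neg h, Set.indicator_of_notMem fun hc => h (by
        have := (mem_sizeSet_iff.1 hc).2
        omega)]
  · rw [Set.indicator_of_notMem fun hc => hf (mem_sizeSet_iff.1 hc).1]
    rw [finite_markedTree_iff] at hf
    push Not at hf
    obtain ⟨i, hi⟩ := hf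
    rw [Finset.prod_eq_zero (Finset.mem_univ i), map_zero]
    rw [pointSeries_eq, if_neg hi]

/-- Integration of the products over the subtrees, on the event that the root has `k` children. -/
theorem integral_rootTerm (μ : Measure (ℕ × ℤ)) [IsProbabilityMeasure μ] {k : ℕ} (m : ℕ)
    {g₀ : ℕ × ℤ → ℂ} (hg₀ : ∀ x, ‖g₀ x‖ ≤ 1) {g : Fin k → (List ℕ → ℕ × ℤ) → ℂ}
    (hg : ∀ i, SizeRegular (g i)) :
    Integrable (fun c => g₀ (c []) * coeff m (∏ i : Fin k, pointSeries (g i) (subtree i c)))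
      (genealogyLaw μ) ∧
    ∫ c, g₀ (c []) * coeff m (∏ i : Fin k, pointSeries (g i) (subtree i c)) ∂genealogyLaw μ =
      (∫ x, g₀ x ∂μ) * coeff m (∏ i : Fin k, sizeSeries μ (g i)) := by
  have hexp : ∀ c : List ℕ → ℕ × ℤ, g₀ (c []) *
      coeff m (∏ i : Fin k, pointSeries (g i) (subtree i c)) =
      ∑ l ∈ Finset.finsuppAntidiag (Finset.univ : Finset (Fin k)) m,
        g₀ (c []) * ∏ i : Fin k, (sizeSet (l i)).indicator (g i) (subtree i c) := fun c => by
    rw [coeff_prod, Finset.mul_sum]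
    simp [pointSeries]
  have hmeas : Measurable g₀ := Measurable.of_discrete
  have hint : ∀ l : Fin k →₀ ℕ, Integrable (fun c : List ℕ → ℕ × ℤ =>
      g₀ (c []) * ∏ i : Fin k, (sizeSet (l i)).indicator (g i) (subtree i c))
      (genealogyLaw μ) := fun l => by
    choose B hB using fun i => (hg i (l i)).2
    refine Integrable.of_bound (C := 1 * ∏ i, B i) (Measurable.aestronglyMeasurable ?_)
      (ae_of_all _ fun c => ?_)
    · refine (hmeas.comp (measurable_pi_apply [])).mul
        (Finset.measurable_fun_prod _ fun i _ => (hg i (l i)).1.comp ?_)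
      unfold subtree
      fun_prop
    · rw [norm_mul, norm_prod]
      exact mul_le_mul (hg₀ _) (Finset.prod_le_prod (fun _ _ => norm_nonneg _) fun i _ => hB i _)
        (Finset.prod_nonneg fun _ _ => norm_nonneg _) zero_le_one
  simp_rw [hexp]
  refine ⟨integrable_finsetSum _ fun l _ => hint l, ?_⟩
  rw [integral_finsetSum _ fun l _ => hint l, coeff_prod, Finset.mul_sum]
  refine Finset.sum_congr rfl fun l _ => ?_
  rw [integral_branching μ g₀ _ fun i => (hg i (l i)).1]
  simp [sizeSeries]

end GaltonWatson

/-! ### The recursion at the root -/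

namespace PowerSeries

/-- The coefficients of `f.subst G * W` by powers of `G`. -/
theorem coeff_subst_mul {f G : ℂ⟦X⟧} (hG0 : constantCoeff G = 0) (W : ℂ⟦X⟧) {m M : ℕ}
    (hM : m < M) :
    coeff m (f.subst G * W) = ∑ k ∈ Finset.range M, coeff k f * coeff m (G ^ k * W) := by
  have hs : HasSubst G := HasSubst.of_constantCoeff_zero hG0
  have hzero : ∀ i ≤ m, coeff i (f.subst G) = ∑ k ∈ Finset.range M, coeff k f * coeff i (G ^ k) := by
    intro i hi
    rw [coeff_subst' hs, finsum_eq_sum_of_support_subset]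
    · rfl
    · intro k hk
      rw [Finset.coe_range, Set.mem_Iio]
      by_contra! hle
      refine hk ?_
      have h1 : X ^ k ∣ G ^ k := pow_dvd_pow_of_dvd (X_dvd_iff.2 hG0) k
      simp only [X_pow_dvd_iff.1 h1 i (by omega), smul_zero]
  rw [coeff_mul]
  simp_rw [coeff_mul, Finset.mul_sum]
  rw [Finset.sum_comm]
  refine Finset.sum_congr rfl fun p hp => ?_
  rw [hzero p.1 (by have := Finset.HasAntidiagonal.mem_antidiagonal.1 hp; omega), Finset.sum_mul]
  exact Finset.sum_congr rfl fun k _ => by ring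

/-- Rewrites the terms in `f`, `f'`, `f''` as one sum over the offspring number `k` of the root, the
form in which the tree recursion arrives. The shift by `2` in the range makes room for the second
derivative. -/
theorem coeff_subst_add_derivatives {a : ℕ → ℝ} {G : ℂ⟦X⟧} (hG0 : constantCoeff G = 0)
    (W₁ W₂ : ℂ⟦X⟧) {m M : ℕ} (hM : m < M) :
    coeff m ((ofReal a).subst G + (d⁄dX ℂ (ofReal a)).subst G * W₁ +
      (d⁄dX ℂ (d⁄dX ℂ (ofReal a))).subst G * W₂) =
    ∑ k ∈ Finset.range (M + 2), (a k : ℂ) *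
      coeff m (G ^ k + (k : ℂ⟦X⟧) * (G ^ (k - 1) * W₁) +
        (k : ℂ⟦X⟧) * ((k : ℂ⟦X⟧) - 1) * (G ^ (k - 2) * W₂)) := by
  have hc : ∀ (k : ℕ) (A : ℂ⟦X⟧), coeff m ((k : ℂ⟦X⟧) * A) = k * coeff m A := fun k A => by
    rw [← nsmul_eq_mul, map_nsmul, nsmul_eq_mul]
  rw [map_add, map_add, ← mul_one ((ofReal a).subst G),
    coeff_subst_mul hG0 1 (M := M + 2) (by omega), coeff_subst_mul hG0 W₁ (M := M + 1) (by omega),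
    coeff_subst_mul hG0 W₂ hM]
  simp_rw [map_add, mul_add, Finset.sum_add_distrib]
  congr 1
  · congr 1
    · simp [ofReal]
    · rw [Finset.sum_range_succ' _ (M + 1)]
      simp only [hc, Nat.cast_zero, zero_mul, map_zero, mul_zero, add_zero, coeff_derivative_ofReal,
        Nat.add_sub_cancel]
      refine Finset.sum_congr rfl fun k _ => ?_
      push_cast
      ring
  · rw [Finset.sum_range_succ' _ (M + 1), Finset.sum_range_succ' _ M]
    simp only [Nat.cast_zero, zero_mul, mul_zero, map_zero, add_zero, zero_add, Nat.cast_one,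
      sub_self, coeff_derivative_derivative_ofReal]
    refine Finset.sum_congr rfl fun k _ => ?_
    have h1 : ((k + 1 + 1 : ℕ) : ℂ⟦X⟧) * (((k + 1 + 1 : ℕ) : ℂ⟦X⟧) - 1) *
        (G ^ (k + 1 + 1 - 2) * W₂) = ((k + 1 + 1 : ℕ) : ℂ⟦X⟧) * (((k + 1 : ℕ) : ℂ⟦X⟧) *
          (G ^ k * W₂)) := by
      rw [show k + 1 + 1 - 2 = k by omega]
      push_cast
      ring
    rw [h1, hc, hc]
    push_cast
    ring

end PowerSeries

theorem Fin.prod_eq_mul_pow {R : Type*} [CommMonoid R] {k : ℕ} (w : Fin k → R) (x : R)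
    (j : Fin k) (h : ∀ i, i ≠ j → w i = x) : ∏ i, w i = w j * x ^ (k - 1) := by
  rw [← Finset.mul_prod_erase _ _ (Finset.mem_univ j),
    Finset.prod_congr rfl fun i hi => h i (Finset.ne_of_mem_erase hi)]
  simp

theorem Fin.prod_eq_mul_mul_pow {R : Type*} [CommMonoid R] {k : ℕ} (w : Fin k → R) (x : R)
    {j l : Fin k} (hjl : j ≠ l) (h : ∀ i, i ≠ j → i ≠ l → w i = x) :
    ∏ i, w i = w j * w l * x ^ (k - 2) := by
  have hl : l ∈ Finset.univ.erase j := Finset.mem_erase.2 ⟨hjl.symm, Finset.mem_univ l⟩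
  rw [← Finset.mul_prod_erase _ _ (Finset.mem_univ j), ← Finset.mul_prod_erase _ _ hl,
    Finset.prod_congr rfl fun i hi => h i
      (Finset.ne_of_mem_erase (Finset.mem_of_mem_erase hi)) (Finset.ne_of_mem_erase hi)]
  simp [Finset.card_erase_of_mem hl, mul_assoc, Nat.sub_sub]

namespace GaltonWatson

open PowerSeries

theorem sizeRegular_one : SizeRegular 1 := fun n =>
  ⟨measurable_one.indicator (measurableSet_sizeSet n), 1, fun c => by
    by_cases hc : c ∈ sizeSet n <;> simp [hc]⟩

theorem sizeRegular_zero : SizeRegular 0 := fun n =>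
  ⟨measurable_zero.indicator (measurableSet_sizeSet n), 0, fun c => by simp⟩

theorem SizeRegular.mul {F F' : (List ℕ → ℕ × ℤ) → ℂ} (hF : SizeRegular F)
    (hF' : SizeRegular F') : SizeRegular (F * F') := fun n => by
  have h : (sizeSet n).indicator (F * F') =
      (sizeSet n).indicator F * (sizeSet n).indicator F' := by
    ext c
    by_cases hc : c ∈ sizeSet n <;> simp [hc]
  obtain ⟨B, hB⟩ := (hF n).2
  obtain ⟨B', hB'⟩ := (hF' n).2
  refine ⟨h ▸ (hF n).1.mul (hF' n).1, B * B', fun c => ?_⟩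
  rw [h, Pi.mul_apply, norm_mul]
  exact mul_le_mul (hB c) (hB' c) (norm_nonneg _) ((norm_nonneg _).trans (hB c))

theorem sizeRegular_expSum (t : ℝ) : SizeRegular (expSum t) := fun n =>
  ⟨measurable_indicator_expSum t n, n, fun c => by
    by_cases hc : c ∈ sizeSet n
    · rw [Set.indicator_of_mem hc]
      obtain ⟨hf, hn⟩ := mem_sizeSet_iff.1 hc
      simpa [hn] using norm_expSum_le t hf
    · simp [hc]⟩

/-- `F` if `o` selects `i`, and `1` otherwise. -/
noncomputable def pick {k : ℕ} (F : (List ℕ → ℕ × ℤ) → ℂ) (o : Option (Fin k)) (i : Fin k) :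
    (List ℕ → ℕ × ℤ) → ℂ := if o = some i then F else 1

/-- Turns an additive expression into a sum of products over the children, to which the branching
property applies. -/
theorem sum_prod_pick {k : ℕ} (F : (List ℕ → ℕ × ℤ) → ℂ) (x : Fin k → List ℕ → ℕ × ℤ) :
    ∑ o : Option (Fin k), ∏ i, pick F o i (x i) = 1 + ∑ i, F (x i) := by
  rw [Fintype.sum_option]
  congr 1
  · simp [pick]
  · refine Finset.sum_congr rfl fun j _ => ?_
    rw [Finset.prod_eq_single j]
    · simp [pick]
    · intro i _ hi
      simp [pick, hi.symm]
    · simp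

theorem sizeRegular_pick_mul {k : ℕ} {F F' : (List ℕ → ℕ × ℤ) → ℂ} (hF : SizeRegular F)
    (hF' : SizeRegular F') (p : Option (Fin k) × Option (Fin k)) (i : Fin k) :
    SizeRegular (pick F p.1 i * pick F' p.2 i) := by
  refine SizeRegular.mul ?_ ?_ <;> unfold pick <;> split_ifs <;>
    first | assumption | exact sizeRegular_one

/-- A pair of choices selects no child, one child for `F` or `F'` alone, the same child for both, or
two distinct children in `k (k - 1)` ways. The last two cases give `F * F'` and the `f''` term. -/
theorem sum_prod_sizeSeries_pick (μ : Measure (ℕ × ℤ)) (F F' : (List ℕ → ℕ × ℤ) → ℂ) (k : ℕ) :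
    ∑ p : Option (Fin k) × Option (Fin k), ∏ i, sizeSeries μ (pick F p.1 i * pick F' p.2 i) =
      sizeSeries μ 1 ^ k + k * (sizeSeries μ 1 ^ (k - 1) *
        (sizeSeries μ F + sizeSeries μ F' + sizeSeries μ (F * F'))) +
      k * (k - 1 : ℂ⟦X⟧) * (sizeSeries μ 1 ^ (k - 2) * (sizeSeries μ F * sizeSeries μ F')) := by
  set G := sizeSeries μ 1 with hG
  have h00 : ∏ i : Fin k, sizeSeries μ (pick F none i * pick F' none i) = G ^ k := by
    simp [pick, hG]
  have h10 : ∀ j : Fin k, ∏ i : Fin k, sizeSeries μ (pick F (some j) i * pick F' none i) =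
      sizeSeries μ F * G ^ (k - 1) := fun j => by
    rw [Fin.prod_eq_mul_pow _ G j fun i hi => by simp [pick, hi.symm, hG]]
    simp [pick]
  have h01 : ∀ j : Fin k, ∏ i : Fin k, sizeSeries μ (pick F none i * pick F' (some j) i) =
      sizeSeries μ F' * G ^ (k - 1) := fun j => by
    rw [Fin.prod_eq_mul_pow _ G j fun i hi => by simp [pick, hi.symm, hG]]
    simp [pick]
  have h11 : ∀ j : Fin k, ∏ i : Fin k, sizeSeries μ (pick F (some j) i * pick F' (some j) i) =
      sizeSeries μ (F * F') * G ^ (k - 1) := fun j => by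
    rw [Fin.prod_eq_mul_pow _ G j fun i hi => by simp [pick, hi.symm, hG]]
    simp [pick]
  have h12 : ∀ j l : Fin k, j ≠ l →
      ∏ i : Fin k, sizeSeries μ (pick F (some j) i * pick F' (some l) i) =
      sizeSeries μ F * sizeSeries μ F' * G ^ (k - 2) := fun j l hjl => by
    rw [Fin.prod_eq_mul_mul_pow _ G hjl fun i hi hi' => by simp [pick, hi.symm, hi'.symm, hG]]
    simp [pick, hjl, hjl.symm]
  have hrow : ∀ j : Fin k,
      ∑ l : Fin k, ∏ i : Fin k, sizeSeries μ (pick F (some j) i * pick F' (some l) i) =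
      sizeSeries μ (F * F') * G ^ (k - 1) +
        (k - 1 : ℂ⟦X⟧) * (sizeSeries μ F * sizeSeries μ F' * G ^ (k - 2)) := fun j => by
    rw [← Finset.add_sum_erase _ _ (Finset.mem_univ j), h11,
      Finset.sum_congr rfl fun l hl => h12 j l (Finset.ne_of_mem_erase hl).symm]
    have hk : 1 ≤ k := by have := j.2; omega
    simp [Nat.cast_sub hk]
  rw [Fintype.sum_prod_type, Fintype.sum_option]
  simp only [Fintype.sum_option, h00, h10, h01, hrow]
  simp only [Finset.sum_const, Finset.card_univ, Fintype.card_fin, nsmul_eq_mul]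
  ring

theorem constantCoeff_sizeSeries (μ : Measure (ℕ × ℤ)) (g : (List ℕ → ℕ × ℤ) → ℂ) :
    constantCoeff (sizeSeries μ g) = 0 := by
  have h : ∀ c, (sizeSet 0).indicator g c = 0 := fun c =>
    Set.indicator_of_notMem (fun hc => by
      obtain ⟨hf, hn⟩ := mem_sizeSet_iff.1 hc
      rw [ncard_markedTree hf] at hn
      omega) g
  rw [← coeff_zero_eq_constantCoeff_apply, sizeSeries, coeff_mk]
  simp [h]

theorem root_degree_le {c : List ℕ → ℕ × ℤ} {n : ℕ} (hc : c ∈ sizeSet n) : (c []).1 < n := by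
  obtain ⟨hf, hn⟩ := mem_sizeSet_iff.1 hc
  have hsub := (finite_markedTree_iff c).1 hf
  have h : ∑ i : Fin (c []).1, 1 ≤ ∑ i : Fin (c []).1, (markedTree (subtree i c)).ncard :=
    Finset.sum_le_sum fun i _ => (Set.ncard_pos (hsub i)).2 ⟨[], nil_mem_markedTree _⟩
  rw [ncard_markedTree hf] at hn
  simp only [Finset.sum_const, Finset.card_univ, Fintype.card_fin, smul_eq_mul, mul_one] at h
  omega

/-- The root of a tree with `m + 1` vertices has at most `m < M` children, so the decomposition by
its degree is a finite sum and raises no question of convergence. -/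
theorem indicator_sizeSet_eq_sum {g₀ : ℕ × ℤ → ℂ} {F F' H : (List ℕ → ℕ × ℤ) → ℂ}
    (hH : ∀ c, (markedTree c).Finite → H c = g₀ (c []) *
      ((1 + ∑ i : Fin (c []).1, F (subtree i c)) * (1 + ∑ i : Fin (c []).1, F' (subtree i c))))
    {m M : ℕ} (hM : m < M) (c : List ℕ → ℕ × ℤ) :
    (sizeSet (m + 1)).indicator H c =
      ∑ k ∈ Finset.range M, ∑ p : Option (Fin k) × Option (Fin k),
        {x : ℕ × ℤ | x.1 = k}.indicator g₀ (c []) *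
          coeff m (∏ i : Fin k, pointSeries (pick F p.1 i * pick F' p.2 i) (subtree i c)) := by
  rw [Finset.sum_eq_single (c []).1]
  · simp_rw [← indicator_sizeSet_prod rfl]
    by_cases hc : c ∈ sizeSet (m + 1)
    · simp only [Set.indicator_of_mem hc]
      rw [Set.indicator_of_mem (show c [] ∈ {x : ℕ × ℤ | x.1 = (c []).1} from rfl),
        hH c (mem_sizeSet_iff.1 hc).1, ← Finset.mul_sum, Fintype.sum_prod_type]
      simp only [Pi.mul_apply, Finset.prod_mul_distrib]
      rw [← Finset.sum_mul_sum, sum_prod_pick, sum_prod_pick]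
    · simp [Set.indicator_of_notMem hc]
  · intro k _ hk
    have : c [] ∉ {x : ℕ × ℤ | x.1 = k} := fun h => hk h.symm
    simp [Set.indicator_of_notMem this]
  · intro hk
    have hc : c ∉ sizeSet (m + 1) := fun hc => by
      have := root_degree_le hc
      rw [Finset.mem_range] at hk
      omega
    simp_rw [← indicator_sizeSet_prod rfl]
    simp [Set.indicator_of_notMem hc]

/-- The recursion at the root for the size series of a product of two additive functionals. -/
theorem sizeSeries_eq (μ : Measure (ℕ × ℤ)) [IsProbabilityMeasure μ] {a : ℕ → ℝ} {z : ℂ}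
    {g₀ : ℕ × ℤ → ℂ} (hg₀ : ∀ x, ‖g₀ x‖ ≤ 1)
    (hz : ∀ k, ∫ x, {x : ℕ × ℤ | x.1 = k}.indicator g₀ x ∂μ = a k * z)
    {F F' H : (List ℕ → ℕ × ℤ) → ℂ} (hF : SizeRegular F) (hF' : SizeRegular F')
    (hH : ∀ c, (markedTree c).Finite → H c = g₀ (c []) *
      ((1 + ∑ i : Fin (c []).1, F (subtree i c)) * (1 + ∑ i : Fin (c []).1, F' (subtree i c)))) :
    sizeSeries μ H = C z * (X * ((ofReal a).subst (sizeSeries μ 1) +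
      (d⁄dX ℂ (ofReal a)).subst (sizeSeries μ 1) *
        (sizeSeries μ F + sizeSeries μ F' + sizeSeries μ (F * F')) +
      (d⁄dX ℂ (d⁄dX ℂ (ofReal a))).subst (sizeSeries μ 1) *
        (sizeSeries μ F * sizeSeries μ F'))) := by
  have hind : ∀ k x, ‖{x : ℕ × ℤ | x.1 = k}.indicator g₀ x‖ ≤ 1 := fun k x =>
    (norm_indicator_le_norm_self _ _).trans (hg₀ x)
  ext n
  rcases n with _ | m
  · simp [constantCoeff_sizeSeries]
  rw [coeff_C_mul, coeff_succ_X_mul,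
    coeff_subst_add_derivatives (constantCoeff_sizeSeries μ 1) _ _ (Nat.lt_succ_self m),
    Finset.mul_sum, sizeSeries, coeff_mk]
  have hterm := fun k (p : Option (Fin k) × Option (Fin k)) =>
    integral_rootTerm μ m (hind k) fun i => sizeRegular_pick_mul hF hF' p i
  simp_rw [indicator_sizeSet_eq_sum hH (show m < m + 1 + 2 by omega)]
  rw [integral_finsetSum _ fun k _ => integrable_finsetSum _ fun p _ => (hterm k p).1]
  refine Finset.sum_congr rfl fun k _ => ?_
  rw [integral_finsetSum _ fun p _ => (hterm k p).1, ← sum_prod_sizeSeries_pick, map_sum,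
    Finset.mul_sum, Finset.mul_sum]
  refine Finset.sum_congr rfl fun p _ => ?_
  rw [(hterm k p).2, hz]
  ring

end GaltonWatson

/-! ### Moments of the exponential sum over trees of given size -/

namespace GaltonWatson

open PowerSeries

theorem norm_exp_intCast_mul_I (t : ℝ) (k : ℤ) : ‖Complex.exp (t * k * Complex.I)‖ = 1 := by
  simpa using norm_exp_ofReal_mul_intCast t k

theorem star_expSum (t : ℝ) {c : List ℕ → ℕ × ℤ} (hc : (markedTree c).Finite) :
    (starRingEnd ℂ) (expSum t c) = expSum (-t) c := by
  rw [expSum, expSum, finsum_mem_eq_finite_toFinset_sum _ hc,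
    finsum_mem_eq_finite_toFinset_sum _ hc, map_sum]
  refine Finset.sum_congr rfl fun v _ => ?_
  rw [← Complex.exp_conj]
  simp

theorem sq_norm_expSum (t : ℝ) {c : List ℕ → ℕ × ℤ} (hc : (markedTree c).Finite) :
    ((‖expSum t c‖ ^ 2 : ℝ) : ℂ) = expSum t c * expSum (-t) c := by
  rw [← star_expSum t hc, Complex.mul_conj, Complex.normSq_eq_norm_sq]

theorem expSum_zero {c : List ℕ → ℕ × ℤ} (hc : (markedTree c).Finite) :
    expSum 0 c = (markedTree c).ncard := by
  rw [expSum, finsum_mem_eq_finite_toFinset_sum _ hc, Set.ncard_eq_toFinset_card _ hc]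
  simp

theorem coeff_sizeSeries_expSum_mul (μ : Measure (ℕ × ℤ)) (t : ℝ) (n : ℕ) :
    coeff n (sizeSeries μ (expSum t * expSum (-t))) =
      ((∫ c in sizeSet n, ‖expSum t c‖ ^ 2 ∂genealogyLaw μ : ℝ) : ℂ) := by
  rw [sizeSeries, coeff_mk, integral_indicator (measurableSet_sizeSet n), ← integral_complex_ofReal]
  refine setIntegral_congr_fun (measurableSet_sizeSet n) fun c hc => ?_
  simp only [Pi.mul_apply]
  rw [sq_norm_expSum t (mem_sizeSet_iff.1 hc).1]

theorem integral_indicator_mark (ξ : Measure ℕ) (η : Measure ℤ) [SFinite ξ] [SFinite η]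
    (t : ℝ) (k : ℕ) :
    ∫ x, {x : ℕ × ℤ | x.1 = k}.indicator (fun x => Complex.exp (t * x.2 * Complex.I)) x
      ∂(ξ.prod η) = ξ.real {k} * intCharFun η t := by
  have h : ∀ x : ℕ × ℤ, {x : ℕ × ℤ | x.1 = k}.indicator
      (fun x => Complex.exp (t * x.2 * Complex.I)) x =
      ({k} : Set ℕ).indicator (fun _ => (1 : ℂ)) x.1 * Complex.exp (t * x.2 * Complex.I) := by
    rintro ⟨a, b⟩
    by_cases hab : a = k <;> simp [hab]
  simp_rw [h]
  rw [integral_prod_mul (fun a : ℕ => ({k} : Set ℕ).indicator (fun _ => (1 : ℂ)) a)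
    (fun b : ℤ => Complex.exp (t * b * Complex.I)), integral_indicator (by simp)]
  simp [intCharFun, measureReal_def]

theorem intCharFun_zero (η : Measure ℤ) [IsProbabilityMeasure η] : intCharFun η 0 = 1 := by simp [intCharFun]

theorem integral_indicator_one (ξ : Measure ℕ) [SFinite ξ] (η : Measure ℤ)
    [IsProbabilityMeasure η] (k : ℕ) :
    ∫ x, {x : ℕ × ℤ | x.1 = k}.indicator 1 x ∂(ξ.prod η) = (ξ.real {k} : ℂ) * 1 := by
  have h := integral_indicator_mark ξ η 0 k
  rw [intCharFun_zero] at h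
  rw [← h]
  congr 1
  ext x
  congr 1
  ext y
  simp

theorem sizeSeries_zero (μ : Measure (ℕ × ℤ)) : sizeSeries μ 0 = 0 := by
  ext n
  simp [sizeSeries]

variable (ξ : Measure ℕ) [IsProbabilityMeasure ξ] (η : Measure ℤ) [IsProbabilityMeasure η]

theorem sizeSeries_one_eq : sizeSeries (ξ.prod η) 1 =
    X * (ofReal fun k => ξ.real {k}).subst (sizeSeries (ξ.prod η) 1) := by
  have h := sizeSeries_eq (ξ.prod η) (g₀ := 1) (z := 1) (by simp) (integral_indicator_one ξ η)
    sizeRegular_zero sizeRegular_zero (H := 1) (by simp)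
  simpa [sizeSeries_zero] using h

theorem sizeSeries_expSum_eq (t : ℝ) : sizeSeries (ξ.prod η) (expSum t) =
    C (intCharFun η t) * (X * ((ofReal fun k => ξ.real {k}).subst (sizeSeries (ξ.prod η) 1) +
      (d⁄dX ℂ (ofReal fun k => ξ.real {k})).subst (sizeSeries (ξ.prod η) 1) *
        sizeSeries (ξ.prod η) (expSum t))) := by
  have h := sizeSeries_eq (ξ.prod η) (fun x => (norm_exp_intCast_mul_I t x.2).le)
    (integral_indicator_mark ξ η t) (sizeRegular_expSum t) sizeRegular_zero (H := expSum t)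
    (fun c hc => by rw [expSum_eq t hc]; simp)
  simpa [sizeSeries_zero] using h

/-- The root phases at `t` and `-t` cancel, so no characteristic function appears in front. -/
theorem sizeSeries_expSum_mul_eq (t : ℝ) :
    sizeSeries (ξ.prod η) (expSum t * expSum (-t)) =
    X * ((ofReal fun k => ξ.real {k}).subst (sizeSeries (ξ.prod η) 1) +
      (d⁄dX ℂ (ofReal fun k => ξ.real {k})).subst (sizeSeries (ξ.prod η) 1) *
        (sizeSeries (ξ.prod η) (expSum t) + sizeSeries (ξ.prod η) (expSum (-t)) +
          sizeSeries (ξ.prod η) (expSum t * expSum (-t))) +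
      (d⁄dX ℂ (d⁄dX ℂ (ofReal fun k => ξ.real {k}))).subst (sizeSeries (ξ.prod η) 1) *
        (sizeSeries (ξ.prod η) (expSum t) * sizeSeries (ξ.prod η) (expSum (-t)))) := by
  have h := sizeSeries_eq (ξ.prod η) (g₀ := 1) (z := 1) (by simp) (integral_indicator_one ξ η)
    (sizeRegular_expSum t) (sizeRegular_expSum (-t)) (H := expSum t * expSum (-t))
    (fun c hc => by
      rw [Pi.mul_apply, expSum_eq t hc, expSum_eq (-t) hc, mul_mul_mul_comm, ← Complex.exp_add]
      simp)
  simpa using h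

/-- The total progeny formula. -/
theorem coeff_pow_eq_size_mul (n : ℕ) :
    coeff n ((ofReal fun k => ξ.real {k}) ^ (n + 1)) =
      ((n + 1) * (genealogyLaw (ξ.prod η)).real (sizeSet (n + 1)) : ℝ) := by
  -- At `t = 0` the exponential sum is the number of vertices, so the one-point series counts size
  -- times probability.
  have h := sizeSeries_expSum_eq ξ η 0
  rw [intCharFun_zero, map_one, one_mul] at h
  rw [← coeff_onePoint (constantCoeff_sizeSeries _ _) (sizeSeries_one_eq ξ η) h, sizeSeries,
    coeff_mk]
  have h1 : (sizeSet (n + 1)).indicator (expSum 0) =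
      (sizeSet (n + 1)).indicator fun _ => ((n + 1 : ℕ) : ℂ) :=
    Set.indicator_congr fun c hc => by
      obtain ⟨hf, hn⟩ := mem_sizeSet_iff.1 hc
      rw [expSum_zero hf, hn]
  rw [h1, integral_indicator_const _ (measurableSet_sizeSet _)]
  simp only [Complex.real_smul]
  push_cast
  ring

theorem setIntegral_sq_norm_expSum_le (μ : Measure (ℕ × ℤ)) [IsProbabilityMeasure μ] (t : ℝ)
    (n : ℕ) : ∫ c in sizeSet n, ‖expSum t c‖ ^ 2 ∂genealogyLaw μ ≤
      n ^ 2 * (genealogyLaw μ).real (sizeSet n) := by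
  refine (Real.le_norm_self _).trans (norm_setIntegral_le_of_norm_le_const
    (measure_lt_top _ _) fun c hc => ?_)
  obtain ⟨hf, hn⟩ := mem_sizeSet_iff.1 hc
  have h := norm_expSum_le t hf
  rw [hn] at h
  rw [norm_pow, norm_norm]
  gcongr

/-- The second moment of the exponential sum on the trees of size `n`. -/
theorem exists_setIntegral_sq_norm_expSum_bound
    (hξ_sq : MemLp (fun k : ℕ => (k : ℝ)) 2 ξ) (hξ_mean : ∫ k : ℕ, (k : ℝ) ∂ξ = 1)
    (hξ_var : 0 < variance (fun k : ℕ => (k : ℝ)) ξ)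
    (hη_sq : MemLp (fun k : ℤ => (k : ℝ)) 2 η) (hη_mean : ∫ k : ℤ, (k : ℝ) ∂η = 0)
    (hη_span : HasSpan η 1) :
    ∃ C > 0, ∀ (n : ℕ) (t : ℝ), 1 ≤ n → |t| ≤ Real.pi →
      0 < (genealogyLaw (ξ.prod η)).real (sizeSet n) →
      ∫ c in sizeSet n, ‖expSum t c‖ ^ 2 ∂genealogyLaw (ξ.prod η) ≤
        C / (1 + n * t ^ 4) * (n ^ 2 * (genealogyLaw (ξ.prod η)).real (sizeSet n)) := by
  have hw := criticalWeights_of_measure ξ hξ_sq hξ_mean hξ_var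
  obtain ⟨d, hd, hsupp, hlt⟩ := hw.exists_span
  obtain ⟨K, hK, b, hb, hchar⟩ := exists_intCharFun_bounds hη_span hη_sq hη_mean
  obtain ⟨D, hD, htwo⟩ := hw.exists_twoPoint_bound hK hd hsupp hlt
  obtain ⟨c, hc, n₀, hlow⟩ := exists_coeff_pow_lower_bound ξ hξ_sq hξ_mean hξ_var hd hsupp hlt
  set A := D / (b ^ 2 * c) with hA
  have hA0 : 0 < A := by positivity
  -- Beyond this size both the local lower bound and the two-point bound apply; up to it the trivial
  -- bound and `t ^ 4 ≤ π ^ 4` suffice. The summand `1` in the constant below pays for the `1` in `1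
  -- + n t⁴`.
  set N := n₀ + 8 with hN
  refine ⟨1 + A + N * Real.pi ^ 4, by positivity, fun n t hn ht hp => ?_⟩
  obtain ⟨m, rfl⟩ : ∃ m, n = m + 1 := ⟨n - 1, by omega⟩
  set p := (genealogyLaw (ξ.prod η)).real (sizeSet (m + 1)) with hp_def
  set V := ∫ c in sizeSet (m + 1), ‖expSum t c‖ ^ 2 ∂genealogyLaw (ξ.prod η) with hV
  have htriv : V ≤ (m + 1 : ℕ) ^ 2 * p := setIntegral_sq_norm_expSum_le _ t (m + 1)
  have hV0 : 0 ≤ V := integral_nonneg fun _ => by positivity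
  have hW0 : 0 ≤ ((m + 1 : ℕ) : ℝ) ^ 2 * p := by positivity
  have ht4 : t ^ 4 ≤ Real.pi ^ 4 := by
    rw [← Even.pow_abs (by decide : Even 4) t]
    gcongr
  have ht40 : 0 ≤ t ^ 4 := by positivity
  have hpos : 0 < 1 + ((m + 1 : ℕ) : ℝ) * t ^ 4 := by positivity
  rw [div_mul_eq_mul_div, le_div_iff₀ hpos]
  have hfinal : ∀ B : ℝ, B ≤ A + N * Real.pi ^ 4 → V * (((m + 1 : ℕ) : ℝ) * t ^ 4) ≤
      B * (((m + 1 : ℕ) : ℝ) ^ 2 * p) → V * (1 + ((m + 1 : ℕ) : ℝ) * t ^ 4) ≤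
      (1 + A + N * Real.pi ^ 4) * (((m + 1 : ℕ) : ℝ) ^ 2 * p) := fun B hB h => by
    have := mul_le_mul_of_nonneg_right hB hW0
    nlinarith
  by_cases hsmall : m + 1 ≤ N
  · refine hfinal (N * Real.pi ^ 4) (by linarith) ?_
    have h1 : ((m + 1 : ℕ) : ℝ) * t ^ 4 ≤ N * Real.pi ^ 4 := by
      have : ((m + 1 : ℕ) : ℝ) ≤ N := by exact_mod_cast hsmall
      gcongr
    rw [mul_comm V]
    exact mul_le_mul h1 htriv hV0 (by positivity)
  by_cases ht0 : t = 0
  · refine hfinal 0 (by positivity) ?_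
    simp [ht0]
  refine hfinal A (by linarith [show (0 : ℝ) ≤ N * Real.pi ^ 4 by positivity]) ?_
  have hprog := coeff_pow_eq_size_mul ξ η m
  -- A size of positive probability makes the coefficient of order `m` nonzero, hence `m` is a
  -- multiple of the span.
  have hdm : d ∣ m := by
    refine hsupp.pow (m + 1) m ?_
    rw [hprog]
    exact_mod_cast (by positivity : ((m : ℝ) + 1) * p ≠ 0)
  have hlow' := hlow m (by omega) hdm
  rw [hprog, Complex.norm_real, Real.norm_of_nonneg (by positivity)] at hlow'
  obtain ⟨him, hre⟩ := hchar t ht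
  obtain ⟨him', hre'⟩ := hchar (-t) (by rwa [abs_neg])
  have hbt : 0 < b * t ^ 2 := by positivity
  rw [neg_sq] at hre'
  have hne : intCharFun η t ≠ 1 := fun h => by
    rw [h, sub_self, norm_zero] at hre
    linarith
  have hne' : intCharFun η (-t) ≠ 1 := fun h => by
    rw [h, sub_self, norm_zero] at hre'
    linarith
  have hup := htwo m (by omega) hdm (intCharFun η t) (intCharFun η (-t))
    (norm_intCharFun_le_one η t) (norm_intCharFun_le_one η (-t)) hne hne' him him'
  rw [← coeff_twoPoint hw.constantCoeff_ne_zero (constantCoeff_sizeSeries _ _)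
    (sizeSeries_one_eq ξ η) (sizeSeries_expSum_eq ξ η t) (sizeSeries_expSum_eq ξ η (-t))
    (sizeSeries_expSum_mul_eq ξ η t), coeff_sizeSeries_expSum_mul, Complex.norm_real,
    Real.norm_of_nonneg hV0] at hup
  have h1 : V * (b * t ^ 2 * (b * t ^ 2)) ≤ D / √(m + 1 : ℝ) :=
    (mul_le_mul_of_nonneg_left (mul_le_mul hre hre' hbt.le (norm_nonneg _)) hV0).trans hup
  -- The factor `1 / √(m + 1)` is traded for `(m + 1) * p` by the lower bound, which supplies the
  -- missing power of the size.
  have h2 : D / √(m + 1 : ℝ) = D / c * (c / √(m + 1 : ℝ)) := by field_simp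
  have h3 : V * (b * t ^ 2 * (b * t ^ 2)) ≤ D / c * ((m + 1) * p) := by
    rw [h2] at h1
    exact h1.trans (by gcongr)
  have h4 : V * t ^ 4 ≤ A * ((m + 1) * p) := by
    rw [hA, ← mul_le_mul_iff_right₀ (show 0 < b ^ 2 by positivity)]
    calc b ^ 2 * (V * t ^ 4) = V * (b * t ^ 2 * (b * t ^ 2)) := by ring
      _ ≤ D / c * ((m + 1) * p) := h3
      _ = b ^ 2 * (D / (b ^ 2 * c) * ((m + 1) * p)) := by field_simp
  have h5 := mul_le_mul_of_nonneg_right h4 (show (0 : ℝ) ≤ (m + 1 : ℕ) by positivity)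
  push_cast at h5 ⊢
  linarith

/-! ### Transfer to an arbitrary probability space -/

/-- The law of a family of independent pairs with independent components. -/
theorem map_prod_genealogyLaw :
    ((Measure.infinitePi fun _ : List ℕ => ξ).prod (Measure.infinitePi fun _ : List ℕ => η)).map
      (fun q v => (q.1 v, q.2 v)) = genealogyLaw (ξ.prod η) := by
  have hm : Measurable fun (q : (List ℕ → ℕ) × (List ℕ → ℤ)) (v : List ℕ) => (q.1 v, q.2 v) := by
    fun_prop
  refine (Measure.isProjectiveLimit_infinitePi fun _ : List ℕ => ξ.prod η).unique ?_ |>.symm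
  intro I
  beta_reduce
  have h1 := measurePreserving_arrowProdEquivProdArrow ℕ ℤ I (fun _ => ξ) fun _ => η
  rw [← (h1.symm _).map_eq, ← Measure.infinitePi_map_restrict (fun _ : List ℕ => ξ),
    ← Measure.infinitePi_map_restrict (fun _ : List ℕ => η),
    Measure.map_prod_map _ _ (by fun_prop) (by fun_prop),
    Measure.map_map (by fun_prop) (by fun_prop),
    Measure.map_map (MeasurableEquiv.measurable _) (by fun_prop)]
  rfl

theorem map_marks {Ω : Type*} [MeasurableSpace Ω] (P : Measure Ω) [IsProbabilityMeasure P]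
    {N : List ℕ → Ω → ℕ} {Y : List ℕ → Ω → ℤ} (hN : ∀ v, Measurable (N v))
    (hNξ : ∀ v, P.map (N v) = ξ) (hNi : iIndepFun N P) (hY : ∀ v, Measurable (Y v))
    (hYη : ∀ v, P.map (Y v) = η) (hYi : iIndepFun Y P)
    (hNY : IndepFun (fun ω v => N v ω) (fun ω v => Y v ω) P) :
    P.map (fun ω v => (N v ω, Y v ω)) = genealogyLaw (ξ.prod η) := by
  have h1 := hNi.map_fun_eq_infinitePi_map hN
  have h2 := hYi.map_fun_eq_infinitePi_map hY
  simp only [hNξ] at h1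
  simp only [hYη] at h2
  have h3 := hNY.map_prod_eq_prod_map_map (measurable_pi_iff.2 hN).aemeasurable
    (measurable_pi_iff.2 hY).aemeasurable
  rw [← map_prod_genealogyLaw, ← h1, ← h2, ← h3, Measure.map_map (by fun_prop) (by fun_prop)]
  rfl

/-- The Fourier transform of the vertical profile is the exponential sum over the vertices. -/
theorem tsum_verticalProfile (c : List ℕ → ℕ) (y : List ℕ → ℤ) (hc : (familyTree c).Finite)
    (t : ℝ) : ∑' j : ℤ, (verticalProfile c y j : ℂ) * Complex.exp (Complex.I * j * t) =
      ∑ᶠ v ∈ familyTree c, Complex.exp (Complex.I * (label y v : ℤ) * t) := by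
  classical
  rw [finsum_mem_eq_finite_toFinset_sum _ hc]
  have h : ∀ j, verticalProfile c y j = {v ∈ hc.toFinset | label y v = j}.card := fun j => by
    rw [verticalProfile, ← Set.ncard_coe_finset]
    congr 1
    ext v
    simp
  rw [tsum_eq_sum (s := hc.toFinset.image (label y))]
  · rw [← Finset.sum_fiberwise_of_maps_to (t := hc.toFinset.image (label y)) (g := label y)
      fun v hv => Finset.mem_image_of_mem _ hv]
    refine Finset.sum_congr rfl fun j _ => ?_
    rw [Finset.sum_congr rfl fun v hv => by rw [(Finset.mem_filter.1 hv).2]]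
    simp [h]
  · intro j hj
    rw [h, Finset.filter_eq_empty_iff.2]
    · simp
    · intro v hv hvj
      exact hj (hvj ▸ Finset.mem_image_of_mem _ hv)

/-- The root mark, absent from the labels, contributes only a factor of modulus one. -/
theorem norm_tsum_verticalProfile (c : List ℕ → ℕ × ℤ) (hc : (markedTree c).Finite) (t : ℝ) :
    ‖∑' j : ℤ, (verticalProfile (fun v => (c v).1) (fun v => (c v).2) j : ℂ) *
      Complex.exp (Complex.I * j * t)‖ = ‖expSum t c‖ := by
  have h : expSum t c = Complex.exp (t * (c []).2 * Complex.I) *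
      ∑ᶠ v ∈ markedTree c, Complex.exp (Complex.I * (label (fun v => (c v).2) v : ℤ) * t) := by
    rw [expSum, ← smul_eq_mul, smul_finsum_mem hc]
    refine finsum_mem_congr rfl fun v _ => ?_
    rw [smul_eq_mul, ← Complex.exp_add]
    congr 1
    push_cast
    ring
  rw [tsum_verticalProfile _ _ hc, h, norm_mul, norm_exp_intCast_mul_I, one_mul]
  rfl

end GaltonWatson

theorem lemma1p8
    -- the offspring distribution, critical with finite non-zero variance
    (ξ : Measure ℕ) [IsProbabilityMeasure ξ]
    (hξ_sq : MemLp (fun k : ℕ => (k : ℝ)) 2 ξ)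
    (hξ_mean : ∫ k : ℕ, (k : ℝ) ∂ξ = 1)
    (hξ_var : 0 < variance (fun k : ℕ => (k : ℝ)) ξ)
    -- the distribution of the edge variables, centred with finite non-zero variance and span one
    (η : Measure ℤ) [IsProbabilityMeasure η]
    (hη_sq : MemLp (fun k : ℤ => (k : ℝ)) 2 η)
    (hη_mean : ∫ k : ℤ, (k : ℝ) ∂η = 0)
    (hη_var : 0 < variance (fun k : ℤ => (k : ℝ)) η)
    (hη_span : GaltonWatson.HasSpan η 1) :
    ∃ C : ℝ, 0 < C ∧
      -- `N v`: offspring number of `v`; `Y v`: variable on the edge from `v` to its parent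
      ∀ {Ω : Type*} [MeasurableSpace Ω] (P : Measure Ω) [IsProbabilityMeasure P]
        (N : List ℕ → Ω → ℕ) (Y : List ℕ → Ω → ℤ),
        (∀ v, Measurable (N v)) → (∀ v, P.map (N v) = ξ) → iIndepFun N P →
        (∀ v, Measurable (Y v)) → (∀ v, P.map (Y v) = η) → iIndepFun Y P →
        IndepFun (fun ω v => N v ω) (fun ω v => Y v ω) P →
        ∀ n : ℕ, 1 ≤ n → 0 < P (GaltonWatson.sizeEvent N n) →
          ∀ t : ℝ, t ∈ Set.Icc (-Real.pi) Real.pi →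
            Integrable (fun ω => ‖(1 / (n : ℂ)) * ∑' j : ℤ,
                (GaltonWatson.verticalProfile (fun v => N v ω) (fun v => Y v ω) j : ℂ)
                  * Complex.exp (Complex.I * (j : ℂ) * (t : ℂ))‖ ^ 2)
              (cond P (GaltonWatson.sizeEvent N n)) ∧
            ∫ ω, ‖(1 / (n : ℂ)) * ∑' j : ℤ,
                (GaltonWatson.verticalProfile (fun v => N v ω) (fun v => Y v ω) j : ℂ)
                  * Complex.exp (Complex.I * (j : ℂ) * (t : ℂ))‖ ^ 2
              ∂(cond P (GaltonWatson.sizeEvent N n))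
              ≤ C / (1 + (n : ℝ) * t ^ 4) := by
  obtain ⟨C, hC, hbound⟩ := GaltonWatson.exists_setIntegral_sq_norm_expSum_bound ξ η hξ_sq hξ_mean
    hξ_var hη_sq hη_mean hη_span
  refine ⟨C, hC, ?_⟩
  intro Ω _ P _ N Y hN hNξ hNi hY hYη hYi hNY n hn hP t ht
  have hmap := GaltonWatson.map_marks ξ η P hN hNξ hNi hY hYη hYi hNY
  set L := GaltonWatson.genealogyLaw (ξ.prod η) with hL
  set Φ : Ω → List ℕ → ℕ × ℤ := fun ω v => (N v ω, Y v ω) with hΦ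
  have hΦm : Measurable Φ := by fun_prop
  set S := GaltonWatson.sizeEvent N n with hS
  have hSΦ : S = Φ ⁻¹' GaltonWatson.sizeSet n := rfl
  have hSm : MeasurableSet S := hΦm (GaltonWatson.measurableSet_sizeSet n)
  have hLS : L (GaltonWatson.sizeSet n) = P S := by
    rw [← hmap, Measure.map_apply hΦm (GaltonWatson.measurableSet_sizeSet n), hSΦ]
  have hLreal : L.real (GaltonWatson.sizeSet n) = P.real S := by
    rw [measureReal_def, hLS, measureReal_def]
  have hPreal : 0 < P.real S := ENNReal.toReal_pos hP.ne' (measure_ne_top _ _)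
  have hn0 : (0 : ℝ) < n := by exact_mod_cast hn
  -- The indicator makes `G` measurable and bounded on the whole space of genealogies, and changes
  -- nothing under the conditional law.
  set G : (List ℕ → ℕ × ℤ) → ℝ := fun c =>
    ‖(GaltonWatson.sizeSet n).indicator (GaltonWatson.expSum t) c‖ ^ 2 with hG
  have hGm : Measurable G := (GaltonWatson.measurable_indicator_expSum t n).norm.pow_const 2
  have hGle : ∀ c, ‖G c‖ ≤ (n : ℝ) ^ 2 := fun c => by
    by_cases hc : c ∈ GaltonWatson.sizeSet n
    · obtain ⟨hf, hcard⟩ := GaltonWatson.mem_sizeSet_iff.1 hc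
      have h := GaltonWatson.norm_expSum_le t hf
      rw [hcard] at h
      simp only [hG, Set.indicator_of_mem hc, norm_pow, norm_norm]
      gcongr
    · simp [hG, Set.indicator_of_notMem hc]
  have heq : ∀ ω ∈ S, ‖(1 / (n : ℂ)) * ∑' j : ℤ,
      (GaltonWatson.verticalProfile (fun v => N v ω) (fun v => Y v ω) j : ℂ)
        * Complex.exp (Complex.I * (j : ℂ) * (t : ℂ))‖ ^ 2 = (1 / (n : ℝ) ^ 2) * G (Φ ω) :=
    fun ω hω => by
      have hω' : Φ ω ∈ GaltonWatson.sizeSet n := hω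
      have h := GaltonWatson.norm_tsum_verticalProfile (Φ ω)
        (GaltonWatson.mem_sizeSet_iff.1 hω').1 t
      simp only [hΦ] at h
      rw [norm_mul, h, hG]
      simp only [Set.indicator_of_mem hω']
      rw [mul_pow]
      simp [hΦ]
  have hae : (fun ω => ‖(1 / (n : ℂ)) * ∑' j : ℤ,
      (GaltonWatson.verticalProfile (fun v => N v ω) (fun v => Y v ω) j : ℂ)
        * Complex.exp (Complex.I * (j : ℂ) * (t : ℂ))‖ ^ 2) =ᵐ[cond P S]
      fun ω => (1 / (n : ℝ) ^ 2) * G (Φ ω) := by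
    filter_upwards [ae_cond_mem hSm] with ω hω using heq ω hω
  have hint : Integrable (fun ω => (1 / (n : ℝ) ^ 2) * G (Φ ω)) (cond P S) :=
    (Integrable.of_bound (hGm.comp hΦm).aestronglyMeasurable (n ^ 2 : ℝ)
      (ae_of_all _ fun ω => hGle _)).const_mul _
  refine ⟨hint.congr hae.symm, ?_⟩
  have hset : ∫ ω in S, G (Φ ω) ∂P = ∫ c in GaltonWatson.sizeSet n,
      ‖GaltonWatson.expSum t c‖ ^ 2 ∂L := by
    have h1 : ∫ c in GaltonWatson.sizeSet n, G c ∂L = ∫ ω in S, G (Φ ω) ∂P := by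
      rw [← hmap, setIntegral_map (GaltonWatson.measurableSet_sizeSet n)
        hGm.aestronglyMeasurable hΦm.aemeasurable]
      rfl
    rw [← h1]
    refine setIntegral_congr_fun (GaltonWatson.measurableSet_sizeSet n) fun c hc => ?_
    simp only [hG, Set.indicator_of_mem hc]
  have hb := hbound n t hn (abs_le.2 ht) (by rwa [hLreal])
  rw [hLreal, ← hset] at hb
  rw [integral_congr_ae hae, integral_const_mul, ProbabilityTheory.cond, integral_smul_measure, ENNReal.toReal_inv,
    smul_eq_mul, ← measureReal_def]
  calc 1 / (n : ℝ) ^ 2 * ((P.real S)⁻¹ * ∫ ω in S, G (Φ ω) ∂P)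
      ≤ 1 / (n : ℝ) ^ 2 * ((P.real S)⁻¹ * (C / (1 + n * t ^ 4) * (n ^ 2 * P.real S))) := by
        gcongr
    _ = C / (1 + n * t ^ 4) := by field_simp
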